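/- Let $V$ be a finite-dimensional complex inner product space, $\mathcal H=L^2(S^1,V)$, $S^1=\mathbb R/2\pi\mathbb Z$, and let $\epsilon$ be the sign operator on $\mathcal H$: $\epsilon(e^{ikx}v)=e^{ikx}v$ for $k\ge 0$ and $\epsilon(e^{ikx}v)=-e^{ikx}v$ for $k<0$. For $r>0$ let $L_r$ be the Schatten class of bounded operators on $\mathcal H$ with $r$-summable singular numbers. For real $p\ge1$ put $\mathfrak{gl}_p=\{X\in\mathcal B(\mathcal H): [\epsilon,X]\in L_{2p}\}$ and $GL_p=\{g\in\mathcal B(\mathcal H)\text{ invertible}: [\epsilon,g]\in L_{2p}\}$. Let $\Omega^m$ be the space of bounded $X$ with $X+\epsilon X\epsilon\in L_{2p/m}$ (no condition if $m=0$), $X-\epsilon X\epsilon\in L_{2p/(m+1)}$ if $m$ is even, and with $X+\epsilon X\epsilon\in L_{2p/(m+1)}$, $X-\epsilon X\epsilon\in L_{2p/m}$ if $m$ is odd; so $\Omega^0=\mathfrak{gl}_p$. Put $dX=[\epsilon,X]$ for $X\in\Omega^m$, $m$ even, and $dX=\epsilon X+X\epsilon$ for $m$ odd. A flat connection is $B\in\Omega^1$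 with $dB+B^2=0$. For $A$ in $\Omega^m$ with $m$ odd and $A+\epsilon A\epsilon\in L_1$ put $\mathrm{Str}(A)=\tfrac12\mathrm{Tr}(A+\epsilon A\epsilon)$. For $k=1,2$, a $k$-cochain $\omega(X_1,\dots,X_k;B)\in\mathbb C$, $X_i\in\mathfrak{gl}_p$, $B\in\Omega^1$, is complex multilinear and alternating in the $X_i$, and differentiable at $t=0$ along all curves $t\mapsto e^{-tX}Be^{tX}+t\,dX$ with $X\in\mathfrak{gl}_p$. With $\mathcal L_Xf(B)=\frac{d}{dt}f(e^{-tX}Be^{tX}+t\,dX)|_{t=0}$, put $$(\delta\eta)(X,Y;B)=\mathcal L_X\eta(Y;B)-\mathcal L_Y\eta(X;B)-\eta([X,Y];B),$$ $$(\delta c)(X,Y,Z;B)=\mathcal L_Xc(Y,Z;B)-\mathcal L_Yc(X,Z;B)+\mathcal L_Zc(X,Y;B)-c([X,Y],Z;B)+c([X,Z],Y;B)-c([Y,Z],X;B).$$ A 2-cocycle is a 2-cochain $c$ with $(\delta c)(X,Y,Z;B)=0$ for all $X,Y,Z\in\mathfrak{gl}_p$ and all flat connections $B$. Let $n\ge0$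 be an integer with $n\ge p-1$ (for instance $n=p$ if $p$ is an integer), and define $$\tilde c_n(X,Y;B)=2^{2n}\,\mathrm{Str}\Big(\sum_{k=0}^{n}(-1)^k\big(B^{2n+1-k}XB^kY-B^{2n+1-k}YB^kX\big)\Big),\qquad \tilde\eta_n(X;B)=\mathrm{Str}(B^{2n+1}X).$$ Theorem. (1) For $X,Y\in\mathfrak{gl}_p$ and $B\in\Omega^1$ the operators under $\mathrm{Str}$ in $\tilde c_n$ and $\tilde\eta_n$, as well as $$W=\sum_{i+j+k=2n+1}(-1)^j\big(B^iXB^jYB^k-B^iYB^jXB^k\big),$$ belong to $\Omega^{2n+1}$; $A+\epsilon A\epsilon$ is trace class for every $A\in\Omega^{2n+1}$; and $\tilde c_n(X,Y;B)=\frac{2^{2n}}{2n+3}\mathrm{Str}(W)$. For $B=g^{-1}dg$, $W$ is the component $(g^{-1}Dg)^{2n+3}_{[2n+1,2]}(X,Y)$ of degree $2n+1$ in $d$ and degree $2$ in $\delta$ in the noncommutative BRST bicomplex with total differential $D=\delta\pm d$. If $g\in GL_p$ then $g^{-1}dg=g^{-1}[\epsilon,g]$ is a flat connection. (2) $\tilde\eta_n$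 is a 1-cochain, $\tilde c_n$ is a 2-cocycle, and $c_n:=\tilde c_n-2^{2n}\,\delta\tilde\eta_n$ is a 2-cocycle, cohomologous to $\tilde c_n$. (3) Let $\mathfrak g\subset\mathrm{End}(V)$ be a complex Lie subalgebra (such as the complexified Lie algebra of a compact group represented in $V$). Let $L_q\mathfrak g$ be either, for $q\ge\frac12$, the set of measurable essentially bounded loops $X:S^1\to\mathfrak g$ with Fourier coefficients satisfying $\sum_{k\in\mathbb Z}(1+k^2)^q|X_k|^2<\infty$, or, for $0<q<1$, the set of continuous loops $X:S^1\to\mathfrak g$ whose multiplication operator on $\mathcal H$ lies in $\mathfrak{gl}_{1/(2q)}$. If $p\ge\frac1{2q}$, then loops in $L_q\mathfrak g$, viewed as multiplication operators, lie in $\mathfrak{gl}_p$, and $c_n(X,Y;B)=0$ for all $X,Y\in L_q\mathfrak g$ and all flat connections $B$ whenever both $X$ and $Y$ have no Fourier modes of index $k>0$ (in particular if both are in $L_q\mathfrak g_-$), or both have no Fourier modes of index $k<0$ (in particular if both are in $L_q\mathfrak g_+$). -/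

import Mathlib

open MeasureTheory AddCircle

attribute [local instance] LieRing.ofAssociativeRing

noncomputable section

namespace FractionalLoop

/-! ### Schatten classes, trace and the graded differential algebra of a polarized Hilbert space -/

/-- The `n`-th singular number (`n = 0, 1, 2, …`) of a bounded Hilbert space operator: its
distance to the operators of rank at most `n`. -/
def singularNumber {H : Type*} [NormedAddCommGroup H] [InnerProductSpace ℂ H]
    (A : H →L[ℂ] H) (n : ℕ) : ℝ :=
  sInf {r : ℝ | ∃ F : H →L[ℂ] H, (F : H →ₗ[ℂ] H).rank ≤ (n : Cardinal) ∧ r = ‖A - F‖}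

/-- The Schatten class `L_r`, for a real exponent `r > 0`: the operators whose singular numbers
are `r`-summable. -/
def schatten (H : Type*) [NormedAddCommGroup H] [InnerProductSpace ℂ H] (r : ℝ) :
    Set (H →L[ℂ] H) :=
  {A | Summable fun n : ℕ => singularNumber A n ^ r}

/-- The trace of an operator, computed in an orthonormal basis of `H` (for trace class operators,
the elements of `L_1`, the choice of the basis is immaterial). -/
def trace {H : Type*} [NormedAddCommGroup H] [InnerProductSpace ℂ H] [CompleteSpace H]
    (A : H →L[ℂ] H) : ℂ :=
  ∑' i, inner ℂ ((exists_hilbertBasis ℂ H).choose_spec.choose i)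
    (A ((exists_hilbertBasis ℂ H).choose_spec.choose i))

/-- The differential on forms of even degree, `d X = [ε, X]`. -/
def dEven {H : Type*} [NormedAddCommGroup H] [InnerProductSpace ℂ H] (ε X : H →L[ℂ] H) :
    H →L[ℂ] H :=
  ε * X - X * ε

/-- The differential on forms of odd degree, `d X = {ε, X}`. -/
def dOdd {H : Type*} [NormedAddCommGroup H] [InnerProductSpace ℂ H] (ε X : H →L[ℂ] H) :
    H →L[ℂ] H :=
  ε * X + X * ε

/-- The Lie algebra `𝔤𝔩_p`: bounded operators `X` with `[ε, X] ∈ L_{2p}`. -/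
def gl {H : Type*} [NormedAddCommGroup H] [InnerProductSpace ℂ H] (ε : H →L[ℂ] H) (p : ℝ) :
    Set (H →L[ℂ] H) :=
  {X | dEven ε X ∈ schatten H (2 * p)}

/-- The space `Ω^m` of noncommutative `m`-forms.  For `m` even, `X + εXε ∈ L_{2p/m}` (no condition
for `m = 0`) and `X - εXε ∈ L_{2p/(m+1)}`; for `m` odd, `X + εXε ∈ L_{2p/(m+1)}` and
`X - εXε ∈ L_{2p/m}`. -/
def form {H : Type*} [NormedAddCommGroup H] [InnerProductSpace ℂ H] (ε : H →L[ℂ] H) (p : ℝ)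
    (m : ℕ) : Set (H →L[ℂ] H) :=
  {X | (Even m → (m ≠ 0 → X + ε * X * ε ∈ schatten H (2 * p / m)) ∧
          X - ε * X * ε ∈ schatten H (2 * p / (m + 1))) ∧
       (Odd m → X + ε * X * ε ∈ schatten H (2 * p / (m + 1)) ∧
          X - ε * X * ε ∈ schatten H (2 * p / m))}

/-- Flat connections: the forms `B ∈ Ω^1` with `dB + B² = 0`. -/
def flat {H : Type*} [NormedAddCommGroup H] [InnerProductSpace ℂ H] (ε : H →L[ℂ] H) (p : ℝ) :
    Set (H →L[ℂ] H) :=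
  {B | B ∈ form ε p 1 ∧ dOdd ε B + B * B = 0}

/-- The supertrace on forms of odd degree (grading operator `Γ = 1`), that is the conditional
trace `½ Tr (A + εAε)`. -/
def str {H : Type*} [NormedAddCommGroup H] [InnerProductSpace ℂ H] [CompleteSpace H]
    (ε A : H →L[ℂ] H) : ℂ :=
  (1 / 2 : ℂ) * trace (A + ε * A * ε)

/-! ### The Lie algebra cochain complex with values in functions of `B ∈ Ω^1` -/

/-- The curve `t ↦ e^{-tX} B e^{tX} + t dX`. -/
def gaugeCurve {H : Type*} [NormedAddCommGroup H] [InnerProductSpace ℂ H] [CompleteSpace H]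
    (ε X B : H →L[ℂ] H) (t : ℝ) : H →L[ℂ] H :=
  NormedSpace.exp (-((t : ℂ) • X)) * B * NormedSpace.exp ((t : ℂ) • X) + (t : ℂ) • dEven ε X

/-- The Lie derivative `𝓛_X f (B) = d/dt f (e^{-tX} B e^{tX} + t dX)` at `t = 0`. -/
def lieDeriv {H : Type*} [NormedAddCommGroup H] [InnerProductSpace ℂ H] [CompleteSpace H]
    (ε X : H →L[ℂ] H) (f : (H →L[ℂ] H) → ℂ) (B : H →L[ℂ] H) : ℂ :=
  deriv (fun t : ℝ => f (gaugeCurve ε X B t)) 0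

/-- Palais' formula for the coboundary of a 1-cochain. -/
def coboundary₁ {H : Type*} [NormedAddCommGroup H] [InnerProductSpace ℂ H] [CompleteSpace H]
    (ε : H →L[ℂ] H) (η : (H →L[ℂ] H) → (H →L[ℂ] H) → ℂ) (X Y B : H →L[ℂ] H) : ℂ :=
  lieDeriv ε X (η Y) B - lieDeriv ε Y (η X) B - η (X * Y - Y * X) B

/-- Palais' formula for the coboundary of a 2-cochain. -/
def coboundary₂ {H : Type*} [NormedAddCommGroup H] [InnerProductSpace ℂ H] [CompleteSpace H]
    (ε : H →L[ℂ] H) (c : (H →L[ℂ] H) → (H →L[ℂ] H) → (H →L[ℂ] H) → ℂ)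
    (X Y Z B : H →L[ℂ] H) : ℂ :=
  lieDeriv ε X (c Y Z) B - lieDeriv ε Y (c X Z) B + lieDeriv ε Z (c X Y) B
    - c (X * Y - Y * X) Z B + c (X * Z - Z * X) Y B - c (Y * Z - Z * Y) X B

/-- `η` is a 1-cochain on `𝔤𝔩_p` with values in the functions on `Ω^1` that are differentiable
along the gauge action. -/
def IsCochain₁ {H : Type*} [NormedAddCommGroup H] [InnerProductSpace ℂ H] [CompleteSpace H]
    (ε : H →L[ℂ] H) (p : ℝ) (η : (H →L[ℂ] H) → (H →L[ℂ] H) → ℂ) : Prop :=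
  ∀ B ∈ form ε p 1,
    (∀ X ∈ gl ε p, ∀ X' ∈ gl ε p, ∀ a : ℂ, η (a • X + X') B = a * η X B + η X' B) ∧
    (∀ X ∈ gl ε p, ∀ Z ∈ gl ε p,
      DifferentiableAt ℝ (fun t : ℝ => η X (gaugeCurve ε Z B t)) 0)

/-- `c` is a 2-cochain on `𝔤𝔩_p` (alternating and bilinear) with values in the functions on `Ω^1`
that are differentiable along the gauge action. -/
def IsCochain₂ {H : Type*} [NormedAddCommGroup H] [InnerProductSpace ℂ H] [CompleteSpace H]
    (ε : H →L[ℂ] H) (p : ℝ) (c : (H →L[ℂ] H) → (H →L[ℂ] H) → (H →L[ℂ] H) → ℂ) : Prop :=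
  ∀ B ∈ form ε p 1,
    (∀ X ∈ gl ε p, ∀ X' ∈ gl ε p, ∀ Y ∈ gl ε p, ∀ a : ℂ,
      c (a • X + X') Y B = a * c X Y B + c X' Y B) ∧
    (∀ X ∈ gl ε p, ∀ Y ∈ gl ε p, ∀ Y' ∈ gl ε p, ∀ a : ℂ,
      c X (a • Y + Y') B = a * c X Y B + c X Y' B) ∧
    (∀ X ∈ gl ε p, c X X B = 0) ∧
    (∀ X ∈ gl ε p, ∀ Y ∈ gl ε p, ∀ Z ∈ gl ε p,
      DifferentiableAt ℝ (fun t : ℝ => c X Y (gaugeCurve ε Z B t)) 0)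

/-- The 2-cocycle condition, at all flat connections. -/
def IsCocycle₂ {H : Type*} [NormedAddCommGroup H] [InnerProductSpace ℂ H] [CompleteSpace H]
    (ε : H →L[ℂ] H) (p : ℝ) (c : (H →L[ℂ] H) → (H →L[ℂ] H) → (H →L[ℂ] H) → ℂ) : Prop :=
  ∀ X ∈ gl ε p, ∀ Y ∈ gl ε p, ∀ Z ∈ gl ε p, ∀ B ∈ flat ε p, coboundary₂ ε c X Y Z B = 0

/-! ### The explicit cochains -/

/-- The component `(B + θ)^{2n+3}_{[2n+1,2]}(X,Y)`, where `B = g⁻¹dg` and `θ = g⁻¹δg`, so that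
`g⁻¹Dg = B + θ` and `θ(X) = X`.  It is the sum of the words `B^i θ B^j θ B^k`, `i + j + k = 2n + 1`,
and in the bicomplex `(B^i θ B^j θ B^k)(X,Y) = (-1)^j (B^i X B^j Y B^k - B^i Y B^j X B^k)`. -/
def brstComponent {H : Type*} [NormedAddCommGroup H] [InnerProductSpace ℂ H] (n : ℕ)
    (X Y B : H →L[ℂ] H) : H →L[ℂ] H :=
  ∑ a ∈ Finset.HasAntidiagonal.antidiagonal (2 * n + 1),
    ∑ b ∈ Finset.HasAntidiagonal.antidiagonal a.2,
    (-1 : ℂ) ^ b.1 •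
      (B ^ a.1 * X * B ^ b.1 * Y * B ^ b.2 - B ^ a.1 * Y * B ^ b.1 * X * B ^ b.2)

/-- The form `∑_{k=0}^n (-1)^k (B^{2n+1-k} X B^k Y - B^{2n+1-k} Y B^k X)`. -/
def cTildeForm {H : Type*} [NormedAddCommGroup H] [InnerProductSpace ℂ H] (n : ℕ)
    (X Y B : H →L[ℂ] H) : H →L[ℂ] H :=
  ∑ k ∈ Finset.range (n + 1), (-1 : ℂ) ^ k •
    (B ^ (2 * n + 1 - k) * X * B ^ k * Y - B ^ (2 * n + 1 - k) * Y * B ^ k * X)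

/-- The 2-cochain `c̃_n(X,Y;B)`. -/
def cTilde {H : Type*} [NormedAddCommGroup H] [InnerProductSpace ℂ H] [CompleteSpace H]
    (ε : H →L[ℂ] H) (n : ℕ) (X Y B : H →L[ℂ] H) : ℂ :=
  2 ^ (2 * n) * str ε (cTildeForm n X Y B)

/-- The 1-cochain `η̃_n(X;B) = Str (B^{2n+1} X)`. -/
def etaTilde {H : Type*} [NormedAddCommGroup H] [InnerProductSpace ℂ H] [CompleteSpace H]
    (ε : H →L[ℂ] H) (n : ℕ) (X B : H →L[ℂ] H) : ℂ :=
  str ε (B ^ (2 * n + 1) * X)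

/-! ### The circle, the sign operator and fractional loop algebras -/

instance factTwoPi : Fact (0 < 2 * Real.pi) := ⟨Real.two_pi_pos⟩

/-- The circle `ℝ / 2πℤ`. -/
abbrev Circ : Type := AddCircle (2 * Real.pi)

/-- The normalized invariant measure of the circle. -/
abbrev haar : Measure Circ := haarAddCircle

/-- The Hilbert space `L²(S¹, V)`. -/
abbrev Hilb (V : Type*) [NormedAddCommGroup V] : Type _ := Lp V 2 haar

/-- The element `x ↦ e^{ikx} v` of `L²(S¹, V)`. -/
def mode {V : Type*} [NormedAddCommGroup V] [InnerProductSpace ℂ V] (k : ℤ) (v : V) : Hilb V :=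
  ContinuousMap.toLp (E := V) 2 haar ℂ ⟨fun x : Circ => fourier k x • v, by fun_prop⟩

/-- The closed subspace `H₊` spanned by the Fourier modes of index `k ≥ 0`. -/
def hPlus (V : Type*) [NormedAddCommGroup V] [InnerProductSpace ℂ V] [CompleteSpace V] :
    Submodule ℂ (Hilb V) :=
  (Submodule.span ℂ {ψ | ∃ k : ℤ, 0 ≤ k ∧ ∃ v : V, ψ = mode k v}).topologicalClosure

instance hPlus_complete (V : Type*) [NormedAddCommGroup V] [InnerProductSpace ℂ V]
    [CompleteSpace V] : CompleteSpace (hPlus V) :=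
  (Submodule.isClosed_topologicalClosure _).completeSpace_coe

/-- The sign operator `ε` on `L²(S¹, V)`: it is `1` on `H₊` and `-1` on `H₋ = H₊ᗮ`, the closed span
of the Fourier modes of index `k < 0`. -/
def signOp (V : Type*) [NormedAddCommGroup V] [InnerProductSpace ℂ V] [CompleteSpace V] :
    Hilb V →L[ℂ] Hilb V :=
  (2 : ℂ) • (hPlus V).starProjection - 1

/-- The essentially bounded measurable loops in `End V`. -/
abbrev LInfty (V : Type*) [NormedAddCommGroup V] [InnerProductSpace ℂ V] : Type _ :=
  Lp (V →L[ℂ] V) ⊤ haar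

/-- The multiplication operator `(M_X ψ)(x) = X(x) ψ(x)` on `L²(S¹, V)`. -/
def mulOp {V : Type*} [NormedAddCommGroup V] [InnerProductSpace ℂ V] (X : LInfty V) :
    Hilb V →L[ℂ] Hilb V :=
  (ContinuousLinearMap.id ℂ (V →L[ℂ] V)).holderL haar ⊤ 2 2 X

/-- The Sobolev form of `L_q 𝔤`: bounded loops `X` in `𝔤` with `∑_k (1 + k²)^q |X_k|² < ∞`. -/
def sobolevLoops {V : Type*} [NormedAddCommGroup V] [InnerProductSpace ℂ V]
    (𝔤 : LieSubalgebra ℂ (V →L[ℂ] V)) (q : ℝ) : Set (LInfty V) :=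
  {X | (∀ᵐ x ∂haar, X x ∈ 𝔤) ∧
    Summable fun k : ℤ => (1 + (k : ℝ) ^ 2) ^ q * ‖fourierCoeff (X : Circ → V →L[ℂ] V) k‖ ^ 2}

/-- The second form of `L_q 𝔤`: continuous loops in `𝔤` that lie in `𝔤𝔩_{1/(2q)}`. -/
def continuousLoops {V : Type*} [NormedAddCommGroup V] [InnerProductSpace ℂ V] [CompleteSpace V]
    (𝔤 : LieSubalgebra ℂ (V →L[ℂ] V)) (q : ℝ) : Set (LInfty V) :=
  {X | (∃ f : C(Circ, V →L[ℂ] V), (∀ x, f x ∈ 𝔤) ∧ (X : Circ → V →L[ℂ] V) =ᵐ[haar] f) ∧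
    mulOp X ∈ gl (signOp V) (1 / (2 * q))}

/-- `L` is the fractional loop algebra `L_q 𝔤`, defined through the Sobolev norm (`1/2 ≤ q`) or as
an algebra of continuous loops (`0 < q < 1`). -/
def IsFractionalLoopAlgebra {V : Type*} [NormedAddCommGroup V] [InnerProductSpace ℂ V]
    [CompleteSpace V] (𝔤 : LieSubalgebra ℂ (V →L[ℂ] V)) (q : ℝ) (L : Set (LInfty V)) : Prop :=
  (1 / 2 ≤ q ∧ L = sobolevLoops 𝔤 q) ∨ (0 < q ∧ q < 1 ∧ L = continuousLoops 𝔤 q)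

/-- Loops without Fourier modes of index `k > 0`. -/
def negativeLoops (V : Type*) [NormedAddCommGroup V] [InnerProductSpace ℂ V] : Set (LInfty V) :=
  {X | ∀ k : ℤ, 0 < k → fourierCoeff (X : Circ → V →L[ℂ] V) k = 0}

/-- Loops without Fourier modes of index `k < 0`. -/
def positiveLoops (V : Type*) [NormedAddCommGroup V] [InnerProductSpace ℂ V] : Set (LInfty V) :=
  {X | ∀ k : ℤ, k < 0 → fourierCoeff (X : Circ → V →L[ℂ] V) k = 0}

end FractionalLoop

end

open FractionalLoop

/-! The proof is a formal computation with a trace, resting on an analytic layer that makes the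
supertrace cyclic and differentiable.

Analysis. Schatten classes are handled through domination: an approximant of rank at most `n` with
error at most `a n`, for every `n`. One sequence `a` may dominate a whole family, which is the
uniformity needed for differentiation. Sums and products split the rank budget, so Hölder's
inequality becomes a statement about sequences, and dyadic telescoping of the approximants bounds
the diagonal sums. Since `p ≤ n + 1`, even parts of forms of degree `2n + 1` are trace class. On
such forms the supertrace is linear (`exists_linear_str`), bounded on dominated families, cyclic
(`str_mul_comm`), and it kills `dEven` (`str_dEven`). The gauge curve has a first order expansion in
the forms with uniformly bounded remainder (`jet_gaugeCurve`), and such expansions survive sums,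
products and the supertrace.

Algebra. In power series in `s` put `b = sB`, `k = (1 - b²)⁻¹`, `e = sε`, so that the power of `s`
records the form degree. The coefficients at `s ^ (2n + 1)` of `k[b, x]ky` and `kbx` give c̃_n (up
to the factor `2 ^ (2n)`) and η̃_n under the supertrace. The gauge direction of `x` is `[e + b, x]`,
and flatness reads `eb = -be - b²`, whence `e` commutes with `k`. Let `T` be the supertrace of that
coefficient. The supertrace of a commutator `[e, w]` vanishes; applying this to the words of
`wardElt` and antisymmetrising gives the cocycle identity (`trace_coboundary_cocycleElt`). That δδη̃
= 0 is formal and needs no flatness (`dCoboundaryElt_cyclic`). Two shorter identities of the same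
kind give `c - δη = -2 T(k dx k y)` (`cReduced_eq`), that is, c_n(X,Y;B) is `-2 ^ (2n + 1)` times
the sum over `i + j = n` of Str(B^{2i} dX B^{2j} Y).

Vanishing. The matrix of `[ε, M_X]` in Fourier modes has entries `(sgn l - sgn k) X_{l-k}`. If `X`
has modes on one side only, a single off-diagonal block survives, so `ε dX = s dX` with `s = ±1`. As
B^{2i} commutes with `ε`, equality of the signs for `X` and `Y` makes the even part of each summand
zero (`even_part_eq_zero`). In the Sobolev case `[ε, M_X]` is Hilbert–Schmidt, since the sign
changes between `k` and `k + m` for `|m|` values of `k`; the continuous case is inclusion of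
Schatten classes. -/

namespace FractionalLoop

/-! ### Operators dominated by a sequence -/

section Dominated

variable {H : Type*} [NormedAddCommGroup H] [InnerProductSpace ℂ H]

/-- `A` is dominated by the sequence `a` if for each `n` it is within distance `a n` of an operator
of rank at most `n`. -/
def Dominated (a : ℕ → ℝ) (A : H →L[ℂ] H) : Prop :=
  ∀ n : ℕ, ∃ F : H →L[ℂ] H, (F : H →ₗ[ℂ] H).rank ≤ (n : Cardinal) ∧ ‖A - F‖ ≤ a n

theorem rank_zero_le (n : ℕ) : ((0 : H →L[ℂ] H) : H →ₗ[ℂ] H).rank ≤ (n : Cardinal) := by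
  simp

theorem rank_add_le_natCast {F G : H →L[ℂ] H} {m n : ℕ}
    (hF : (F : H →ₗ[ℂ] H).rank ≤ (m : Cardinal)) (hG : (G : H →ₗ[ℂ] H).rank ≤ (n : Cardinal)) :
    ((F + G : H →L[ℂ] H) : H →ₗ[ℂ] H).rank ≤ ((m + n : ℕ) : Cardinal) := by
  rw [ContinuousLinearMap.toLinearMap_add, Nat.cast_add]
  exact (LinearMap.rank_add_le _ _).trans (add_le_add hF hG)

theorem rank_mul_le_left {F : H →L[ℂ] H} {m : ℕ} (G : H →L[ℂ] H)
    (hF : (F : H →ₗ[ℂ] H).rank ≤ (m : Cardinal)) :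
    ((F * G : H →L[ℂ] H) : H →ₗ[ℂ] H).rank ≤ (m : Cardinal) :=
  (LinearMap.rank_comp_le_left (G : H →ₗ[ℂ] H) (F : H →ₗ[ℂ] H)).trans hF

theorem rank_mul_le_right {F : H →L[ℂ] H} {m : ℕ} (G : H →L[ℂ] H)
    (hF : (F : H →ₗ[ℂ] H).rank ≤ (m : Cardinal)) :
    ((G * F : H →L[ℂ] H) : H →ₗ[ℂ] H).rank ≤ (m : Cardinal) :=
  (LinearMap.rank_comp_le_right (F : H →ₗ[ℂ] H) (G : H →ₗ[ℂ] H)).trans hF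

theorem rank_smul_le {F : H →L[ℂ] H} {m : ℕ} (c : ℂ)
    (hF : (F : H →ₗ[ℂ] H).rank ≤ (m : Cardinal)) :
    ((c • F : H →L[ℂ] H) : H →ₗ[ℂ] H).rank ≤ (m : Cardinal) := by
  have h : c • F = (c • (1 : H →L[ℂ] H)) * F := by simp
  rw [h]
  exact rank_mul_le_right _ hF

theorem rank_sub_le_natCast {F G : H →L[ℂ] H} {m n : ℕ}
    (hF : (F : H →ₗ[ℂ] H).rank ≤ (m : Cardinal)) (hG : (G : H →ₗ[ℂ] H).rank ≤ (n : Cardinal)) :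
    ((F - G : H →L[ℂ] H) : H →ₗ[ℂ] H).rank ≤ ((m + n : ℕ) : Cardinal) := by
  have h : F - G = F + (-1 : ℂ) • G := by rw [neg_one_smul, sub_eq_add_neg]
  rw [h]
  exact rank_add_le_natCast hF (rank_smul_le _ hG)

theorem rank_sum_le {F : ℕ → H →L[ℂ] H} {m : ℕ → ℕ}
    (hF : ∀ k, (F k : H →ₗ[ℂ] H).rank ≤ (m k : Cardinal)) (K : ℕ) :
    ((∑ k ∈ Finset.range K, F k : H →L[ℂ] H) : H →ₗ[ℂ] H).rank ≤
      ((∑ k ∈ Finset.range K, m k : ℕ) : Cardinal) := by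
  induction K with
  | zero => simp
  | succ K ih =>
    rw [Finset.sum_range_succ, Finset.sum_range_succ]
    exact rank_add_le_natCast ih (hF K)

theorem rank_mono {F : H →L[ℂ] H} {m n : ℕ} (h : m ≤ n)
    (hF : (F : H →ₗ[ℂ] H).rank ≤ (m : Cardinal)) : (F : H →ₗ[ℂ] H).rank ≤ (n : Cardinal) :=
  hF.trans (Nat.cast_le.2 h)

theorem Dominated.mono {a b : ℕ → ℝ} {A : H →L[ℂ] H} (h : Dominated a A) (hab : ∀ n, a n ≤ b n) :
    Dominated b A := fun n => by
  obtain ⟨F, hF, hn⟩ := h n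
  exact ⟨F, hF, hn.trans (hab n)⟩

theorem dominated_norm (A : H →L[ℂ] H) : Dominated (fun _ => ‖A‖) A := fun n =>
  ⟨0, rank_zero_le n, by simp⟩

theorem Dominated.norm_le {a : ℕ → ℝ} {A : H →L[ℂ] H} (h : Dominated a A) : ‖A‖ ≤ a 0 := by
  obtain ⟨F, hF, hn⟩ := h 0
  have : F = 0 := by
    have h0 : (F : H →ₗ[ℂ] H).rank = 0 := by simpa using hF
    rw [LinearMap.rank, Submodule.rank_eq_zero, LinearMap.range_eq_bot] at h0
    ext x
    exact congrArg (fun f : H →ₗ[ℂ] H => f x) h0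
  simpa [this] using hn

/-- Where `a n` exceeds the norm bound, zero is a good enough approximant. Capping the sequence in
this way makes traces small when norms are small. -/
theorem Dominated.inf_norm {a : ℕ → ℝ} {A : H →L[ℂ] H} (h : Dominated a A) {r : ℝ} (hr : ‖A‖ ≤ r) :
    Dominated (fun n => min (a n) r) A := fun n => by
  rcases le_total (a n) r with h1 | h1
  · simpa [h1] using h n
  · exact ⟨0, rank_zero_le n, by simpa [h1] using hr⟩

theorem dominated_zero {a : ℕ → ℝ} (ha : ∀ n, 0 ≤ a n) : Dominated a (0 : H →L[ℂ] H) := fun n =>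
  ⟨0, rank_zero_le n, by simpa using ha n⟩

/-- The rank budget `n` is divided equally between the two approximants, which is the origin of the
index `n / 2`. -/
theorem Dominated.add {a b : ℕ → ℝ} {A B : H →L[ℂ] H} (hA : Dominated a A) (hB : Dominated b B) :
    Dominated (fun n => a (n / 2) + b (n / 2)) (A + B) := fun n => by
  obtain ⟨F, hF, hn⟩ := hA (n / 2)
  obtain ⟨G, hG, hm⟩ := hB (n / 2)
  refine ⟨F + G, rank_mono (by omega) (rank_add_le_natCast hF hG), ?_⟩
  have : A + B - (F + G) = (A - F) + (B - G) := by abel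
  rw [this]
  exact (norm_add_le _ _).trans (add_le_add hn hm)

theorem Dominated.smul {a : ℕ → ℝ} {A : H →L[ℂ] H} (hA : Dominated a A) {c : ℂ}
    {C : ℝ} (hc : ‖c‖ ≤ C) : Dominated (fun n => C * a n) (c • A) := fun n => by
  obtain ⟨F, hF, hn⟩ := hA n
  refine ⟨c • F, rank_smul_le _ hF, ?_⟩
  rw [← smul_sub, norm_smul]
  exact mul_le_mul hc hn (norm_nonneg _) ((norm_nonneg _).trans hc)

/-- The approximant `F * B + (A - F) * G` leaves exactly the error `(A - F) * (B - G)`, so errors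
multiply while ranks add. -/
theorem Dominated.mul {a b : ℕ → ℝ} {A B : H →L[ℂ] H} (hA : Dominated a A) (hB : Dominated b B)
    (ha : ∀ n, 0 ≤ a n) : Dominated (fun n => a (n / 2) * b (n / 2)) (A * B) := fun n => by
  obtain ⟨F, hF, hn⟩ := hA (n / 2)
  obtain ⟨G, hG, hm⟩ := hB (n / 2)
  refine ⟨F * B + (A - F) * G,
    rank_mono (by omega) (rank_add_le_natCast (rank_mul_le_left B hF) (rank_mul_le_right _ hG)), ?_⟩
  have : A * B - (F * B + (A - F) * G) = (A - F) * (B - G) := by noncomm_ring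
  rw [this]
  exact (norm_mul_le _ _).trans (mul_le_mul hn hm (norm_nonneg _) (ha _))

/-! ### Singular numbers compared with dominating sequences. -/

theorem singularNumber_set_bddBelow (A : H →L[ℂ] H) (n : ℕ) :
    BddBelow {r : ℝ | ∃ F : H →L[ℂ] H, (F : H →ₗ[ℂ] H).rank ≤ (n : Cardinal) ∧ r = ‖A - F‖} :=
  ⟨0, by rintro r ⟨F, -, rfl⟩; exact norm_nonneg _⟩

theorem singularNumber_set_nonempty (A : H →L[ℂ] H) (n : ℕ) :
    {r : ℝ | ∃ F : H →L[ℂ] H, (F : H →ₗ[ℂ] H).rank ≤ (n : Cardinal) ∧ r = ‖A - F‖}.Nonempty :=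
  ⟨_, 0, rank_zero_le n, rfl⟩

theorem singularNumber_nonneg (A : H →L[ℂ] H) (n : ℕ) : 0 ≤ singularNumber A n :=
  le_csInf (singularNumber_set_nonempty A n) (by rintro r ⟨F, -, rfl⟩; exact norm_nonneg _)

theorem singularNumber_le {A F : H →L[ℂ] H} {n : ℕ} (hF : (F : H →ₗ[ℂ] H).rank ≤ (n : Cardinal)) :
    singularNumber A n ≤ ‖A - F‖ :=
  csInf_le (singularNumber_set_bddBelow A n) ⟨F, hF, rfl⟩

theorem singularNumber_antitone (A : H →L[ℂ] H) : Antitone (singularNumber A) := by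
  intro m n h
  refine le_csInf (singularNumber_set_nonempty A m) ?_
  rintro r ⟨F, hF, rfl⟩
  exact singularNumber_le (rank_mono h hF)

theorem Dominated.singularNumber_le {a : ℕ → ℝ} {A : H →L[ℂ] H} (h : Dominated a A) (n : ℕ) :
    singularNumber A n ≤ a n := by
  obtain ⟨F, hF, hn⟩ := h n
  exact (FractionalLoop.singularNumber_le hF).trans hn

/-- The infimum defining a singular number is not shown to be attained; an arbitrary positive slack
produces an approximant. -/
theorem dominated_singularNumber_add (A : H →L[ℂ] H) {δ : ℕ → ℝ} (hδ : ∀ n, 0 < δ n) :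
    Dominated (fun n => singularNumber A n + δ n) A := fun n => by
  obtain ⟨r, ⟨F, hF, rfl⟩, hlt⟩ := exists_lt_of_csInf_lt (singularNumber_set_nonempty A n)
    (lt_add_of_pos_right (singularNumber A n) (hδ n))
  exact ⟨F, hF, hlt.le⟩

end Dominated

/-! ### Summability of powers of nonnegative sequences -/

section Sequences

/-- Division with remainder identifies `ℕ` with `ℕ × Fin m`, so each value of `f` is counted `m`
times. -/
theorem hasSum_comp_div {f : ℕ → ℝ} (hf : Summable f) (h0 : ∀ n, 0 ≤ f n) (m : ℕ) [NeZero m] :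
    HasSum (fun n => f (n / m)) (m * ∑' n, f n) := by
  have h1 : HasSum (fun x : ℕ × Fin m => f x.1 * 1) ((∑' n, f n) * ∑ _i : Fin m, (1 : ℝ)) := by
    have hs : Summable fun x : ℕ × Fin m => f x.1 * (1 : ℝ) :=
      hf.mul_of_nonneg (hasSum_fintype fun _ : Fin m => (1 : ℝ)).summable h0 (fun _ => zero_le_one)
    exact hf.hasSum.mul (hasSum_fintype fun _ : Fin m => (1 : ℝ)) hs
  rw [← (Nat.divModEquiv m).hasSum_iff] at h1
  simpa [Function.comp_def, Nat.divModEquiv, mul_comm] using h1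

theorem summable_rpow_mono {a : ℕ → ℝ} (h0 : ∀ n, 0 ≤ a n) {r s : ℝ} (hr : 0 < r) (hrs : r ≤ s)
    (h : Summable fun n => a n ^ r) : Summable fun n => a n ^ s := by
  have ht := h.tendsto_atTop_zero
  have hev : ∀ᶠ n in Filter.atTop, a n ^ r ≤ 1 := ht.eventually_le_const one_pos
  rw [← Nat.cofinite_eq_atTop] at hev
  refine Summable.of_norm_bounded_eventually h ?_
  filter_upwards [hev] with n hn
  have h1 : a n ≤ 1 := by
    by_contra hlt
    push Not at hlt
    exact absurd hn (not_le.2 (Real.one_lt_rpow hlt hr))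
  rw [Real.norm_of_nonneg (Real.rpow_nonneg (h0 n) s)]
  rcases (h0 n).eq_or_lt with h2 | h2
  · rw [← h2, Real.zero_rpow (by linarith), Real.zero_rpow (by linarith)]
  · exact Real.rpow_le_rpow_of_exponent_ge h2 h1 hrs

theorem add_rpow_le_mul {x y r : ℝ} (hx : 0 ≤ x) (hy : 0 ≤ y) (hr : 0 ≤ r) :
    (x + y) ^ r ≤ 2 ^ r * (x ^ r + y ^ r) := by
  have h1 : x + y ≤ 2 * max x y := by
    have := le_max_left x y
    have := le_max_right x y
    linarith
  have h2 : (max x y) ^ r ≤ x ^ r + y ^ r := by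
    rcases le_total x y with h | h
    · rw [max_eq_right h]; linarith [Real.rpow_nonneg hx r]
    · rw [max_eq_left h]; linarith [Real.rpow_nonneg hy r]
  calc (x + y) ^ r ≤ (2 * max x y) ^ r := Real.rpow_le_rpow (by positivity) h1 hr
    _ = 2 ^ r * (max x y) ^ r := Real.mul_rpow (by norm_num) (le_max_of_le_left hx)
    _ ≤ _ := by gcongr

theorem summable_add_rpow {a b : ℕ → ℝ} (ha : ∀ n, 0 ≤ a n) (hb : ∀ n, 0 ≤ b n) {r : ℝ} (hr : 0 ≤ r)
    (hsa : Summable fun n => a n ^ r) (hsb : Summable fun n => b n ^ r) :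
    Summable fun n => (a n + b n) ^ r :=
  Summable.of_nonneg_of_le (fun n => Real.rpow_nonneg (add_nonneg (ha n) (hb n)) r)
    (fun n => add_rpow_le_mul (ha n) (hb n) hr) ((hsa.add hsb).mul_left _)

/-- Weighted AM–GM with weights `i / (i + j)` and `j / (i + j)`. This is the termwise form of
Hölder's inequality that makes Schatten levels add under products. -/
theorem mul_rpow_div_le {x y P i j : ℝ} (hx : 0 ≤ x) (hy : 0 ≤ y) (hi : 0 < i) (hj : 0 < j) :
    (x * y) ^ (P / (i + j)) ≤ x ^ (P / i) + y ^ (P / j) := by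
  have h := Real.geom_mean_le_arith_mean2_weighted (w₁ := i / (i + j)) (w₂ := j / (i + j))
    (by positivity) (by positivity) (Real.rpow_nonneg hx (P / i)) (Real.rpow_nonneg hy (P / j))
    (by field_simp)
  rw [← Real.rpow_mul hx, ← Real.rpow_mul hy] at h
  have e1 : P / i * (i / (i + j)) = P / (i + j) := by field_simp
  have e2 : P / j * (j / (i + j)) = P / (i + j) := by field_simp
  rw [e1, e2, ← Real.mul_rpow hx hy] at h
  refine h.trans (add_le_add ?_ ?_)
  · refine mul_le_of_le_one_left (Real.rpow_nonneg hx _) ?_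
    rw [div_le_one (by positivity)]; linarith
  · refine mul_le_of_le_one_left (Real.rpow_nonneg hy _) ?_
    rw [div_le_one (by positivity)]; linarith

end Sequences

/-! ### Bounded families in the Schatten classes `L_{2p/m}` -/

/-- A nonincreasing nonnegative sequence which is `2p/m`-summable (no condition if `m = 0`). -/
structure IsLevel (p : ℝ) (m : ℕ) (a : ℕ → ℝ) : Prop where
  anti : Antitone a
  nonneg : ∀ n, 0 ≤ a n
  summable : m ≠ 0 → Summable fun n => a n ^ (2 * p / m)

section Level

variable {p : ℝ} {m m' : ℕ} {a b : ℕ → ℝ}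

theorem IsLevel.mono (hp : 1 ≤ p) (h : IsLevel p m' a) (hm : m ≤ m') : IsLevel p m a := by
  refine ⟨h.anti, h.nonneg, fun h0 => ?_⟩
  have hm0 : (0 : ℝ) < m := by exact_mod_cast Nat.pos_of_ne_zero h0
  have hm1 : (0 : ℝ) < m' := by exact_mod_cast (Nat.pos_of_ne_zero h0).trans_le hm
  refine summable_rpow_mono h.nonneg (by positivity) ?_ (h.summable (by omega))
  have : (m : ℝ) ≤ m' := by exact_mod_cast hm
  gcongr

theorem IsLevel.comp_div (h : IsLevel p m a) : IsLevel p m (fun n => a (n / 2)) := by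
  refine ⟨fun i j hij => h.anti (Nat.div_le_div_right hij), fun n => h.nonneg _, fun h0 => ?_⟩
  exact (hasSum_comp_div (h.summable h0) (fun n => Real.rpow_nonneg (h.nonneg n) _) 2).summable

theorem IsLevel.add (hp : 1 ≤ p) (ha : IsLevel p m a) (hb : IsLevel p m b) :
    IsLevel p m (fun n => a n + b n) := by
  refine ⟨fun i j hij => add_le_add (ha.anti hij) (hb.anti hij),
    fun n => add_nonneg (ha.nonneg n) (hb.nonneg n), fun h0 => ?_⟩
  exact summable_add_rpow ha.nonneg hb.nonneg (by positivity) (ha.summable h0) (hb.summable h0)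

theorem IsLevel.const_mul (ha : IsLevel p m a) {C : ℝ} (hC : 0 ≤ C) :
    IsLevel p m (fun n => C * a n) := by
  refine ⟨fun i j hij => mul_le_mul_of_nonneg_left (ha.anti hij) hC,
    fun n => mul_nonneg hC (ha.nonneg n), fun h0 => ?_⟩
  simp only [Real.mul_rpow hC (ha.nonneg _)]
  exact (ha.summable h0).mul_left _

theorem IsLevel.mul (hp : 1 ≤ p) (ha : IsLevel p m a) (hb : IsLevel p m' b) :
    IsLevel p (m + m') (fun n => a n * b n) := by
  refine ⟨fun i j hij => mul_le_mul (ha.anti hij) (hb.anti hij) (hb.nonneg _) (ha.nonneg _),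
    fun n => mul_nonneg (ha.nonneg n) (hb.nonneg n), fun h0 => ?_⟩
  -- Level `0` carries no summability, so a factor of level `0` is bounded by its value at index
  -- `0`.
  have aux : ∀ {m : ℕ} {a b : ℕ → ℝ}, IsLevel p m a → Antitone b → (∀ n, 0 ≤ b n) → m ≠ 0 →
      Summable fun n => (a n * b n) ^ (2 * p / m) := by
    intro m a b ha hb hb0 hm
    refine Summable.of_nonneg_of_le
      (fun n => Real.rpow_nonneg (mul_nonneg (ha.nonneg n) (hb0 n)) _) (fun n => ?_)
      ((ha.summable hm).mul_right (b 0 ^ (2 * p / m)))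
    rw [Real.mul_rpow (ha.nonneg n) (hb0 n)]
    exact mul_le_mul_of_nonneg_left
      (Real.rpow_le_rpow (hb0 n) (hb (Nat.zero_le n)) (by positivity))
      (Real.rpow_nonneg (ha.nonneg n) _)
  rcases Nat.eq_zero_or_pos m with rfl | hm
  · simp only [mul_comm (a _), zero_add]
    exact aux hb ha.anti ha.nonneg (by omega)
  rcases Nat.eq_zero_or_pos m' with rfl | hm'
  · simp only [add_zero]
    exact aux ha hb.anti hb.nonneg (by omega)
  refine Summable.of_nonneg_of_le
    (fun n => Real.rpow_nonneg (mul_nonneg (ha.nonneg n) (hb.nonneg n)) _) (fun n => ?_)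
    ((ha.summable hm.ne').add (hb.summable hm'.ne'))
  rw [Nat.cast_add]
  exact mul_rpow_div_le (ha.nonneg n) (hb.nonneg n) (by exact_mod_cast hm) (by exact_mod_cast hm')

end Level

/-- A family of operators which is bounded in the Schatten class `L_{2p/m}` (in operator norm if
`m = 0`), in the sense that it is dominated by a common sequence. -/
def UnifLevel {H : Type*} [NormedAddCommGroup H] [InnerProductSpace ℂ H] {ι : Type*} (p : ℝ)
    (m : ℕ) (T : ι → H →L[ℂ] H) : Prop :=
  ∃ a, IsLevel p m a ∧ ∀ i, Dominated a (T i)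

section UnifLevel

variable {H : Type*} [NormedAddCommGroup H] [InnerProductSpace ℂ H] {ι : Type*} {p : ℝ} {m m' : ℕ}
  {T S : ι → H →L[ℂ] H}

theorem UnifLevel.mono (hp : 1 ≤ p) (h : UnifLevel p m' T) (hm : m ≤ m') : UnifLevel p m T := by
  obtain ⟨a, ha, h⟩ := h
  exact ⟨a, ha.mono hp hm, h⟩

theorem unifLevel_zero (hp : 1 ≤ p) : UnifLevel p m (fun _ : ι => (0 : H →L[ℂ] H)) := by
  refine ⟨fun _ => 0, ⟨antitone_const, fun _ => le_rfl, fun h0 => ?_⟩, fun i =>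
    dominated_zero fun _ => le_rfl⟩
  have : (0 : ℝ) < m := by exact_mod_cast Nat.pos_of_ne_zero h0
  simp [Real.zero_rpow (show 2 * p / m ≠ 0 by positivity)]

theorem UnifLevel.add (hp : 1 ≤ p) (hT : UnifLevel p m T) (hS : UnifLevel p m S) :
    UnifLevel p m (fun i => T i + S i) := by
  obtain ⟨a, ha, hT⟩ := hT
  obtain ⟨b, hb, hS⟩ := hS
  exact ⟨_, ha.comp_div.add hp hb.comp_div, fun i => (hT i).add (hS i)⟩

theorem UnifLevel.smul (hT : UnifLevel p m T) {c : ι → ℂ} {C : ℝ} (hc : ∀ i, ‖c i‖ ≤ C) :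
    UnifLevel p m (fun i => c i • T i) := by
  obtain ⟨a, ha, hT⟩ := hT
  refine ⟨fun n => max C 0 * a n, ha.const_mul (le_max_right _ _), fun i => ?_⟩
  exact (hT i).smul ((hc i).trans (le_max_left _ _))

theorem UnifLevel.const_smul (hT : UnifLevel p m T) (c : ℂ) : UnifLevel p m (fun i => c • T i) :=
  hT.smul (C := ‖c‖) fun _ => le_rfl

theorem UnifLevel.sub (hp : 1 ≤ p) (hT : UnifLevel p m T) (hS : UnifLevel p m S) :
    UnifLevel p m (fun i => T i - S i) := by
  have h := hT.add hp (hS.const_smul (-1))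
  simpa [sub_eq_add_neg] using h

theorem UnifLevel.mul (hp : 1 ≤ p) (hT : UnifLevel p m T) (hS : UnifLevel p m' S) :
    UnifLevel p (m + m') (fun i => T i * S i) := by
  obtain ⟨a, ha, hT⟩ := hT
  obtain ⟨b, hb, hS⟩ := hS
  exact ⟨_, ha.comp_div.mul hp hb.comp_div, fun i => (hT i).mul (hS i) ha.nonneg⟩

theorem unifLevel_zero_iff : UnifLevel p 0 T ↔ ∃ C, ∀ i, ‖T i‖ ≤ C := by
  constructor
  · rintro ⟨a, -, h⟩
    exact ⟨a 0, fun i => (h i).norm_le⟩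
  · rintro ⟨C, hC⟩
    refine ⟨fun _ => max C 0, ⟨antitone_const, fun _ => le_max_right _ _, fun h => absurd rfl h⟩,
      fun i => (dominated_norm (T i)).mono fun _ => (hC i).trans (le_max_left _ _)⟩

theorem unifLevel_const_zero (A : H →L[ℂ] H) : UnifLevel p 0 (fun _ : ι => A) :=
  unifLevel_zero_iff.2 ⟨‖A‖, fun _ => le_rfl⟩

theorem UnifLevel.mem_schatten (hp : 1 ≤ p) (h : UnifLevel p m T) (hm : m ≠ 0) (i : ι) :
    T i ∈ schatten H (2 * p / m) := by
  obtain ⟨a, ha, h⟩ := h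
  refine Summable.of_nonneg_of_le (fun n => Real.rpow_nonneg (singularNumber_nonneg _ n) _)
    (fun n => ?_) (ha.summable hm)
  exact Real.rpow_le_rpow (singularNumber_nonneg _ n) ((h i).singularNumber_le n) (by positivity)

theorem unifLevel_of_mem_schatten (hp : 1 ≤ p) {A : H →L[ℂ] H} (h : A ∈ schatten H (2 * p / m)) :
    UnifLevel p m (fun _ : ι => A) := by
  -- The slack is geometric because it must be antitone and summable to every positive power.
  have hδ : ∀ n : ℕ, (0 : ℝ) < (1 / 2) ^ n := fun n => by positivity
  refine ⟨fun n => singularNumber A n + (1 / 2) ^ n, ⟨?_, fun n =>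
    add_nonneg (singularNumber_nonneg A n) (hδ n).le, fun h0 => ?_⟩, fun _ =>
    dominated_singularNumber_add A hδ⟩
  · intro i j hij
    exact add_le_add (singularNumber_antitone A hij)
      (pow_le_pow_of_le_one (by norm_num) (by norm_num) hij)
  · have hm : (0 : ℝ) < m := by exact_mod_cast Nat.pos_of_ne_zero h0
    have hr : 0 < 2 * p / m := by positivity
    refine summable_add_rpow (singularNumber_nonneg A) (fun n => (hδ n).le) hr.le h ?_
    have : ∀ n : ℕ, (((1 : ℝ) / 2) ^ n) ^ (2 * p / m) = ((1 / 2) ^ (2 * p / m)) ^ n := fun n => by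
      rw [← Real.rpow_natCast, ← Real.rpow_natCast, ← Real.rpow_mul (by norm_num),
        ← Real.rpow_mul (by norm_num), mul_comm]
    simp only [this]
    exact summable_geometric_of_lt_one (by positivity)
      (Real.rpow_lt_one (by norm_num) (by norm_num) hr)

theorem schatten_mono {r s : ℝ} (hr : 0 < r) (hrs : r ≤ s) : schatten H r ⊆ schatten H s :=
  fun A hA => summable_rpow_mono (singularNumber_nonneg A) hr hrs hA

end UnifLevel

/-! ### Rapidly convergent series in Schatten classes and the exponential -/

section Series

variable {H : Type*} [NormedAddCommGroup H] [InnerProductSpace ℂ H] {ι : Type*} {p : ℝ} {m : ℕ}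
  {a : ℕ → ℝ}

/-- The rank budget for an infinite series: the `k`-th term may spend `2 ^ k` times `N / 4 ^ (k +
1)`, and these amounts decay geometrically. -/
theorem sum_two_pow_mul_div_le (N K : ℕ) :
    ∑ k ∈ Finset.range K, 2 ^ k * (N / 4 ^ (k + 1)) ≤ N := by
  have h1 : ∀ k ∈ Finset.range K,
      ((2 ^ k * (N / 4 ^ (k + 1)) : ℕ) : ℝ) ≤ (N : ℝ) / 4 * (1 / 2) ^ k := fun k _ => by
    have h2 : ((N / 4 ^ (k + 1) : ℕ) : ℝ) ≤ (N : ℝ) / 4 ^ (k + 1) := by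
      simpa using (Nat.cast_div_le (α := ℝ) (m := N) (n := 4 ^ (k + 1)))
    push_cast at h2 ⊢
    calc (2 : ℝ) ^ k * ((N / 4 ^ (k + 1) : ℕ) : ℝ) ≤ 2 ^ k * ((N : ℝ) / 4 ^ (k + 1)) := by
          gcongr
      _ = (N : ℝ) / 4 * (1 / 2) ^ k := by
          have : (4 : ℝ) ^ k = 2 ^ k * 2 ^ k := by rw [← mul_pow]; norm_num
          rw [pow_succ, this, one_div, inv_pow]
          field_simp
  have h3 : ∑ k ∈ Finset.range K, (1 / 2 : ℝ) ^ k ≤ 2 := by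
    simpa using Summable.sum_le_tsum (Finset.range K) (fun k _ => by positivity)
      summable_geometric_two |>.trans_eq tsum_geometric_two
  have h4 : ((∑ k ∈ Finset.range K, 2 ^ k * (N / 4 ^ (k + 1)) : ℕ) : ℝ) ≤ N := by
    rw [Nat.cast_sum]
    refine (Finset.sum_le_sum h1).trans ?_
    rw [← Finset.mul_sum]
    have : (0 : ℝ) ≤ N := Nat.cast_nonneg N
    nlinarith
  exact_mod_cast h4

/-- With `r = 2p / m`, take for `b N` the `r`-th root of the sum over `k` of `8⁻ᵏ a(N / 4ᵏ⁺¹)ʳ`.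
Dilation by `4ᵏ⁺¹` multiplies the sum over `N` by `4ᵏ⁺¹`, which `8⁻ᵏ` beats. The assumption `1 ≤ r`
allows `8ᵏ` in place of its `r`-th root. -/
theorem IsLevel.exists_dilation_bound (ha : IsLevel p m a) (hm : m ≠ 0) (hr : 1 ≤ 2 * p / m) :
    ∃ b, IsLevel p m b ∧ ∀ N k : ℕ, a (N / 4 ^ (k + 1)) ≤ 8 ^ k * b N := by
  set r := 2 * p / m with hrdef
  have hr0 : 0 < r := by linarith
  let f : ℕ × ℕ → ℝ := fun x => (1 / 8) ^ x.1 * a (x.2 / 4 ^ (x.1 + 1)) ^ r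
  have hf0 : 0 ≤ f := fun x => mul_nonneg (by positivity) (Real.rpow_nonneg (ha.nonneg _) r)
  have hinner : ∀ k, HasSum (fun N => f (k, N))
      ((1 / 8) ^ k * (((4 ^ (k + 1) : ℕ) : ℝ) * ∑' n, a n ^ r)) := fun k =>
    (hasSum_comp_div (ha.summable hm) (fun n => Real.rpow_nonneg (ha.nonneg n) _)
      (4 ^ (k + 1))).mul_left _
  have hf : Summable f := by
    rw [summable_prod_of_nonneg hf0]
    refine ⟨fun k => (hinner k).summable, ?_⟩
    simp only [fun k => (hinner k).tsum_eq]
    have h1 : ∀ k : ℕ, (1 / 8 : ℝ) ^ k * (((4 ^ (k + 1) : ℕ) : ℝ) * ∑' n, a n ^ r) =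
        (1 / 2) ^ k * (4 * ∑' n, a n ^ r) := fun k => by
      have : (1 / 2 : ℝ) ^ k = (1 / 8) ^ k * 4 ^ k := by rw [← mul_pow]; norm_num
      rw [this]; push_cast; ring
    simp only [h1]
    exact summable_geometric_two.mul_right _
  have hswap : Summable fun x : ℕ × ℕ => f x.swap := hf.prod_symm
  have hk : ∀ N, Summable fun k => f (k, N) := fun N => hswap.prod_factor N
  have hg0 : ∀ N, 0 ≤ ∑' k, f (k, N) := fun N => tsum_nonneg fun k => hf0 _
  refine ⟨fun N => (∑' k, f (k, N)) ^ (1 / r), ⟨fun i j hij => ?_,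
    fun N => Real.rpow_nonneg (hg0 N) _, fun _ => ?_⟩, fun N k => ?_⟩
  · refine Real.rpow_le_rpow (hg0 _) ?_ (by positivity)
    refine Summable.tsum_le_tsum (fun k => ?_) (hk j) (hk i)
    exact mul_le_mul_of_nonneg_left (Real.rpow_le_rpow (ha.nonneg _)
      (ha.anti (Nat.div_le_div_right hij)) hr0.le) (by positivity)
  · have h1 : ∀ N, ((∑' k, f (k, N)) ^ (1 / r)) ^ (2 * p / m) = ∑' k, f (k, N) := fun N => by
      rw [← hrdef, ← Real.rpow_mul (hg0 N), one_div_mul_cancel hr0.ne', Real.rpow_one]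
    simp only [h1]
    exact hswap.prod
  · have h1 : a (N / 4 ^ (k + 1)) ^ r ≤ 8 ^ k * ∑' k, f (k, N) := by
      have h2 : f (k, N) ≤ ∑' k, f (k, N) := (hk N).le_tsum k fun j _ => hf0 _
      have h3 : a (N / 4 ^ (k + 1)) ^ r = 8 ^ k * f (k, N) := by
        simp only [f]
        rw [← mul_assoc, ← mul_pow]; norm_num
      rw [h3]; gcongr
    calc a (N / 4 ^ (k + 1)) = (a (N / 4 ^ (k + 1)) ^ r) ^ (1 / r) := by
          rw [← Real.rpow_mul (ha.nonneg _), mul_one_div_cancel hr0.ne', Real.rpow_one]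
      _ ≤ (8 ^ k * ∑' k, f (k, N)) ^ (1 / r) :=
          Real.rpow_le_rpow (Real.rpow_nonneg (ha.nonneg _) _) h1 (by positivity)
      _ = (8 ^ k) ^ (1 / r) * (∑' k, f (k, N)) ^ (1 / r) :=
          Real.mul_rpow (by positivity) (hg0 N)
      _ ≤ 8 ^ k * (∑' k, f (k, N)) ^ (1 / r) := by
          refine mul_le_mul_of_nonneg_right ?_ (Real.rpow_nonneg (hg0 N) _)
          conv_rhs => rw [← Real.rpow_one (8 ^ k)]
          exact Real.rpow_le_rpow_of_exponent_le (one_le_pow₀ (by norm_num))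
            (by rw [div_le_one hr0]; exact hr)

/-- The `k`-th term is approximated with parameter `N / 4 ^ (k + 1)`, so the total rank stays below
`N`. The loss from evaluating `a` so early is at most `8 ^ k`, absorbed by the summability of `l k *
8 ^ k`. -/
theorem unifLevel_of_hasSum (hm : m ≠ 0) (hr : 1 ≤ 2 * p / m) {A : ι → ℕ → H →L[ℂ] H}
    {T : ι → H →L[ℂ] H} (hsum : ∀ i, HasSum (A i) (T i)) {a : ℕ → ℝ} (ha : IsLevel p m a)
    {l : ℕ → ℝ} (hl0 : ∀ k, 0 ≤ l k) (hl : Summable fun k => l k * 8 ^ k)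
    (h : ∀ i k n, ∃ F : H →L[ℂ] H, (F : H →ₗ[ℂ] H).rank ≤ ((2 ^ k * n : ℕ) : Cardinal) ∧
      ‖A i k - F‖ ≤ l k * a n) : UnifLevel p m T := by
  obtain ⟨b, hb, hab⟩ := ha.exists_dilation_bound hm hr
  have hM : 0 ≤ ∑' k, l k * 8 ^ k := tsum_nonneg fun k => mul_nonneg (hl0 k) (by positivity)
  refine ⟨_, hb.const_mul hM, fun i N => ?_⟩
  choose F hF hn using fun k => h i k (N / 4 ^ (k + 1))
  -- From `k = N` on the natural quotient is zero, so the approximants have rank zero and only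
  -- finitely many contribute.
  have hF0 : ∀ k ∉ Finset.range N, F k = 0 := fun k hk => by
    have hk' : N / 4 ^ (k + 1) = 0 := by
      refine Nat.div_eq_of_lt ?_
      have h1 : N ≤ k := by simpa using hk
      calc N < N + 1 := Nat.lt_succ_self N
        _ ≤ k + 1 := by omega
        _ < 4 ^ (k + 1) := Nat.lt_pow_self (by norm_num)
    have h0 := hF k
    rw [hk', mul_zero, Nat.cast_zero, nonpos_iff_eq_zero, LinearMap.rank, Submodule.rank_eq_zero,
      LinearMap.range_eq_bot] at h0
    ext x
    exact congrArg (fun f : H →ₗ[ℂ] H => f x) h0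
  refine ⟨∑ k ∈ Finset.range N, F k,
    rank_mono (sum_two_pow_mul_div_le N N) (rank_sum_le hF N), ?_⟩
  have hT : HasSum (fun k => A i k - F k) (T i - ∑ k ∈ Finset.range N, F k) :=
    (hsum i).sub (hasSum_sum_of_ne_finset_zero hF0)
  have hle : ∀ k, ‖A i k - F k‖ ≤ l k * 8 ^ k * b N := fun k => by
    refine (hn k).trans ?_
    rw [mul_assoc]
    exact mul_le_mul_of_nonneg_left (hab N k) (hl0 k)
  rw [← hT.tsum_eq, ← tsum_mul_right]
  exact tsum_of_norm_bounded (hl.mul_right (b N)).hasSum hle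

theorem norm_pow_le_pow (x : H →L[ℂ] H) {M : ℝ} (hx : ‖x‖ ≤ M) (k : ℕ) : ‖x ^ k‖ ≤ M ^ k := by
  rcases Nat.eq_zero_or_pos k with rfl | hk
  · rw [pow_zero, pow_zero]
    exact ContinuousLinearMap.norm_id_le
  · exact (norm_pow_le' _ hk).trans (pow_le_pow_left₀ (norm_nonneg _) hx _)

/-- Telescoping `Z ^ k - Z' ^ k` puts one difference `Z - Z'` into each of `k` summands; replacing
it by `D` costs rank `n` and error `M ^ k * α` each time. -/
theorem exists_rank_le_pow_sub_pow {Z Z' D : H →L[ℂ] H} {M α : ℝ} (hM : 1 ≤ M) (hZ : ‖Z‖ ≤ M)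
    (hZ' : ‖Z'‖ ≤ M) {n : ℕ} (hD : (D : H →ₗ[ℂ] H).rank ≤ (n : Cardinal))
    (hα : ‖Z - Z' - D‖ ≤ α) (k : ℕ) :
    ∃ F : H →L[ℂ] H, (F : H →ₗ[ℂ] H).rank ≤ ((k * n : ℕ) : Cardinal) ∧
      ‖Z ^ k - Z' ^ k - F‖ ≤ k * M ^ k * α := by
  have hα0 : 0 ≤ α := (norm_nonneg _).trans hα
  induction k with
  | zero => exact ⟨0, rank_zero_le _, by simp⟩
  | succ k ih =>
    obtain ⟨F, hF, hn⟩ := ih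
    refine ⟨Z * F + D * Z' ^ k, rank_mono (by ring_nf; rfl)
      (rank_add_le_natCast (rank_mul_le_right Z hF) (rank_mul_le_left _ hD)), ?_⟩
    have h1 : Z ^ (k + 1) - Z' ^ (k + 1) - (Z * F + D * Z' ^ k) =
        Z * (Z ^ k - Z' ^ k - F) + (Z - Z' - D) * Z' ^ k := by
      rw [pow_succ', pow_succ']; noncomm_ring
    have h2 : ‖Z' ^ k‖ ≤ M ^ k := norm_pow_le_pow Z' hZ' k
    have hM0 : 0 ≤ M := by linarith
    rw [h1]
    calc _ ≤ ‖Z‖ * ‖Z ^ k - Z' ^ k - F‖ + ‖Z - Z' - D‖ * ‖Z' ^ k‖ :=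
          (norm_add_le _ _).trans (add_le_add (norm_mul_le _ _) (norm_mul_le _ _))
      _ ≤ M * (k * M ^ k * α) + α * M ^ k := by gcongr
      _ ≤ M * (k * M ^ k * α) + α * M ^ k * M := by
          have : 0 ≤ α * M ^ k := by positivity
          nlinarith
      _ = _ := by push_cast; ring

end Series

section Exponential

variable {H : Type*} [NormedAddCommGroup H] [InnerProductSpace ℂ H] [CompleteSpace H]

/-- The entire function `(e^x - 1 - x) / x²`. -/
noncomputable def expRemainder (x : H →L[ℂ] H) : H →L[ℂ] H :=
  ∑' k : ℕ, (((k + 2).factorial : ℂ)⁻¹) • x ^ k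

theorem norm_expRemainder_term_le (x : H →L[ℂ] H) {M : ℝ} (hx : ‖x‖ ≤ M) (k : ℕ) :
    ‖(((k + 2).factorial : ℂ)⁻¹) • x ^ k‖ ≤ M ^ k / k.factorial := by
  have hM0 : 0 ≤ M := (norm_nonneg _).trans hx
  rw [norm_smul, norm_inv, Complex.norm_natCast, div_eq_inv_mul]
  have h1 : ((k.factorial : ℕ) : ℝ) ≤ ((k + 2).factorial : ℕ) := by
    exact_mod_cast Nat.factorial_le (by omega)
  have h2 : (0 : ℝ) < k.factorial := by exact_mod_cast k.factorial_pos
  exact mul_le_mul (inv_anti₀ h2 h1) (norm_pow_le_pow x hx k) (norm_nonneg _) (by positivity)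

theorem hasSum_expRemainder (x : H →L[ℂ] H) :
    HasSum (fun k : ℕ => (((k + 2).factorial : ℂ)⁻¹) • x ^ k) (expRemainder x) :=
  (Summable.of_norm_bounded (Real.summable_pow_div_factorial ‖x‖)
    (norm_expRemainder_term_le x le_rfl)).hasSum

theorem norm_expRemainder_le (x : H →L[ℂ] H) {M : ℝ} (hx : ‖x‖ ≤ M) :
    ‖expRemainder x‖ ≤ ∑' k : ℕ, M ^ k / k.factorial :=
  tsum_of_norm_bounded (Real.summable_pow_div_factorial M).hasSum (norm_expRemainder_term_le x hx)

/-- The quadratic remainder is factored as `x * x * expRemainder x`, so a first order expansion in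
the forms only needs a uniform bound on `expRemainder`. -/
theorem exp_eq_add_expRemainder (x : H →L[ℂ] H) :
    NormedSpace.exp x = 1 + x + x * x * expRemainder x := by
  have h1 : Summable fun k : ℕ => ((k.factorial : ℂ)⁻¹) • x ^ k :=
    (NormedSpace.norm_expSeries_summable' x).of_norm
  rw [NormedSpace.exp_eq_tsum ℂ]
  simp only
  rw [← h1.sum_add_tsum_nat_add 2, ← ((hasSum_expRemainder x).mul_left (x * x)).tsum_eq]
  congr 1
  · simp [Finset.sum_range_succ]
  · refine tsum_congr fun k => ?_
    rw [mul_smul_comm, ← pow_two, ← pow_add, add_comm k 2]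

/-- Conjugation by `ε` is multiplicative, so the odd part of each power telescopes through `Z - ε *
Z * ε`. The resulting ranks `k * n ≤ 2 ^ k * n` and factorially small errors fit
`unifLevel_of_hasSum`. -/
theorem unifLevel_expRemainder_sub {ι : Type*} {p : ℝ} (hp : 1 ≤ p) {ε Z : H →L[ℂ] H}
    (hε : ε * ε = 1) (hZ : UnifLevel p 1 (fun _ : Unit => Z - ε * Z * ε)) {t : ι → ℂ}
    (ht : ∀ i, ‖t i‖ ≤ 1) :
    UnifLevel p 1 (fun i => expRemainder (t i • Z) - ε * expRemainder (t i • Z) * ε) := by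
  obtain ⟨a, ha, hdom⟩ := hZ
  set M := 1 + ‖Z‖ + ‖ε * Z * ε‖ with hMdef
  have hM : 1 ≤ M := by linarith [norm_nonneg Z, norm_nonneg (ε * Z * ε)]
  have hMZ : ‖Z‖ ≤ M := by linarith [norm_nonneg Z, norm_nonneg (ε * Z * ε)]
  have hMZ' : ‖ε * Z * ε‖ ≤ M := by linarith [norm_nonneg Z, norm_nonneg (ε * Z * ε)]
  have hpow : ∀ k, ε * Z ^ k * ε = (ε * Z * ε) ^ k := fun k => by
    induction k with
    | zero => simpa using hε
    | succ k ih =>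
      rw [pow_succ, pow_succ, ← ih]
      calc ε * (Z ^ k * Z) * ε = ε * Z ^ k * (1 : H →L[ℂ] H) * Z * ε := by noncomm_ring
        _ = ε * Z ^ k * (ε * ε) * Z * ε := by rw [hε]
        _ = _ := by noncomm_ring
  refine unifLevel_of_hasSum (m := 1) one_ne_zero (by norm_num; linarith)
    (fun i => (hasSum_expRemainder (t i • Z)).sub
      (((hasSum_expRemainder (t i • Z)).mul_left ε).mul_right ε)) ha
    (l := fun k => M ^ k / k.factorial) (fun k => by positivity) ?_ fun i k n => ?_
  · have : ∀ k : ℕ, M ^ k / k.factorial * 8 ^ k = (M * 8) ^ k / k.factorial := fun k => by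
      rw [mul_pow]; ring
    simp only [this]
    exact Real.summable_pow_div_factorial _
  · obtain ⟨D, hD, hDa⟩ := hdom () n
    obtain ⟨F, hF, hFa⟩ := exists_rank_le_pow_sub_pow hM hMZ hMZ' hD hDa k
    refine ⟨((((k + 2).factorial : ℂ)⁻¹) * t i ^ k) • F, rank_smul_le _
      (rank_mono (Nat.mul_le_mul_right n k.lt_two_pow_self.le) hF), ?_⟩
    have h1 : (((k + 2).factorial : ℂ)⁻¹) • (t i • Z) ^ k -
        ε * ((((k + 2).factorial : ℂ)⁻¹) • (t i • Z) ^ k) * ε -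
        ((((k + 2).factorial : ℂ)⁻¹) * t i ^ k) • F =
        ((((k + 2).factorial : ℂ)⁻¹) * t i ^ k) • (Z ^ k - (ε * Z * ε) ^ k - F) := by
      rw [← hpow, smul_pow]
      simp only [smul_smul, mul_smul_comm, smul_mul_assoc, smul_sub]
    rw [h1, norm_smul, norm_mul, norm_inv, Complex.norm_natCast, norm_pow]
    -- The factor `k` from telescoping is absorbed in passing from `(k + 2)!` to `k!`.
    have h2 : ((k + 2).factorial : ℝ)⁻¹ * ‖t i‖ ^ k * k ≤ (k.factorial : ℝ)⁻¹ := by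
      have h3 : ‖t i‖ ^ k ≤ 1 := pow_le_one₀ (norm_nonneg _) (ht i)
      have h4 : (0 : ℝ) < k.factorial := by exact_mod_cast k.factorial_pos
      have h5 : ((k + 2).factorial : ℝ)⁻¹ * k ≤ (k.factorial : ℝ)⁻¹ := by
        rw [Nat.factorial_succ, Nat.factorial_succ]
        push_cast
        rw [inv_mul_le_iff₀ (by positivity)]
        field_simp
        have : (0 : ℝ) ≤ k := Nat.cast_nonneg k
        nlinarith
      calc ((k + 2).factorial : ℝ)⁻¹ * ‖t i‖ ^ k * k
          ≤ ((k + 2).factorial : ℝ)⁻¹ * 1 * k := by gcongr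
        _ ≤ _ := by simpa using h5
    have ha0 := ha.nonneg n
    calc _ ≤ ((k + 2).factorial : ℝ)⁻¹ * ‖t i‖ ^ k * (k * M ^ k * a n) := by gcongr
      _ = (((k + 2).factorial : ℝ)⁻¹ * ‖t i‖ ^ k * k) * (M ^ k * a n) := by ring
      _ ≤ (k.factorial : ℝ)⁻¹ * (M ^ k * a n) := by gcongr
      _ = _ := by ring

end Exponential

/-! ### The trace -/

section Trace

set_option linter.unusedSectionVars false

variable {H : Type*} [NormedAddCommGroup H] [InnerProductSpace ℂ H] [CompleteSpace H]
  {κ : Type*} (b : HilbertBasis κ ℂ H)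

theorem exists_eq_sum_of_rank_le {F : H →L[ℂ] H} {N : ℕ}
    (hF : (F : H →ₗ[ℂ] H).rank ≤ (N : Cardinal)) :
    ∃ d ≤ N, ∃ u : Fin d → H, (∀ j, ‖u j‖ = 1) ∧
      ∀ x, F x = ∑ j, inner ℂ (F.adjoint (u j)) x • u j := by
  have hfin : FiniteDimensional ℂ (LinearMap.range (F : H →ₗ[ℂ] H)) :=
    Module.rank_lt_aleph0_iff.1 (lt_of_le_of_lt hF Cardinal.natCast_lt_aleph0)
  let e := stdOrthonormalBasis ℂ (LinearMap.range (F : H →ₗ[ℂ] H))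
  refine ⟨_, ?_, fun j => (e j : H), fun j => e.orthonormal.1 j, fun x => ?_⟩
  · have h1 : (Module.finrank ℂ (LinearMap.range (F : H →ₗ[ℂ] H)) : Cardinal) ≤ N := by
      rw [Module.finrank_eq_rank]; exact hF
    exact_mod_cast h1
  · have h1 := e.sum_repr' ⟨F x, LinearMap.mem_range_self (F : H →ₗ[ℂ] H) x⟩
    have h2 := congrArg (Subtype.val) h1
    simp only [Submodule.coe_sum, Submodule.coe_smul, Submodule.coe_inner] at h2
    rw [← h2]
    refine Finset.sum_congr rfl fun j _ => ?_
    rw [ContinuousLinearMap.adjoint_inner_left]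

/-- Cauchy–Schwarz over `s`, then Bessel's inequality for each factor. -/
theorem sum_norm_inner_mul_le (x y : H) (s : Finset κ) :
    ∑ i ∈ s, ‖inner ℂ x (b i) * inner ℂ (b i) y‖ ≤ ‖x‖ * ‖y‖ := by
  have h1 : ∀ z : H, √(∑ i ∈ s, ‖inner ℂ (b i) z‖ ^ 2) ≤ ‖z‖ := fun z =>
    Real.sqrt_le_iff.2 ⟨norm_nonneg z, b.orthonormal.sum_inner_products_le z⟩
  calc ∑ i ∈ s, ‖inner ℂ x (b i) * inner ℂ (b i) y‖
      = ∑ i ∈ s, ‖inner ℂ (b i) x‖ * ‖inner ℂ (b i) y‖ := by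
        refine Finset.sum_congr rfl fun i _ => ?_
        rw [norm_mul, norm_inner_symm]
    _ ≤ √(∑ i ∈ s, ‖inner ℂ (b i) x‖ ^ 2) * √(∑ i ∈ s, ‖inner ℂ (b i) y‖ ^ 2) :=
        Real.sum_mul_le_sqrt_mul_sqrt _ _ _
    _ ≤ ‖x‖ * ‖y‖ := mul_le_mul (h1 x) (h1 y) (Real.sqrt_nonneg _) (norm_nonneg _)

/-- A rank `N` operator is a sum of at most `N` rank one operators built on an orthonormal basis of
its range, each contributing at most `‖F‖` to the diagonal. -/
theorem sum_norm_inner_le_of_rank_le {F : H →L[ℂ] H} {N : ℕ}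
    (hF : (F : H →ₗ[ℂ] H).rank ≤ (N : Cardinal)) (s : Finset κ) :
    ∑ i ∈ s, ‖inner ℂ (b i) (F (b i))‖ ≤ N * ‖F‖ := by
  obtain ⟨d, hd, u, hu, hFu⟩ := exists_eq_sum_of_rank_le hF
  calc ∑ i ∈ s, ‖inner ℂ (b i) (F (b i))‖
      ≤ ∑ i ∈ s, ∑ j, ‖inner ℂ (F.adjoint (u j)) (b i) * inner ℂ (b i) (u j)‖ := by
        refine Finset.sum_le_sum fun i _ => ?_
        rw [hFu, inner_sum]
        refine (norm_sum_le _ _).trans (le_of_eq (Finset.sum_congr rfl fun j _ => ?_))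
        rw [inner_smul_right]
    _ = ∑ j, ∑ i ∈ s, ‖inner ℂ (F.adjoint (u j)) (b i) * inner ℂ (b i) (u j)‖ :=
        Finset.sum_comm
    _ ≤ ∑ _j : Fin d, ‖F‖ := by
        refine Finset.sum_le_sum fun j _ => (sum_norm_inner_mul_le b _ _ s).trans ?_
        rw [hu, mul_one]
        refine (ContinuousLinearMap.le_opNorm _ _).trans ?_
        rw [hu, mul_one, LinearIsometryEquiv.norm_map]
    _ ≤ N * ‖F‖ := by
        simp only [Finset.sum_const, Finset.card_univ, Fintype.card_fin, nsmul_eq_mul]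
        gcongr

/-- Telescope the approximants along powers of two. The difference `F (2 ^ (K + 1)) - F (2 ^ K)` has
rank at most `3 * 2 ^ K` and norm at most `2 * a (2 ^ K)`, whence the constant `6`; the initial
approximant `F 1` has norm at most `2 * a 0`. The result is a condensed sum, comparable with the sum
of `a`. -/
theorem Dominated.sum_norm_inner_le {a : ℕ → ℝ} {T : H →L[ℂ] H} (hT : Dominated a T)
    (ha : Antitone a) (ha0 : ∀ n, 0 ≤ a n) (hs : Summable fun k : ℕ => 2 ^ k * a (2 ^ k))
    (s : Finset κ) :
    ∑ i ∈ s, ‖inner ℂ (b i) (T (b i))‖ ≤ 2 * a 0 + 6 * ∑' k : ℕ, 2 ^ k * a (2 ^ k) := by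
  choose F hF hn using hT
  have hT0 : ‖T‖ ≤ a 0 := Dominated.norm_le fun n => ⟨F n, hF n, hn n⟩
  have hG : ∀ K : ℕ, ∑ i ∈ s, ‖inner ℂ (b i) (F (2 ^ K) (b i))‖ ≤
      2 * a 0 + 6 * ∑ k ∈ Finset.range K, 2 ^ k * a (2 ^ k) := fun K => by
    induction K with
    | zero =>
      refine (sum_norm_inner_le_of_rank_le b (hF (2 ^ 0)) s).trans ?_
      have h1 : ‖F 1‖ ≤ ‖T‖ + ‖T - F 1‖ := by
        calc ‖F 1‖ = ‖T - (T - F 1)‖ := by rw [sub_sub_cancel]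
          _ ≤ _ := norm_sub_le _ _
      have h2 := hn 1
      have h3 := ha (Nat.zero_le 1)
      simp
      linarith
    | succ K ih =>
      have h1 := sum_norm_inner_le_of_rank_le b
        (rank_sub_le_natCast (hF (2 ^ (K + 1))) (hF (2 ^ K))) s
      have h2 : ‖F (2 ^ (K + 1)) - F (2 ^ K)‖ ≤ 2 * a (2 ^ K) := by
        calc ‖F (2 ^ (K + 1)) - F (2 ^ K)‖
            = ‖(T - F (2 ^ K)) - (T - F (2 ^ (K + 1)))‖ := by congr 1; abel
          _ ≤ ‖T - F (2 ^ K)‖ + ‖T - F (2 ^ (K + 1))‖ := norm_sub_le _ _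
          _ ≤ a (2 ^ K) + a (2 ^ K) := add_le_add (hn _) ((hn _).trans
              (ha (Nat.pow_le_pow_right (by norm_num) (Nat.le_succ K))))
          _ = _ := by ring
      have h3 : ∀ i, ‖inner ℂ (b i) (F (2 ^ (K + 1)) (b i))‖ ≤
          ‖inner ℂ (b i) (F (2 ^ K) (b i))‖ +
            ‖inner ℂ (b i) ((F (2 ^ (K + 1)) - F (2 ^ K)) (b i))‖ := fun i => by
        refine le_trans (le_of_eq ?_) (norm_add_le _ _)
        rw [← inner_add_right]
        simp
      refine (Finset.sum_le_sum fun i _ => h3 i).trans ?_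
      rw [Finset.sum_add_distrib, Finset.sum_range_succ]
      have h4 : ((2 ^ (K + 1) + 2 ^ K : ℕ) : ℝ) * ‖F (2 ^ (K + 1)) - F (2 ^ K)‖ ≤
          6 * (2 ^ K * a (2 ^ K)) := by
        calc _ ≤ ((2 ^ (K + 1) + 2 ^ K : ℕ) : ℝ) * (2 * a (2 ^ K)) := by gcongr
          _ = _ := by push_cast; ring
      linarith
  -- For a fixed finite set `s` the remainder `T - F (2 ^ K)` contributes at most `s.card * a (2 ^
  -- K)`, which tends to zero and leaves a bound independent of `s`.
  have hlim : Filter.Tendsto (fun K : ℕ => 2 * a 0 + 6 * (∑' k : ℕ, 2 ^ k * a (2 ^ k)) +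
      s.card * (2 ^ K * a (2 ^ K))) Filter.atTop
      (nhds (2 * a 0 + 6 * (∑' k : ℕ, 2 ^ k * a (2 ^ k)) + s.card * 0)) :=
    tendsto_const_nhds.add (hs.tendsto_atTop_zero.const_mul _)
  rw [mul_zero, add_zero] at hlim
  refine ge_of_tendsto' hlim fun K => ?_
  have h1 : ∀ i ∈ s, ‖inner ℂ (b i) (T (b i))‖ ≤
      ‖inner ℂ (b i) (F (2 ^ K) (b i))‖ + 2 ^ K * a (2 ^ K) := fun i _ => by
    have h2 : inner ℂ (b i) (T (b i)) =
        inner ℂ (b i) (F (2 ^ K) (b i)) + inner ℂ (b i) ((T - F (2 ^ K)) (b i)) := by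
      rw [← inner_add_right]; simp
    rw [h2]
    refine (norm_add_le _ _).trans (add_le_add le_rfl ?_)
    refine (norm_inner_le_norm _ _).trans ?_
    have h3 : ‖b i‖ = 1 := b.orthonormal.1 i
    rw [h3, one_mul]
    refine (ContinuousLinearMap.le_opNorm _ _).trans ?_
    rw [h3, mul_one]
    refine (hn _).trans ?_
    exact le_mul_of_one_le_left (ha0 _) (one_le_pow₀ (by norm_num))
  refine (Finset.sum_le_sum h1).trans ?_
  rw [Finset.sum_add_distrib, Finset.sum_const, nsmul_eq_mul]
  have h5 : ∑ k ∈ Finset.range K, 2 ^ k * a (2 ^ k) ≤ ∑' k : ℕ, 2 ^ k * a (2 ^ k) :=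
    hs.sum_le_tsum _ fun k _ => mul_nonneg (by positivity) (ha0 _)
  linarith [hG K]

/-- The diagonal of `T` in the basis `b` is summable. -/
def DiagSummable (T : H →L[ℂ] H) : Prop := Summable fun i => inner ℂ (b i) (T (b i))

/-- The sum of the diagonal entries of `T` in the basis `b`. -/
noncomputable def basisTrace (T : H →L[ℂ] H) : ℂ := ∑' i, inner ℂ (b i) (T (b i))

variable {b}

theorem DiagSummable.add {T S : H →L[ℂ] H} (hT : DiagSummable b T) (hS : DiagSummable b S) :
    DiagSummable b (T + S) := by
  simpa [DiagSummable, inner_add_right] using Summable.add hT hS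

theorem basisTrace_add {T S : H →L[ℂ] H} (hT : DiagSummable b T) (hS : DiagSummable b S) :
    basisTrace b (T + S) = basisTrace b T + basisTrace b S := by
  simpa [basisTrace, inner_add_right] using Summable.tsum_add hT hS

theorem basisTrace_smul (c : ℂ) (T : H →L[ℂ] H) :
    basisTrace b (c • T) = c * basisTrace b T := by
  simp [basisTrace, tsum_mul_left]

theorem DiagSummable.of_sum_le {T : H →L[ℂ] H} {C : ℝ}
    (h : ∀ s : Finset κ, ∑ i ∈ s, ‖inner ℂ (b i) (T (b i))‖ ≤ C) : DiagSummable b T :=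
  (summable_of_sum_le (fun _ => norm_nonneg _) h).of_norm

theorem norm_basisTrace_le {T : H →L[ℂ] H} {C : ℝ}
    (h : ∀ s : Finset κ, ∑ i ∈ s, ‖inner ℂ (b i) (T (b i))‖ ≤ C) : ‖basisTrace b T‖ ≤ C := by
  have hs : Summable fun i => ‖inner ℂ (b i) (T (b i))‖ :=
    summable_of_sum_le (fun _ => norm_nonneg _) h
  exact (norm_tsum_le_tsum_norm hs).trans (hs.tsum_le_of_sum_le h)

theorem diagSummable_of_rank_le {F : H →L[ℂ] H} {N : ℕ}
    (hF : (F : H →ₗ[ℂ] H).rank ≤ (N : Cardinal)) : DiagSummable b F :=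
  .of_sum_le (sum_norm_inner_le_of_rank_le b hF)

theorem summable_condensed {a : ℕ → ℝ} (ha : Antitone a) (ha0 : ∀ n, 0 ≤ a n) (hs : Summable a) :
    Summable fun k : ℕ => 2 ^ k * a (2 ^ k) :=
  (summable_condensed_iff_of_nonneg ha0 fun _ _ _ h => ha h).2 hs

theorem Dominated.diagSummable {a : ℕ → ℝ} {T : H →L[ℂ] H} (hT : Dominated a T)
    (ha : Antitone a) (ha0 : ∀ n, 0 ≤ a n) (hs : Summable a) : DiagSummable b T :=
  .of_sum_le (hT.sum_norm_inner_le b ha ha0 (summable_condensed ha ha0 hs))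

theorem Dominated.norm_basisTrace_le {a : ℕ → ℝ} {T : H →L[ℂ] H} (hT : Dominated a T)
    (ha : Antitone a) (ha0 : ∀ n, 0 ≤ a n) (hs : Summable a) :
    ‖basisTrace b T‖ ≤ 2 * a 0 + 6 * ∑' k : ℕ, 2 ^ k * a (2 ^ k) :=
  FractionalLoop.norm_basisTrace_le
    (hT.sum_norm_inner_le b ha ha0 (summable_condensed ha ha0 hs))

/-- `R k` is dominated by `min (c n) (ρ k)`, which tends to zero for each `n`; dominated convergence
applies to the condensed sums. -/
theorem tendsto_basisTrace_zero {c ρ : ℕ → ℝ} {R : ℕ → H →L[ℂ] H} (hR : ∀ k, Dominated c (R k))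
    (hc : Antitone c) (hc0 : ∀ n, 0 ≤ c n) (hs : Summable c) (hρ : ∀ k, ‖R k‖ ≤ ρ k)
    (hlim : Filter.Tendsto ρ Filter.atTop (nhds 0)) :
    Filter.Tendsto (fun k => basisTrace b (R k)) Filter.atTop (nhds 0) := by
  have hρ0 : ∀ k, 0 ≤ ρ k := fun k => (norm_nonneg _).trans (hρ k)
  have hd0 : ∀ k n, 0 ≤ min (c n) (ρ k) := fun k n => le_min (hc0 n) (hρ0 k)
  have hds : ∀ k, Summable fun n => min (c n) (ρ k) := fun k =>
    Summable.of_nonneg_of_le (hd0 k) (fun n => min_le_left _ _) hs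
  have hmin : ∀ n, Filter.Tendsto (fun k => min (c n) (ρ k)) Filter.atTop (nhds 0) := fun n => by
    have := (tendsto_const_nhds (x := c n) (f := (Filter.atTop : Filter ℕ))).min hlim
    rwa [min_eq_right (hc0 n)] at this
  have hsum : Filter.Tendsto (fun k => ∑' j : ℕ, 2 ^ j * min (c (2 ^ j)) (ρ k)) Filter.atTop
      (nhds (∑' _j : ℕ, (0 : ℝ))) := by
    refine tendsto_tsum_of_dominated_convergence (summable_condensed hc hc0 hs) (fun j => ?_)
      (Filter.Eventually.of_forall fun k j => ?_)
    · simpa using (hmin (2 ^ j)).const_mul ((2 : ℝ) ^ j)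
    · rw [Real.norm_of_nonneg (mul_nonneg (by positivity) (hd0 k _))]
      exact mul_le_mul_of_nonneg_left (min_le_left _ _) (by positivity)
  have hbound : Filter.Tendsto (fun k => 2 * min (c 0) (ρ k) +
      6 * ∑' j : ℕ, 2 ^ j * min (c (2 ^ j)) (ρ k)) Filter.atTop (nhds 0) := by
    simpa using ((hmin 0).const_mul 2).add (hsum.const_mul 6)
  refine squeeze_zero_norm (fun k => ?_) hbound
  exact ((hR k).inf_norm (hρ k)).norm_basisTrace_le
    (fun i j hij => min_le_min_right _ (hc hij)) (hd0 k) (hds k)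

/-- With `F = ∑ ⟨F* u_j, ·⟩ u_j`, Parseval evaluates both traces as `∑ ⟨F* u_j, S u_j⟩`. -/
theorem basisTrace_mul_comm_of_rank_le {F : H →L[ℂ] H} {N : ℕ}
    (hF : (F : H →ₗ[ℂ] H).rank ≤ (N : Cardinal)) (S : H →L[ℂ] H) :
    basisTrace b (F * S) = basisTrace b (S * F) := by
  obtain ⟨d, hd, u, hu, hFu⟩ := exists_eq_sum_of_rank_le hF
  have h1 : HasSum (fun i => inner ℂ (b i) ((F * S) (b i)))
      (∑ j, inner ℂ (S.adjoint (F.adjoint (u j))) (u j)) := by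
    have h2 := hasSum_sum fun (j : Fin d) (_ : j ∈ Finset.univ) =>
      b.hasSum_inner_mul_inner (S.adjoint (F.adjoint (u j))) (u j)
    refine h2.congr_fun fun i => ?_
    rw [mul_apply_eq_comp, hFu, inner_sum]
    refine Finset.sum_congr rfl fun j _ => ?_
    rw [inner_smul_right, ContinuousLinearMap.adjoint_inner_left S]
  have h3 : HasSum (fun i => inner ℂ (b i) ((S * F) (b i)))
      (∑ j, inner ℂ (F.adjoint (u j)) (S (u j))) := by
    have h2 := hasSum_sum fun (j : Fin d) (_ : j ∈ Finset.univ) =>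
      b.hasSum_inner_mul_inner (F.adjoint (u j)) (S (u j))
    refine h2.congr_fun fun i => ?_
    rw [mul_apply_eq_comp, hFu, map_sum, inner_sum]
    refine Finset.sum_congr rfl fun j _ => ?_
    rw [map_smul, inner_smul_right]
  rw [basisTrace, basisTrace, h1.tsum_eq, h3.tsum_eq]
  exact Finset.sum_congr rfl fun j _ => ContinuousLinearMap.adjoint_inner_left S _ _

/-- Neither factor need be trace class; only the product of the dominating sequences is summable.
Finite rank parts commute under the trace, and the remaining products `(A - F k) * (B - G k)` tend
to zero in norm under a common summable bound. -/
theorem basisTrace_mul_comm {a a' : ℕ → ℝ} {A B : H →L[ℂ] H} (hA : Dominated a A)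
    (hB : Dominated a' B) (ha : Antitone a) (ha' : Antitone a') (ha0 : ∀ n, 0 ≤ a n)
    (ha0' : ∀ n, 0 ≤ a' n) (hs : Summable fun n => a n * a' n) :
    basisTrace b (A * B) = basisTrace b (B * A) := by
  -- A bound for `A - F k` uniform in `k`: use the zero approximant when `n / 2 ≤ k`, and `F (n / 2)
  -- - F k` otherwise.
  have key : ∀ {a : ℕ → ℝ} {A : H →L[ℂ] H} {F : ℕ → H →L[ℂ] H}, Antitone a →
      (∀ n, (F n : H →ₗ[ℂ] H).rank ≤ (n : Cardinal)) → (∀ n, ‖A - F n‖ ≤ a n) →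
      ∀ k, Dominated (fun n => a (n / 2)) (A - F k) := by
    intro a A F ha hF hn k n
    rcases le_total (n / 2) k with h | h
    · exact ⟨0, rank_zero_le n, by rw [sub_zero]; exact (hn k).trans (ha h)⟩
    · refine ⟨F (n / 2) - F k, rank_mono (by omega) (rank_sub_le_natCast (hF _) (hF _)), ?_⟩
      rw [sub_sub_sub_cancel_right]
      exact hn _
  choose F hF hFn using hA
  choose G hG hGn using hB
  have hdA := key ha hF hFn
  have hdB := key ha' hG hGn
  have hanti : Antitone fun n => a n * a' n := fun i j hij =>
    mul_le_mul (ha hij) (ha' hij) (ha0' _) (ha0 _)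
  have hnn : ∀ n, 0 ≤ a n * a' n := fun n => mul_nonneg (ha0 n) (ha0' n)
  have hs4 : Summable fun n => a (n / 2 / 2) * a' (n / 2 / 2) := by
    have h2 := (hasSum_comp_div hs hnn 2).summable
    exact (hasSum_comp_div h2 (fun n => hnn _) 2).summable
  have hanti4 : Antitone fun n => a (n / 2 / 2) * a' (n / 2 / 2) := fun i j hij =>
    hanti (Nat.div_le_div_right (Nat.div_le_div_right hij))
  have hR : ∀ k, Dominated (fun n => a (n / 2 / 2) * a' (n / 2 / 2)) ((A - F k) * (B - G k)) :=
    fun k => (hdA k).mul (hdB k) fun n => ha0 _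
  have hR' : ∀ k, Dominated (fun n => a (n / 2 / 2) * a' (n / 2 / 2)) ((B - G k) * (A - F k)) :=
    fun k => ((hdB k).mul (hdA k) fun n => ha0' _).mono fun n => (mul_comm _ _).le
  have hρ : ∀ k, ‖(A - F k) * (B - G k)‖ ≤ a k * a' k := fun k =>
    (norm_mul_le _ _).trans (mul_le_mul (hFn k) (hGn k) (norm_nonneg _) (ha0 k))
  have hρ' : ∀ k, ‖(B - G k) * (A - F k)‖ ≤ a k * a' k := fun k =>
    (norm_mul_le _ _).trans ((mul_le_mul (hGn k) (hFn k) (norm_nonneg _) (ha0' k)).trans_eq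
      (mul_comm _ _))
  -- Every term of `A * B` containing `F k` or `G k` matches a term of `B * A` by the finite rank
  -- case, so the defect of cyclicity is carried by the remainders for every `k`.
  have hdiff : ∀ k, basisTrace b (A * B) - basisTrace b (B * A) =
      basisTrace b ((A - F k) * (B - G k)) - basisTrace b ((B - G k) * (A - F k)) := fun k => by
    have e1 : A * B = (F k * B + (A - F k) * G k) + (A - F k) * (B - G k) := by noncomm_ring
    have e2 : B * A = (B * F k + G k * (A - F k)) + (B - G k) * (A - F k) := by noncomm_ring
    have s1 := diagSummable_of_rank_le (b := b) (rank_mul_le_left B (hF k))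
    have s2 := diagSummable_of_rank_le (b := b) (rank_mul_le_right (A - F k) (hG k))
    have s3 := diagSummable_of_rank_le (b := b) (rank_mul_le_right B (hF k))
    have s4 := diagSummable_of_rank_le (b := b) (rank_mul_le_left (A - F k) (hG k))
    have s5 := (hR k).diagSummable (b := b) hanti4 (fun n => hnn _) hs4
    have s6 := (hR' k).diagSummable (b := b) hanti4 (fun n => hnn _) hs4
    conv_lhs => rw [e1, e2]
    rw [basisTrace_add (s1.add s2) s5, basisTrace_add (s3.add s4) s6, basisTrace_add s1 s2,
      basisTrace_add s3 s4, basisTrace_mul_comm_of_rank_le (hF k) B,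
      basisTrace_mul_comm_of_rank_le (hG k) (A - F k)]
    ring
  have hlim := (tendsto_basisTrace_zero (b := b) hR hanti4 (fun n => hnn _) hs4 hρ
    hs.tendsto_atTop_zero).sub (tendsto_basisTrace_zero (b := b) hR' hanti4 (fun n => hnn _) hs4 hρ'
    hs.tendsto_atTop_zero)
  simp only [← hdiff, sub_zero] at hlim
  exact sub_eq_zero.1 (tendsto_nhds_unique tendsto_const_nhds hlim)

end Trace

/-! ### Bounded families of forms -/

/-- The Schatten level of the even part of a form of degree `m`. -/
def evenLevel (m : ℕ) : ℕ := 2 * ((m + 1) / 2)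

/-- The Schatten level of the odd part of a form of degree `m`. -/
def oddLevel (m : ℕ) : ℕ := 2 * (m / 2) + 1

section Forms

set_option linter.unusedSectionVars false

variable {H : Type*} [NormedAddCommGroup H] [InnerProductSpace ℂ H] {ι : Type*} {ε : H →L[ℂ] H}
  {p : ℝ} {m m' : ℕ} {T S : ι → H →L[ℂ] H}

/-- A bounded family of forms of degree `m`. -/
structure UnifForm (ε : H →L[ℂ] H) (p : ℝ) (m : ℕ) (T : ι → H →L[ℂ] H) : Prop where
  even : UnifLevel p (evenLevel m) (fun i => T i + ε * T i * ε)
  odd : UnifLevel p (oddLevel m) (fun i => T i - ε * T i * ε)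

theorem UnifForm.mono (hp : 1 ≤ p) (h : UnifForm ε p m' T) (hm : m ≤ m') : UnifForm ε p m T :=
  ⟨h.even.mono hp (by unfold evenLevel; omega), h.odd.mono hp (by unfold oddLevel; omega)⟩

theorem UnifForm.add (hp : 1 ≤ p) (hT : UnifForm ε p m T) (hS : UnifForm ε p m S) :
    UnifForm ε p m (fun i => T i + S i) := by
  constructor
  · convert hT.even.add hp hS.even using 2 with i
    noncomm_ring
  · convert hT.odd.add hp hS.odd using 2 with i
    noncomm_ring

theorem UnifForm.smul (hT : UnifForm ε p m T) {c : ι → ℂ} {C : ℝ} (hc : ∀ i, ‖c i‖ ≤ C) :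
    UnifForm ε p m (fun i => c i • T i) := by
  constructor
  · convert hT.even.smul hc using 2 with i
    rw [smul_add, mul_smul_comm, smul_mul_assoc]
  · convert hT.odd.smul hc using 2 with i
    rw [smul_sub, mul_smul_comm, smul_mul_assoc]

theorem unifForm_zero (hp : 1 ≤ p) : UnifForm ε p m (fun _ : ι => 0) := by
  constructor
  · simpa using unifLevel_zero hp
  · simpa using unifLevel_zero hp

/-- Conjugation by `ε` is an involutive automorphism; this is the rule for the even component in a
ℤ/2-grading, with the normalisation of `X + ε * X * ε` producing the factor one half. -/
theorem even_part_mul (hε : ε * ε = 1) (A B : H →L[ℂ] H) :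
    A * B + ε * (A * B) * ε = (1 / 2 : ℂ) • ((A + ε * A * ε) * (B + ε * B * ε) +
      (A - ε * A * ε) * (B - ε * B * ε)) := by
  have h : ε * (A * B) * ε = (ε * A * ε) * (ε * B * ε) := by
    calc ε * (A * B) * ε = ε * A * 1 * B * ε := by noncomm_ring
      _ = ε * A * (ε * ε) * B * ε := by rw [hε]
      _ = _ := by noncomm_ring
  have h2 : (A + ε * A * ε) * (B + ε * B * ε) + (A - ε * A * ε) * (B - ε * B * ε) =
      (2 : ℂ) • (A * B + (ε * A * ε) * (ε * B * ε)) := by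
    rw [two_smul]; noncomm_ring
  rw [h, h2, smul_smul]
  norm_num

theorem odd_part_mul (hε : ε * ε = 1) (A B : H →L[ℂ] H) :
    A * B - ε * (A * B) * ε = (1 / 2 : ℂ) • ((A + ε * A * ε) * (B - ε * B * ε) +
      (A - ε * A * ε) * (B + ε * B * ε)) := by
  have h : ε * (A * B) * ε = (ε * A * ε) * (ε * B * ε) := by
    calc ε * (A * B) * ε = ε * A * 1 * B * ε := by noncomm_ring
      _ = ε * A * (ε * ε) * B * ε := by rw [hε]
      _ = _ := by noncomm_ring
  have h2 : (A + ε * A * ε) * (B - ε * B * ε) + (A - ε * A * ε) * (B + ε * B * ε) =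
      (2 : ℂ) • (A * B - (ε * A * ε) * (ε * B * ε)) := by
    rw [two_smul]; noncomm_ring
  rw [h, h2, smul_smul]
  norm_num

/-- `evenLevel m` and `oddLevel m` are the least even and odd integers at least `m`. The rounded
levels of two factors always add up to at least the rounded level of the corresponding part of the
product. -/
theorem UnifForm.mul (hp : 1 ≤ p) (hε : ε * ε = 1) (hT : UnifForm ε p m T)
    (hS : UnifForm ε p m' S) : UnifForm ε p (m + m') (fun i => T i * S i) := by
  constructor
  · simp only [even_part_mul hε]
    refine UnifLevel.const_smul (UnifLevel.add hp ((hT.even.mul hp hS.even).mono hp ?_)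
      ((hT.odd.mul hp hS.odd).mono hp ?_)) _ <;> unfold evenLevel <;> try unfold oddLevel
    all_goals omega
  · simp only [odd_part_mul hε]
    refine UnifLevel.const_smul (UnifLevel.add hp ((hT.even.mul hp hS.odd).mono hp ?_)
      ((hT.odd.mul hp hS.even).mono hp ?_)) _ <;> unfold evenLevel oddLevel
    all_goals omega

theorem UnifForm.mem_form (hp : 1 ≤ p) (h : UnifForm ε p m T) (i : ι) : T i ∈ form ε p m := by
  refine ⟨fun hm => ⟨fun h0 => ?_, ?_⟩, fun hm => ⟨?_, ?_⟩⟩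
  · have e : evenLevel m = m := by obtain ⟨k, rfl⟩ := hm; unfold evenLevel; omega
    have := h.even
    rw [e] at this
    exact this.mem_schatten hp h0 i
  · have e : oddLevel m = m + 1 := by obtain ⟨k, rfl⟩ := hm; unfold oddLevel; omega
    have := h.odd
    rw [e] at this
    simpa using this.mem_schatten hp (by omega) i
  · have e : evenLevel m = m + 1 := by obtain ⟨k, rfl⟩ := hm; unfold evenLevel; omega
    have := h.even
    rw [e] at this
    simpa using this.mem_schatten hp (by omega) i
  · have e : oddLevel m = m := by obtain ⟨k, rfl⟩ := hm; unfold oddLevel; omega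
    have := h.odd
    rw [e] at this
    exact this.mem_schatten hp (by obtain ⟨k, rfl⟩ := hm; omega) i

theorem unifForm_of_mem_form (hp : 1 ≤ p) {A : H →L[ℂ] H} (h : A ∈ form ε p m) :
    UnifForm ε p m (fun _ : ι => A) := by
  rcases Nat.even_or_odd m with hm | hm
  · have e : evenLevel m = m := by obtain ⟨k, rfl⟩ := hm; unfold evenLevel; omega
    have e' : oddLevel m = m + 1 := by obtain ⟨k, rfl⟩ := hm; unfold oddLevel; omega
    obtain ⟨h1, h2⟩ := h.1 hm
    constructor
    · rw [e]
      rcases Nat.eq_zero_or_pos m with rfl | h0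
      · exact unifLevel_const_zero _
      · exact unifLevel_of_mem_schatten hp (h1 h0.ne')
    · rw [e']
      exact unifLevel_of_mem_schatten hp (by exact_mod_cast h2)
  · have e : evenLevel m = m + 1 := by obtain ⟨k, rfl⟩ := hm; unfold evenLevel; omega
    have e' : oddLevel m = m := by obtain ⟨k, rfl⟩ := hm; unfold oddLevel; omega
    obtain ⟨h1, h2⟩ := h.2 hm
    constructor
    · rw [e]
      exact unifLevel_of_mem_schatten hp (by exact_mod_cast h1)
    · rw [e']
      exact unifLevel_of_mem_schatten hp h2

variable {A B : H →L[ℂ] H}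

theorem form_mono (hp : 1 ≤ p) (hm : m ≤ m') : form ε p m' ⊆ form ε p m := fun _ h =>
  ((unifForm_of_mem_form (ι := Unit) hp h).mono hp hm).mem_form hp ()

theorem mul_mem_form (hp : 1 ≤ p) (hε : ε * ε = 1) (hA : A ∈ form ε p m) (hB : B ∈ form ε p m') :
    A * B ∈ form ε p (m + m') :=
  ((unifForm_of_mem_form (ι := Unit) hp hA).mul hp hε (unifForm_of_mem_form hp hB)).mem_form hp ()

/-- The forms of degree `m` as a subspace. -/
def formSubmodule (ε : H →L[ℂ] H) (hp : 1 ≤ p) (m : ℕ) : Submodule ℂ (H →L[ℂ] H) where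
  carrier := form ε p m
  add_mem' hA hB := ((unifForm_of_mem_form (ι := Unit) hp hA).add hp
    (unifForm_of_mem_form hp hB)).mem_form hp ()
  zero_mem' := (unifForm_zero (ι := Unit) hp).mem_form hp ()
  smul_mem' c _ hA := ((unifForm_of_mem_form (ι := Unit) hp hA).smul
    (c := fun _ => c) (C := ‖c‖) fun _ => le_rfl).mem_form hp ()

theorem mem_formSubmodule {hp : 1 ≤ p} : A ∈ formSubmodule ε hp m ↔ A ∈ form ε p m := Iff.rfl

theorem sub_conj_eq (hε : ε * ε = 1) (A : H →L[ℂ] H) : A - ε * A * ε = ε * dEven ε A := by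
  unfold dEven
  calc A - ε * A * ε = 1 * A - ε * A * ε := by rw [one_mul]
    _ = (ε * ε) * A - ε * A * ε := by rw [hε]
    _ = _ := by noncomm_ring

theorem dEven_eq (hε : ε * ε = 1) (A : H →L[ℂ] H) : dEven ε A = ε * (A - ε * A * ε) := by
  rw [sub_conj_eq hε, ← mul_assoc, hε, one_mul]

/-- Since `ε² = 1`, the commutator `[ε, A]` anticommutes with `ε` and is purely odd. Hence `dEven`
raises even degrees and has zero supertrace. -/
theorem dEven_add_conj (hε : ε * ε = 1) (A : H →L[ℂ] H) :
    dEven ε A + ε * dEven ε A * ε = 0 := by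
  unfold dEven
  have : ε * A - A * ε + ε * (ε * A - A * ε) * ε =
    ε * A - A * ε + ((ε * ε) * A * ε - ε * A * (ε * ε)) := by noncomm_ring
  rw [this, hε]; noncomm_ring

theorem unifLevel_one_iff {A : H →L[ℂ] H} (hp : 1 ≤ p) :
    UnifLevel p 1 (fun _ : Unit => A) ↔ A ∈ schatten H (2 * p) := by
  constructor
  · intro h
    simpa using h.mem_schatten hp one_ne_zero ()
  · intro h
    exact unifLevel_of_mem_schatten hp (by simpa using h)

theorem schatten_mul_left (hp : 1 ≤ p) (hA : A ∈ schatten H (2 * p)) (B : H →L[ℂ] H) :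
    B * A ∈ schatten H (2 * p) := by
  rw [← unifLevel_one_iff hp] at hA ⊢
  simpa using (unifLevel_const_zero B).mul hp hA

theorem mem_gl : A ∈ gl ε p ↔ dEven ε A ∈ schatten H (2 * p) := Iff.rfl

/-- The odd part of `A` is `ε` times `[ε, A]` and conversely, and multiplication by a bounded
operator preserves the Schatten class. -/
theorem mem_gl_iff (hp : 1 ≤ p) (hε : ε * ε = 1) : A ∈ gl ε p ↔ A ∈ form ε p 0 := by
  have h0 : A ∈ form ε p 0 ↔ A - ε * A * ε ∈ schatten H (2 * p) := by
    simp [form]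
  rw [h0]
  constructor
  · intro h
    rw [mem_gl] at h
    rw [sub_conj_eq hε]
    exact schatten_mul_left hp h ε
  · intro h
    rw [mem_gl, dEven_eq hε]
    exact schatten_mul_left hp h ε

theorem dEven_mem_form (hp : 1 ≤ p) (hε : ε * ε = 1) (hm : Even m) (hA : A ∈ form ε p m) :
    dEven ε A ∈ form ε p (m + 1) := by
  have h := unifForm_of_mem_form (ι := Unit) hp hA
  refine UnifForm.mem_form (T := fun _ : Unit => dEven ε A) hp ⟨?_, ?_⟩ ()
  · simp only [dEven_add_conj hε]
    exact unifLevel_zero hp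
  · have e1 : dEven ε A - ε * dEven ε A * ε = (2 : ℂ) • (ε * (A - ε * A * ε)) := by
      have := dEven_add_conj hε A
      rw [← dEven_eq hε, two_smul, sub_eq_iff_eq_add]
      rw [add_assoc, this, add_zero]
    simp only [e1]
    -- Degrees `2j` and `2j + 1` have the same odd level, so the bound on the odd part of `A`
    -- already suffices.
    have e2 : oddLevel (m + 1) = 0 + oddLevel m := by
      obtain ⟨k, rfl⟩ := hm; unfold oddLevel; omega
    rw [e2]
    exact UnifLevel.const_smul (UnifLevel.mul hp (unifLevel_const_zero ε) h.odd) _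

theorem one_mem_form (hp : 1 ≤ p) (hε : ε * ε = 1) : (1 : H →L[ℂ] H) ∈ form ε p 0 := by
  rw [← mem_gl_iff hp hε, mem_gl]
  have : dEven ε (1 : H →L[ℂ] H) = 0 := by simp [dEven]
  rw [this]
  simpa using (unifLevel_zero (H := H) (ι := Unit) (m := 1) hp).mem_schatten hp one_ne_zero ()

theorem pow_mem_form (hp : 1 ≤ p) (hε : ε * ε = 1) (hA : A ∈ form ε p m) (k : ℕ) :
    A ^ k ∈ form ε p (k * m) := by
  induction k with
  | zero => simpa using one_mem_form hp hε
  | succ k ih =>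
    rw [pow_succ, Nat.succ_mul]
    exact mul_mem_form hp hε ih hA

end Forms

/-! ### The supertrace -/

section Supertrace

variable {H : Type*} [NormedAddCommGroup H] [InnerProductSpace ℂ H] [CompleteSpace H] {ι : Type*}
  {ε : H →L[ℂ] H} {p : ℝ} {m m' n : ℕ}

theorem trace_eq_basisTrace (A : H →L[ℂ] H) :
    trace A = basisTrace (exists_hilbertBasis ℂ H).choose_spec.choose A := rfl

/-- Level `2n + 2` means summability to the power `p / (n + 1)`, which is at most `1` by hypothesis.
-/
theorem IsLevel.summable_self (hp : 1 ≤ p) (hpn : p ≤ n + 1) {a : ℕ → ℝ} (ha : IsLevel p m a)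
    (hm : 2 * n + 2 ≤ m) : Summable a := by
  have h2 := (ha.mono hp hm).summable (by omega)
  have := summable_rpow_mono ha.nonneg (s := 1) (by push_cast; positivity) (by
    push_cast
    rw [div_le_one (by positivity)]; linarith) h2
  simpa using this

theorem UnifForm.exists_bound (hp : 1 ≤ p) (hpn : p ≤ n + 1) {T : ι → H →L[ℂ] H}
    (hT : UnifForm ε p (2 * n + 1) T) : ∃ C, ∀ i, ‖str ε (T i)‖ ≤ C := by
  obtain ⟨a, ha, hdom⟩ := hT.even
  have hs := ha.summable_self hp hpn (by unfold evenLevel; omega)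
  refine ⟨‖(1 / 2 : ℂ)‖ * (2 * a 0 + 6 * ∑' k : ℕ, 2 ^ k * a (2 ^ k)), fun i => ?_⟩
  rw [str, norm_mul, trace_eq_basisTrace]
  exact mul_le_mul_of_nonneg_left ((hdom i).norm_basisTrace_le ha.anti ha.nonneg hs)
    (norm_nonneg _)

theorem diagSummable_of_mem_form (hp : 1 ≤ p) (hpn : p ≤ n + 1) {T : H →L[ℂ] H}
    (hT : T ∈ form ε p (2 * n + 1)) :
    DiagSummable (exists_hilbertBasis ℂ H).choose_spec.choose (T + ε * T * ε) := by
  obtain ⟨a, ha, hdom⟩ := (unifForm_of_mem_form (ι := Unit) hp hT).even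
  exact (hdom ()).diagSummable ha.anti ha.nonneg
    (ha.summable_self hp hpn (by unfold evenLevel; omega))

/-- A linear extension of the supertrace on forms of degree `2n + 1` to all bounded operators. -/
theorem exists_linear_str (hp : 1 ≤ p) (hpn : p ≤ n + 1) :
    ∃ τ : (H →L[ℂ] H) →ₗ[ℂ] ℂ, ∀ T ∈ form ε p (2 * n + 1), str ε T = τ T := by
  -- `trace` is a `tsum`, with value `0` when the diagonal is not summable, so additivity is
  -- available only on the subspace of forms. Extending the functional to all operators lets
  -- ordinary linear rewriting be used later.
  let f : formSubmodule ε hp (2 * n + 1) →ₗ[ℂ] ℂ :=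
    { toFun := fun T => str ε T
      map_add' := fun T S => by
        have h : (T + S : H →L[ℂ] H) + ε * (T + S : H →L[ℂ] H) * ε =
            (T + ε * T * ε) + (S + ε * S * ε) := by noncomm_ring
        rw [str, str, str, ← mul_add, trace_eq_basisTrace, trace_eq_basisTrace,
          trace_eq_basisTrace, Submodule.coe_add, h,
          basisTrace_add (diagSummable_of_mem_form hp hpn T.2)
            (diagSummable_of_mem_form hp hpn S.2)]
      map_smul' := fun c T => by
        have h : (c • T : H →L[ℂ] H) + ε * (c • T : H →L[ℂ] H) * ε = c • (T + ε * T * ε) := by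
          rw [smul_add, mul_smul_comm, smul_mul_assoc]
        rw [str, str, trace_eq_basisTrace, trace_eq_basisTrace, Submodule.coe_smul, h,
          basisTrace_smul, smul_eq_mul, RingHom.id_apply]
        ring }
  obtain ⟨g, hg⟩ := f.exists_extend
  exact ⟨g, fun T hT => (congrArg (fun h => h ⟨T, hT⟩) hg).symm⟩

/-- Even parts and odd parts commute separately under the trace: their levels sum to at least `2n +
2`. There is no sign because the supertrace uses the ungraded trace of the even part. -/
theorem str_mul_comm (hp : 1 ≤ p) (hpn : p ≤ n + 1) (hε : ε * ε = 1) {A B : H →L[ℂ] H}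
    (hA : A ∈ form ε p m) (hB : B ∈ form ε p m') (hm : 2 * n + 1 ≤ m + m') :
    str ε (A * B) = str ε (B * A) := by
  have hA' := unifForm_of_mem_form (ι := Unit) hp hA
  have hB' := unifForm_of_mem_form (ι := Unit) hp hB
  obtain ⟨a, ha, hda⟩ := hA'.even
  obtain ⟨a', ha', hda'⟩ := hA'.odd
  obtain ⟨b, hb, hdb⟩ := hB'.even
  obtain ⟨b', hb', hdb'⟩ := hB'.odd
  have h1 := (ha.mul hp hb).summable_self hp hpn (by unfold evenLevel; omega)
  have h2 := (ha'.mul hp hb').summable_self hp hpn (by unfold oddLevel; omega)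
  have hd : ∀ {a b : ℕ → ℝ} {A B : H →L[ℂ] H} {i j : ℕ}, IsLevel p i a → IsLevel p j b →
      Dominated a A → Dominated b B → 2 * n + 2 ≤ i + j →
      DiagSummable (exists_hilbertBasis ℂ H).choose_spec.choose (A * B) := by
    intro a b A B i j ha hb hA hB hij
    have h := ha.comp_div.mul hp hb.comp_div
    exact (hA.mul hB ha.nonneg).diagSummable h.anti h.nonneg (h.summable_self hp hpn hij)
  rw [str, str, even_part_mul hε, even_part_mul hε, trace_eq_basisTrace, trace_eq_basisTrace,
    basisTrace_smul, basisTrace_smul, basisTrace_add, basisTrace_add,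
    basisTrace_mul_comm (hda ()) (hdb ()) ha.anti hb.anti ha.nonneg hb.nonneg h1,
    basisTrace_mul_comm (hda' ()) (hdb' ()) ha'.anti hb'.anti ha'.nonneg hb'.nonneg h2]
  · exact hd hb ha (hdb ()) (hda ()) (by unfold evenLevel; omega)
  · exact hd hb' ha' (hdb' ()) (hda' ()) (by unfold oddLevel; omega)
  · exact hd ha hb (hda ()) (hdb ()) (by unfold evenLevel; omega)
  · exact hd ha' hb' (hda' ()) (hdb' ()) (by unfold oddLevel; omega)

/-- The even part of a commutator with `ε` is identically zero, so no trace class assumption is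
needed. -/
theorem str_dEven (hε : ε * ε = 1) (A : H →L[ℂ] H) : str ε (dEven ε A) = 0 := by
  rw [str, dEven_add_conj hε]
  simp [trace]

end Supertrace

/-! ### First order expansions of curves of forms -/

section Jet

variable {H : Type*} [NormedAddCommGroup H] [InnerProductSpace ℂ H] {ε : H →L[ℂ] H} {p : ℝ}
  {m m' n : ℕ}

/-- The curve `T` in the forms of degree `m` has the expansion `T₀ + t T₁ + O(t²)` at `t = 0`. -/
def Jet (ε : H →L[ℂ] H) (p : ℝ) (m : ℕ) (T : ℝ → H →L[ℂ] H) (T₀ T₁ : H →L[ℂ] H) : Prop :=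
  T₀ ∈ form ε p m ∧ T₁ ∈ form ε p m ∧ ∃ R : ℝ → H →L[ℂ] H,
    UnifForm ε p m (fun t : Set.Icc (-1 : ℝ) 1 => R t) ∧
    ∀ t ∈ Set.Icc (-1 : ℝ) 1, T t = T₀ + (t : ℂ) • T₁ + ((t : ℂ) ^ 2) • R t

variable {T S : ℝ → H →L[ℂ] H} {T₀ T₁ S₀ S₁ : H →L[ℂ] H}

theorem norm_coe_Icc_le (t : Set.Icc (-1 : ℝ) 1) : ‖((t : ℝ) : ℂ)‖ ≤ 1 := by
  rw [Complex.norm_real, Real.norm_eq_abs, abs_le]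
  exact t.2

theorem Jet.mem_form (hp : 1 ≤ p) (h : Jet ε p m T T₀ T₁) {t : ℝ} (ht : t ∈ Set.Icc (-1 : ℝ) 1) :
    T t ∈ form ε p m := by
  obtain ⟨h0, h1, R, hR, hT⟩ := h
  rw [hT t ht]
  have h2 := hR.mem_form hp ⟨t, ht⟩
  rw [← mem_formSubmodule (hp := hp)] at h0 h1 h2 ⊢
  exact add_mem (add_mem h0 (Submodule.smul_mem _ _ h1)) (Submodule.smul_mem _ _ h2)

theorem Jet.zero_mem (h : Jet ε p m T T₀ T₁) : T₀ ∈ form ε p m := h.1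

theorem Jet.deriv_mem (h : Jet ε p m T T₀ T₁) : T₁ ∈ form ε p m := h.2.1

theorem jet_const (hp : 1 ≤ p) (h : T₀ ∈ form ε p m) : Jet ε p m (fun _ => T₀) T₀ 0 :=
  ⟨h, (formSubmodule ε hp m).zero_mem, fun _ => 0, unifForm_zero hp, fun t _ => by simp⟩

theorem jet_smul (hp : 1 ≤ p) (h : T₁ ∈ form ε p m) : Jet ε p m (fun t => (t : ℂ) • T₁) 0 T₁ :=
  ⟨(formSubmodule ε hp m).zero_mem, h, fun _ => 0, unifForm_zero hp, fun t _ => by simp⟩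

theorem Jet.add (hp : 1 ≤ p) (hT : Jet ε p m T T₀ T₁) (hS : Jet ε p m S S₀ S₁) :
    Jet ε p m (fun t => T t + S t) (T₀ + S₀) (T₁ + S₁) := by
  obtain ⟨h0, h1, R, hR, hT⟩ := hT
  obtain ⟨h0', h1', R', hR', hS⟩ := hS
  refine ⟨(formSubmodule ε hp m).add_mem h0 h0', (formSubmodule ε hp m).add_mem h1 h1',
    fun t => R t + R' t, hR.add hp hR', fun t ht => ?_⟩
  beta_reduce
  rw [hT t ht, hS t ht, smul_add, smul_add]
  abel

theorem Jet.const_smul (hp : 1 ≤ p) (hT : Jet ε p m T T₀ T₁) (c : ℂ) :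
    Jet ε p m (fun t => c • T t) (c • T₀) (c • T₁) := by
  obtain ⟨h0, h1, R, hR, hT⟩ := hT
  refine ⟨(formSubmodule ε hp m).smul_mem c h0, (formSubmodule ε hp m).smul_mem c h1,
    fun t => c • R t, hR.smul (c := fun _ => c) (C := ‖c‖) fun _ => le_rfl, fun t ht => ?_⟩
  beta_reduce
  rw [hT t ht]
  simp only [smul_add, smul_smul, mul_comm]

theorem Jet.sum (hp : 1 ≤ p) {κ : Type*} {s : Finset κ} {T : κ → ℝ → H →L[ℂ] H}
    {T₀ T₁ : κ → H →L[ℂ] H} (h : ∀ k ∈ s, Jet ε p m (T k) (T₀ k) (T₁ k)) :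
    Jet ε p m (fun t => ∑ k ∈ s, T k t) (∑ k ∈ s, T₀ k) (∑ k ∈ s, T₁ k) := by
  classical
  induction s using Finset.induction_on with
  | empty => simpa using jet_const hp (formSubmodule ε hp m).zero_mem
  | insert k s hk ih =>
    simp only [Finset.sum_insert hk]
    exact (h k (Finset.mem_insert_self k s)).add hp
      (ih fun j hj => h j (Finset.mem_insert_of_mem hj))

theorem Jet.mul (hp : 1 ≤ p) (hε : ε * ε = 1) (hT : Jet ε p m T T₀ T₁) (hS : Jet ε p m' S S₀ S₁) :
    Jet ε p (m + m') (fun t => T t * S t) (T₀ * S₀) (T₁ * S₀ + T₀ * S₁) := by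
  obtain ⟨h0, h1, R, hR, hT⟩ := hT
  obtain ⟨h0', h1', R', hR', hS⟩ := hS
  have u0 := unifForm_of_mem_form (ι := Set.Icc (-1 : ℝ) 1) hp h0
  have u1 := unifForm_of_mem_form (ι := Set.Icc (-1 : ℝ) 1) hp h1
  have u0' := unifForm_of_mem_form (ι := Set.Icc (-1 : ℝ) 1) hp h0'
  have u1' := unifForm_of_mem_form (ι := Set.Icc (-1 : ℝ) 1) hp h1'
  have hc := norm_coe_Icc_le
  refine ⟨mul_mem_form hp hε h0 h0', (formSubmodule ε hp _).add_mem (mul_mem_form hp hε h1 h0')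
    -- The new remainder collects all terms of order at least two; the leftover powers of `t` are
    -- bounded by `1` on the interval `[-1, 1]`.
    (mul_mem_form hp hε h0 h1'), fun t => T₀ * R' t + T₁ * S₁ + R t * S₀ +
      (t : ℂ) • (T₁ * R' t + R t * S₁ + (t : ℂ) • (R t * R' t)), ?_, fun t ht => ?_⟩
  · exact (((u0.mul hp hε hR').add hp (u1.mul hp hε u1')).add hp (hR.mul hp hε u0')).add hp
      ((((u1.mul hp hε hR').add hp (hR.mul hp hε u1')).add hp
        ((hR.mul hp hε hR').smul hc)).smul hc)
  · beta_reduce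
    rw [hT t ht, hS t ht]
    simp only [mul_add, add_mul, smul_add, smul_mul_assoc, mul_smul_comm, smul_smul]
    module

theorem Jet.cast {m₁ : ℕ} (h : Jet ε p m T T₀ T₁) (hm : m = m₁) : Jet ε p m₁ T T₀ T₁ := hm ▸ h

variable [CompleteSpace H]

/-- The supertrace of the remainder is bounded uniformly in `t`, so the error in the linear
expansion is `O(t²)`. -/
theorem Jet.hasDerivAt_str (hp : 1 ≤ p) (hpn : p ≤ n + 1) (h : Jet ε p (2 * n + 1) T T₀ T₁) :
    HasDerivAt (fun t => str ε (T t)) (str ε T₁) 0 := by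
  obtain ⟨h0, h1, R, hR, hT⟩ := h
  obtain ⟨C, hC⟩ := hR.exists_bound hp hpn
  obtain ⟨τ, hτ⟩ := exists_linear_str (ε := ε) (H := H) hp hpn
  have hf : ∀ t ∈ Set.Icc (-1 : ℝ) 1,
      str ε (T t) = str ε T₀ + (t : ℂ) * str ε T₁ + (t : ℂ) ^ 2 * str ε (R t) := fun t ht => by
    have hR' := hR.mem_form hp ⟨t, ht⟩
    rw [hτ _ (Jet.mem_form hp ⟨h0, h1, R, hR, hT⟩ ht), hτ _ h0, hτ _ h1, hτ _ hR', hT t ht]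
    simp
  have h00 : str ε (T 0) = str ε T₀ := by simpa using hf 0 (by simp)
  rw [hasDerivAt_iff_isLittleO_nhds_zero]
  have hO : (fun t : ℝ => str ε (T (0 + t)) - str ε (T 0) - t • str ε T₁) =O[nhds 0]
      (fun t : ℝ => t ^ 2) := by
    refine Asymptotics.IsBigO.of_bound C ?_
    filter_upwards [Icc_mem_nhds (show (-1 : ℝ) < 0 by norm_num) (show (0 : ℝ) < 1 by norm_num)]
      with t ht
    rw [zero_add, hf t ht, h00]
    have : str ε T₀ + (t : ℂ) * str ε T₁ + (t : ℂ) ^ 2 * str ε (R t) - str ε T₀ - t • str ε T₁ =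
        (t : ℂ) ^ 2 * str ε (R t) := by
      rw [Complex.real_smul]; ring
    rw [this, norm_mul, norm_pow, norm_pow, Complex.norm_real, mul_comm]
    exact mul_le_mul_of_nonneg_right (hC ⟨t, ht⟩) (by positivity)
  refine hO.trans_isLittleO ?_
  simpa using (Asymptotics.isLittleO_pow_pow (𝕜 := ℝ) (show 1 < 2 by norm_num))

theorem unifForm_expRemainder (hp : 1 ≤ p) (hε : ε * ε = 1) {Z : H →L[ℂ] H} (hZ : Z ∈ form ε p 0)
    {ι : Type*} {t : ι → ℂ} (ht : ∀ i, ‖t i‖ ≤ 1) :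
    UnifForm ε p 0 (fun i => expRemainder (t i • Z)) := by
  have hb : UnifLevel p 0 (fun i => expRemainder (t i • Z)) := by
    refine unifLevel_zero_iff.2 ⟨∑' k : ℕ, ‖Z‖ ^ k / k.factorial, fun i =>
      norm_expRemainder_le _ ?_⟩
    rw [norm_smul]
    exact mul_le_of_le_one_left (norm_nonneg _) (ht i)
  refine ⟨?_, unifLevel_expRemainder_sub hp hε (unifForm_of_mem_form hp hZ).odd ht⟩
  exact hb.add hp (((unifLevel_const_zero ε).mul hp hb).mul hp (unifLevel_const_zero ε))

theorem jet_exp_smul (hp : 1 ≤ p) (hε : ε * ε = 1) {Z : H →L[ℂ] H} (hZ : Z ∈ form ε p 0) (c : ℂ)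
    (hc : ‖c‖ ≤ 1) :
    Jet ε p 0 (fun t => NormedSpace.exp (((t : ℂ) * c) • Z)) 1 (c • Z) := by
  refine ⟨one_mem_form hp hε, (formSubmodule ε hp 0).smul_mem c hZ,
    fun t => (c ^ 2) • (Z * Z * expRemainder (((t : ℂ) * c) • Z)), ?_, fun t _ => ?_⟩
  · have hZu := unifForm_of_mem_form (ι := Set.Icc (-1 : ℝ) 1) hp hZ
    refine UnifForm.smul (c := fun _ => c ^ 2) (C := ‖c ^ 2‖) (((hZu.mul hp hε hZu).mul hp hε
      (unifForm_expRemainder hp hε hZ fun t => ?_))) fun _ => le_rfl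
    rw [norm_mul]
    exact mul_le_one₀ (norm_coe_Icc_le t) (norm_nonneg _) hc
  · simp only [exp_eq_add_expRemainder, smul_mul_assoc, mul_smul_comm, smul_smul]
    congr 2
    ring

/-- The exponentials contribute `[B, Z]` and the affine term contributes `[ε, Z]`: the direction is
the commutator of `ε + B` with `Z`. -/
theorem jet_gaugeCurve (hp : 1 ≤ p) (hε : ε * ε = 1) {Z B : H →L[ℂ] H} (hZ : Z ∈ form ε p 0)
    (hB : B ∈ form ε p 1) :
    Jet ε p 1 (gaugeCurve ε Z B) B (B * Z - Z * B + dEven ε Z) := by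
  have h1 := jet_exp_smul hp hε hZ (-1) (by simp)
  have h2 := jet_exp_smul hp hε hZ 1 (by simp)
  have h := (((h1.mul hp hε (jet_const hp hB)).mul hp hε h2).cast (m₁ := 1) rfl).add hp
    (jet_smul hp (dEven_mem_form hp hε (by simp) hZ))
  convert h using 1
  · funext t
    simp [gaugeCurve]
  · simp
  · simp [sub_eq_neg_add]

end Jet

/-! ### Cyclic identities for the transgressed cocycle -/

section CyclicAlgebra

variable {A : Type*} [Ring A]

/-- The derivative of `k = (1 - b²)⁻¹` in the direction `D` of `b`. -/
def dK (k b D : A) : A := k * (D * b + b * D) * k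

/-- The element `k [b, x] k y` representing the cocycle. -/
def cocycleElt (k b x y : A) : A := k * (b * x - x * b) * k * y

/-- The derivative of `k [b, x] k y` in the direction `D` of `b`. -/
def dCocycleElt (k b D x y : A) : A :=
  dK k b D * (b * x - x * b) * k * y + k * (D * x - x * D) * k * y +
    k * (b * x - x * b) * dK k b D * y

/-- The derivative of `k b` in the direction `D` of `b`. -/
def dKB (k b D : A) : A := dK k b D * b + k * D

/-- The second derivative of `k b` in the directions `D` and `D'` of `b`. -/
def ddKB (k b D D' : A) : A :=
  (dK k b D * (D' * b + b * D') * k + k * (D' * D + D * D') * k +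
    k * (D' * b + b * D') * dK k b D) * b + dK k b D' * D + dK k b D * D'

/-- The element representing the coboundary of the 1-cochain `k b x`, where `D x` is the direction
of the gauge action of `x`. -/
def coboundaryElt (k b x y Dx Dy : A) : A :=
  dKB k b Dx * y - dKB k b Dy * x - k * b * (x * y - y * x)

/-- The derivative of `coboundaryElt` in the direction `D` of `b`, when `Dx` and `Dy` vary in the
directions `D'x` and `D'y`. -/
def dCoboundaryElt (k b D x y Dx Dy D'x D'y : A) : A :=
  (ddKB k b D Dx + dKB k b D'x) * y - (ddKB k b D Dy + dKB k b D'y) * x -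
    dKB k b D * (x * y - y * x)

theorem ddKB_symm (k b D D' : A) : ddKB k b D D' = ddKB k b D' D := by
  unfold ddKB dK
  noncomm_ring

theorem dKB_sub (k b D D' : A) : dKB k b (D - D') = dKB k b D - dKB k b D' := by
  unfold dKB dK
  noncomm_ring

/-- The identity δδ = 0 for the element `k b x`, before any trace is taken. It uses that second
derivatives of `k b` are symmetric and that the directions `[a, x]` represent the Lie bracket;
neither flatness nor an inverse relation for `k` enters. -/
theorem dCoboundaryElt_cyclic (k b a x y z : A) :
    dCoboundaryElt k b (a * x - x * a) y z (a * y - y * a) (a * z - z * a)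
        ((a * x - x * a) * y - y * (a * x - x * a)) ((a * x - x * a) * z - z * (a * x - x * a)) -
      dCoboundaryElt k b (a * y - y * a) x z (a * x - x * a) (a * z - z * a)
        ((a * y - y * a) * x - x * (a * y - y * a)) ((a * y - y * a) * z - z * (a * y - y * a)) +
      dCoboundaryElt k b (a * z - z * a) x y (a * x - x * a) (a * y - y * a)
        ((a * z - z * a) * x - x * (a * z - z * a)) ((a * z - z * a) * y - y * (a * z - z * a)) -
      coboundaryElt k b (x * y - y * x) z (a * (x * y - y * x) - (x * y - y * x) * a)
        (a * z - z * a) +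
      coboundaryElt k b (x * z - z * x) y (a * (x * z - z * x) - (x * z - z * x) * a)
        (a * y - y * a) -
      coboundaryElt k b (y * z - z * y) x (a * (y * z - z * y) - (y * z - z * y) * a)
        (a * x - x * a) = 0 := by
  -- The Jacobi identity: the direction of `[x, y]` is the antisymmetrised variation of the
  -- direction of one element along that of the other.
  have h : ∀ x y : A, a * (x * y - y * x) - (x * y - y * x) * a =
      ((a * x - x * a) * y - y * (a * x - x * a)) -
        ((a * y - y * a) * x - x * (a * y - y * a)) := fun x y => by noncomm_ring
  simp only [h, dCoboundaryElt, coboundaryElt, dKB_sub]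
  rw [ddKB_symm k b (a * y - y * a) (a * x - x * a), ddKB_symm k b (a * z - z * a) (a * x - x * a),
    ddKB_symm k b (a * z - z * a) (a * y - y * a)]
  noncomm_ring

variable {k b : A}

/-- The element whose commutator with `e` gives the Ward identity of degree three. -/
def wardElt (k b x y z : A) : A :=
  k * x * k * y * k * z - k * b * x * k * b * y * k * z + k * b * x * k * y * k * b * z -
    k * x * k * b * y * k * b * z

/-- The commutator of `e` with `wardElt`. -/
def dWardElt (k b x y z dx dy dz : A) : A :=
  (k * dx * k * y * k * z + k * b * dx * k * b * y * k * z - k * b * dx * k * y * k * b * z -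
    k * dx * k * b * y * k * b * z) +
  (k * x * k * dy * k * z - k * b * x * k * b * dy * k * z - k * b * x * k * dy * k * b * z +
    k * x * k * b * dy * k * b * z) +
  (k * x * k * y * k * dz - k * b * x * k * b * y * k * dz + k * b * x * k * y * k * b * dz -
    k * x * k * b * y * k * b * dz) +
  (k * b * x * y * k * z - x * k * b * y * k * z + x * k * y * k * b * z - k * b * x * k * y * z -
    k * x * y * k * b * z + k * x * k * b * y * z)

/-- Move `e` to the right through every word. Each word of `wardElt` contains an even number of
letters `b`, so `e` emerges with its original sign. Passing `x`, `y`, `z` creates the differentials,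
and passing `b` creates `b²`, which contracts with `k` through `k b² = k - 1` to give the words
without differentials. -/
theorem commutator_wardElt {e x y z dx dy dz : A} (hkb : b * k = k * b) (hk : k * (b * b) = k - 1)
    (hek : e * k = k * e) (heb : e * b = -(b * e) - b * b) (hx : e * x = x * e + dx)
    (hy : e * y = y * e + dy) (hz : e * z = z * e + dz) :
    e * wardElt k b x y z - wardElt k b x y z * e = dWardElt k b x y z dx dy dz := by
  have hkb' : ∀ c, b * (k * c) = k * (b * c) := fun c => by rw [← mul_assoc, hkb, mul_assoc]
  have hk' : ∀ c, k * (b * (b * c)) = k * c - c := fun c => by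
    rw [← mul_assoc b, ← mul_assoc, hk, sub_mul, one_mul]
  have hek' : ∀ c, e * (k * c) = k * (e * c) := fun c => by rw [← mul_assoc, hek, mul_assoc]
  have heb' : ∀ c, e * (b * c) = -(b * (e * c)) - b * (b * c) := fun c => by
    rw [← mul_assoc, heb]; noncomm_ring
  have hx' : ∀ c, e * (x * c) = x * (e * c) + dx * c := fun c => by
    rw [← mul_assoc, hx]; noncomm_ring
  have hy' : ∀ c, e * (y * c) = y * (e * c) + dy * c := fun c => by
    rw [← mul_assoc, hy]; noncomm_ring
  unfold wardElt dWardElt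
  simp only [mul_assoc, mul_add, add_mul, mul_sub, sub_mul, mul_neg, hk', hek', heb',
    hx', hy', hz]
  abel

/-- In the direction `[b, z]` the derivative of `k` is `[k, z]`, so the derivative of any expression
in `k` and `b` is its commutator with `z`, corrected for the letters `x` and `y` that stay fixed. -/
theorem dCocycleElt_commutator (hkb : b * k = k * b) (hk : k * (b * b) = k - 1) (x y z : A) :
    dCocycleElt k b (b * z - z * b) x y =
      (cocycleElt k b x y * z - z * cocycleElt k b x y) - cocycleElt k b (x * z - z * x) y -
        cocycleElt k b x (y * z - z * y) := by
  have hkb' : ∀ c, b * (k * c) = k * (b * c) := fun c => by rw [← mul_assoc, hkb, mul_assoc]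
  have hk' : ∀ c, k * (b * (b * c)) = k * c - c := fun c => by
    rw [← mul_assoc b, ← mul_assoc, hk, sub_mul, one_mul]
  have h1 : dK k b (b * z - z * b) = k * z - z * k := by
    unfold dK
    simp only [mul_assoc, mul_add, add_mul, mul_sub, sub_mul, hkb, hkb', hk, hk']
    noncomm_ring
  rw [dCocycleElt, h1]
  unfold cocycleElt
  noncomm_ring

theorem dCocycleElt_add (k b D D' x y : A) :
    dCocycleElt k b (D + D') x y = dCocycleElt k b D x y + dCocycleElt k b D' x y := by
  unfold dCocycleElt dK
  noncomm_ring

/-- The words of `dCocycleElt` in the cyclic order `D, x, y`. -/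
def dCocycleWord (k b D x y : A) : A :=
  k * D * k * x * k * y + k * b * D * k * b * x * k * y - k * b * D * k * x * k * b * y -
    k * D * k * b * x * k * b * y

theorem dCocycleElt_eq_words (hkb : b * k = k * b) (hk : k * (b * b) = k - 1) (D x y : A) :
    dCocycleElt k b D x y = dCocycleWord k b D x y -
      (k * x * (k * D * k * y) + k * x * (k * b * D * k * b * y) - k * b * x * (k * b * D * k * y) -
        k * b * x * (k * D * k * b * y)) := by
  have hkb' : ∀ c, b * (k * c) = k * (b * c) := fun c => by rw [← mul_assoc, hkb, mul_assoc]
  have hk' : ∀ c, k * (b * (b * c)) = k * c - c := fun c => by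
    rw [← mul_assoc b, ← mul_assoc, hk, sub_mul, one_mul]
  unfold dCocycleElt dCocycleWord dK
  simp only [mul_assoc, mul_add, add_mul, mul_sub, sub_mul, hkb, hkb', hk']
  abel

theorem cocycleElt_eq (hkb : b * k = k * b) (x y : A) :
    cocycleElt k b x y = k * b * x * k * y - k * x * k * b * y := by
  have hkb' : ∀ c, b * (k * c) = k * (b * c) := fun c => by rw [← mul_assoc, hkb, mul_assoc]
  unfold cocycleElt
  simp only [mul_assoc, mul_sub, sub_mul, hkb']

variable (T : A →+ ℂ) (hT : ∀ f g, T (f * g) = T (g * f))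

include hT in
-- The second bracket of `dCocycleElt_eq_words` consists of cyclic rotations of the words of
-- `dCocycleWord` with `x` and `y` exchanged.
theorem trace_dCocycleElt (hkb : b * k = k * b) (hk : k * (b * b) = k - 1) (D x y : A) :
    T (dCocycleElt k b D x y) = T (dCocycleWord k b D x y) - T (dCocycleWord k b D y x) := by
  have h : dCocycleWord k b D y x = (k * D * k * y) * (k * x) + (k * b * D * k * b * y) * (k * x) -
      (k * b * D * k * y) * (k * b * x) - (k * D * k * b * y) * (k * b * x) := by
    unfold dCocycleWord; noncomm_ring
  rw [dCocycleElt_eq_words hkb hk, h]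
  simp only [map_add, map_sub]
  rw [hT (k * x) _, hT (k * x) _, hT (k * b * x) _, hT (k * b * x) _]

include hT in
-- Rotation exchanges the two words `kbx·ky` and `kx·kby` of the element, up to renaming, and they
-- carry opposite signs.
theorem trace_cocycleElt_swap (hkb : b * k = k * b) (x y : A) :
    T (cocycleElt k b x y) = -T (cocycleElt k b y x) := by
  have h1 : cocycleElt k b x y = (k * b * x) * (k * y) - (k * x) * (k * b * y) := by
    rw [cocycleElt_eq hkb]; noncomm_ring
  have h2 : cocycleElt k b y x = (k * b * y) * (k * x) - (k * y) * (k * b * x) := by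
    rw [cocycleElt_eq hkb]; noncomm_ring
  rw [h1, h2, map_sub, map_sub, hT (k * b * x), hT (k * x)]
  ring

include hT in
-- Rotate each word so that its differential comes first. The six words without differentials pair
-- into cocycle elements evaluated on the products `xy`, `yz`, `zx`.
theorem trace_dWardElt (hkb : b * k = k * b) (x y z dx dy dz : A) :
    T (dWardElt k b x y z dx dy dz) = T (dCocycleWord k b dx y z) + T (dCocycleWord k b dy z x) +
      T (dCocycleWord k b dz x y) + T (cocycleElt k b (x * y) z) + T (cocycleElt k b (y * z) x) +
      T (cocycleElt k b (z * x) y) := by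
  have e1 : dCocycleWord k b dy z x = (k * dy * k * z) * (k * x) +
      (k * b * dy * k * b * z) * (k * x) - (k * b * dy * k * z) * (k * b * x) -
      (k * dy * k * b * z) * (k * b * x) := by unfold dCocycleWord; noncomm_ring
  have e2 : dCocycleWord k b dz x y = (k * dz) * (k * x * k * y) +
      (k * b * dz) * (k * b * x * k * y) - (k * b * dz) * (k * x * k * b * y) -
      (k * dz) * (k * b * x * k * b * y) := by unfold dCocycleWord; noncomm_ring
  have e3 : cocycleElt k b (x * y) z = k * b * x * y * k * z - k * x * y * k * b * z := by
    rw [cocycleElt_eq hkb]; noncomm_ring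
  have e4 : cocycleElt k b (y * z) x = (k * b * y * z) * (k * x) - (k * y * z) * (k * b * x) := by
    rw [cocycleElt_eq hkb]; noncomm_ring
  have e5 : cocycleElt k b (z * x) y = (k * b * z) * (x * k * y) - (k * z) * (x * k * b * y) := by
    rw [cocycleElt_eq hkb]; noncomm_ring
  rw [e1, e2, e3, e4, e5]
  simp only [map_add, map_sub]
  rw [hT (k * dy * k * z), hT (k * b * dy * k * b * z), hT (k * b * dy * k * z),
    hT (k * dy * k * b * z), hT (k * dz) (k * x * k * y), hT (k * b * dz) (k * b * x * k * y),
    hT (k * b * dz) (k * x * k * b * y), hT (k * dz) (k * b * x * k * b * y),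
    hT (k * b * y * z), hT (k * y * z), hT (k * b * z), hT (k * z)]
  unfold dWardElt dCocycleWord
  simp only [map_add, map_sub, mul_assoc]
  ring

include hT in
/-- The cocycle identity. -/
theorem trace_coboundary_cocycleElt (hkb : b * k = k * b) (hk : k * (b * b) = k - 1)
    {x y z dx dy dz : A} (h1 : T (dWardElt k b x y z dx dy dz) = 0)
    (h2 : T (dWardElt k b y x z dy dx dz) = 0) :
    T (dCocycleElt k b (b * x - x * b + dx) y z) - T (dCocycleElt k b (b * y - y * b + dy) x z) +
      T (dCocycleElt k b (b * z - z * b + dz) x y) - T (cocycleElt k b (x * y - y * x) z) +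
      T (cocycleElt k b (x * z - z * x) y) - T (cocycleElt k b (y * z - z * y) x) = 0 := by
  have hsub : ∀ u v w : A, T (cocycleElt k b (u - v) w) =
      T (cocycleElt k b u w) - T (cocycleElt k b v w) := fun u v w => by
    rw [← map_sub]; congr 1; unfold cocycleElt; noncomm_ring
  -- Split the gauge direction. Its part `[b, z]` acts as a derivation, whose total commutator
  -- vanishes under `T`; its part `dz` leaves the antisymmetrised words.
  have hL : ∀ x y z dz : A, T (dCocycleElt k b (b * z - z * b + dz) x y) =
      T (dCocycleWord k b dz x y) - T (dCocycleWord k b dz y x) -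
        T (cocycleElt k b (x * z - z * x) y) + T (cocycleElt k b (y * z - z * y) x) :=
    fun x y z dz => by
      rw [dCocycleElt_add, map_add, trace_dCocycleElt T hT hkb hk dz, dCocycleElt_commutator hkb hk,
        map_sub, map_sub, map_sub, hT _ z, trace_cocycleElt_swap T hT hkb x]
      ring
  rw [trace_dWardElt T hT hkb] at h1 h2
  rw [hL, hL, hL]
  simp only [hsub]
  -- Antisymmetrising the Ward identity in its first two arguments turns products into brackets and
  -- single words into derivatives of the cocycle.
  linear_combination h1 - h2

/-- The two-letter analogues of the Ward identity. They relate words carrying `dx` to words carrying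
`dy`, once without and once with factors `b`. -/
theorem commutator_wardElt₂ {e x y dx dy : A} (hkb : b * k = k * b) (hk : k * (b * b) = k - 1)
    (hek : e * k = k * e) (heb : e * b = -(b * e) - b * b) (hx : e * x = x * e + dx)
    (hy : e * y = y * e + dy) :
    e * (k * x * k * y) - (k * x * k * y) * e = k * dx * k * y + k * x * k * dy ∧
    e * (k * b * x * k * b * y) - (k * b * x * k * b * y) * e =
      -(k * x * k * b * y) + x * k * b * y - k * b * dx * k * b * y + k * b * x * k * y -
        k * b * x * y + k * b * x * k * b * dy := by
  have hkb' : ∀ c, b * (k * c) = k * (b * c) := fun c => by rw [← mul_assoc, hkb, mul_assoc]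
  have hk' : ∀ c, k * (b * (b * c)) = k * c - c := fun c => by
    rw [← mul_assoc b, ← mul_assoc, hk, sub_mul, one_mul]
  have hek' : ∀ c, e * (k * c) = k * (e * c) := fun c => by rw [← mul_assoc, hek, mul_assoc]
  have heb' : ∀ c, e * (b * c) = -(b * (e * c)) - b * (b * c) := fun c => by
    rw [← mul_assoc, heb]; noncomm_ring
  have hx' : ∀ c, e * (x * c) = x * (e * c) + dx * c := fun c => by
    rw [← mul_assoc, hx]; noncomm_ring
  constructor
  · simp only [mul_assoc, mul_add, hek', hx', hy]
    abel
  · simp only [mul_assoc, mul_add, mul_sub, mul_neg, hk', hek', heb', hx', hy]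
    abel

include hT in
/-- The difference of the cocycle and the coboundary of `k b x`. -/
theorem trace_cocycleElt_sub_coboundaryElt (hkb : b * k = k * b) (hk : k * (b * b) = k - 1)
    {x y dx dy : A} (h1 : T (k * dx * k * y + k * x * k * dy) = 0)
    (h2 : T (-(k * x * k * b * y) + x * k * b * y - k * b * dx * k * b * y + k * b * x * k * y -
        k * b * x * y + k * b * x * k * b * dy) = 0) :
    T (cocycleElt k b x y) -
      T (coboundaryElt k b x y (b * x - x * b + dx) (b * y - y * b + dy)) =
        -2 * T (k * dx * k * y) := by
  have hkb' : ∀ c, b * (k * c) = k * (b * c) := fun c => by rw [← mul_assoc, hkb, mul_assoc]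
  have hk' : ∀ c, k * (b * (b * c)) = k * c - c := fun c => by
    rw [← mul_assoc b, ← mul_assoc, hk, sub_mul, one_mul]
  -- The gauge derivative of `k b` is its commutator with `z` plus a part linear in `dz`, simplified
  -- by `k b² = k - 1`.
  have hD : ∀ z dz : A, dKB k b (b * z - z * b + dz) = k * b * z - z * (k * b) + k * dz * k +
      k * b * dz * k * b := fun z dz => by
    unfold dKB dK
    simp only [mul_assoc, mul_add, add_mul, mul_sub, sub_mul, hkb, hkb', hk, hk', mul_one]
    abel
  have e1 : coboundaryElt k b x y (b * x - x * b + dx) (b * y - y * b + dy) =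
      k * b * (x * y) - x * (k * b * y) + k * dx * k * y + k * b * dx * k * b * y -
        (k * b * (y * x) - y * (k * b * x) + (k * dy) * (k * x) + (k * b * dy) * (k * b * x)) -
        (k * b * (x * y) - k * b * (y * x)) := by
    unfold coboundaryElt
    rw [hD, hD]
    noncomm_ring
  rw [e1, cocycleElt_eq hkb]
  simp only [map_add, map_sub, map_neg] at h1 h2 ⊢
  rw [hT y, hT (k * dy), hT (k * b * dy)]
  simp only [mul_assoc] at h1 h2 ⊢
  linear_combination h1 + h2

end CyclicAlgebra

/-! ### Power series of forms -/

section Series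

set_option linter.unusedSectionVars false

variable {H : Type*} [NormedAddCommGroup H] [InnerProductSpace ℂ H] {ε : H →L[ℂ] H} {p : ℝ}

open PowerSeries

/-- The power series `s A`. -/
noncomputable def bSer (A : H →L[ℂ] H) : PowerSeries (H →L[ℂ] H) := C A * X

/-- The power series `(1 - s² B²)⁻¹`. -/
noncomputable def kSer (B : H →L[ℂ] H) : PowerSeries (H →L[ℂ] H) :=
  PowerSeries.mk fun l => if Even l then B ^ l else 0

theorem coeff_bSer_mul_succ (A : H →L[ℂ] H) (f : PowerSeries (H →L[ℂ] H)) (l : ℕ) :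
    coeff (l + 1) (bSer A * f) = A * coeff l f := by
  rw [bSer, mul_assoc, coeff_C_mul, coeff_succ_X_mul]

theorem coeff_bSer_mul_zero (A : H →L[ℂ] H) (f : PowerSeries (H →L[ℂ] H)) :
    coeff 0 (bSer A * f) = 0 := by
  rw [bSer, mul_assoc, coeff_C_mul, coeff_zero_X_mul, mul_zero]

theorem coeff_mul_bSer_succ (A : H →L[ℂ] H) (f : PowerSeries (H →L[ℂ] H)) (l : ℕ) :
    coeff (l + 1) (f * bSer A) = coeff l f * A := by
  rw [bSer, ← mul_assoc, coeff_succ_mul_X, coeff_mul_C]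

theorem coeff_mul_bSer_zero (A : H →L[ℂ] H) (f : PowerSeries (H →L[ℂ] H)) :
    coeff 0 (f * bSer A) = 0 := by
  rw [bSer, ← mul_assoc, coeff_zero_mul_X]

theorem coeff_kSer_add_two (B : H →L[ℂ] H) (l : ℕ) :
    coeff (l + 2) (kSer B) = B * (B * coeff l (kSer B)) := by
  rw [kSer, coeff_mk, coeff_mk]
  have : Even (l + 2) ↔ Even l := by simp [Nat.even_add]
  simp only [this]
  split_ifs
  · rw [pow_succ', pow_succ']
  · simp

theorem bSer_mul_kSer (B : H →L[ℂ] H) : bSer B * kSer B = kSer B * bSer B := by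
  ext1 l
  cases l with
  | zero => rw [coeff_bSer_mul_zero, coeff_mul_bSer_zero]
  | succ l =>
    rw [coeff_bSer_mul_succ, coeff_mul_bSer_succ, kSer, coeff_mk]
    split_ifs
    · rw [← pow_succ, pow_succ']
    · simp

theorem kSer_mul_bSer_sq (B : H →L[ℂ] H) : kSer B * (bSer B * bSer B) = kSer B - 1 := by
  have h : bSer B * (bSer B * kSer B) = kSer B - 1 := by
    ext1 l
    rcases l with _ | _ | l
    · rw [coeff_bSer_mul_zero, map_sub, kSer, coeff_mk]
      simp
    · rw [coeff_bSer_mul_succ, coeff_bSer_mul_zero, map_sub, kSer, coeff_mk]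
      simp [coeff_one]
    · rw [coeff_bSer_mul_succ, coeff_bSer_mul_succ, map_sub, ← coeff_kSer_add_two]
      simp [coeff_one]
  rw [← h, ← mul_assoc, ← mul_assoc, ← bSer_mul_kSer, mul_assoc, ← bSer_mul_kSer, ← mul_assoc]

theorem bSer_mul_C (A X : H →L[ℂ] H) : bSer A * C X = bSer (A * X) := by
  rw [bSer, bSer, mul_assoc, X_mul, ← mul_assoc, ← map_mul]

theorem C_mul_bSer (A X : H →L[ℂ] H) : C X * bSer A = bSer (X * A) := by
  rw [bSer, bSer, ← mul_assoc, ← map_mul]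

theorem bSer_add (A B : H →L[ℂ] H) : bSer (A + B) = bSer A + bSer B := by
  rw [bSer, map_add, add_mul, bSer, bSer]

theorem bSer_sub (A B : H →L[ℂ] H) : bSer (A - B) = bSer A - bSer B := by
  rw [bSer, map_sub, sub_mul, bSer, bSer]

theorem bSer_mul_bSer (A B : H →L[ℂ] H) : bSer A * bSer B = C (A * B) * X * X := by
  rw [bSer, bSer, map_mul]
  simp only [mul_assoc]
  rw [← mul_assoc X, X_mul, mul_assoc]

theorem bSer_eps_mul_C (X : H →L[ℂ] H) :
    bSer ε * C X = C X * bSer ε + bSer (dEven ε X) := by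
  rw [bSer_mul_C, C_mul_bSer, dEven, bSer_sub]
  abel

theorem bSer_eps_mul_bSer {B : H →L[ℂ] H} (hB : dOdd ε B + B * B = 0) :
    bSer ε * bSer B = -(bSer B * bSer ε) - bSer B * bSer B := by
  have h : ε * B = -(B * ε) - B * B := by
    have := hB
    unfold dOdd at this
    rw [← sub_eq_zero, ← this]; abel
  rw [bSer_mul_bSer, h, bSer_mul_bSer, bSer_mul_bSer, map_sub, map_neg]
  noncomm_ring

/-- Flatness gives `εB = -Bε - B²`. Passing a second `B` reverses the sign and the two cubic terms
cancel, so `ε` commutes with even powers of a flat connection. -/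
theorem commute_sq {B : H →L[ℂ] H} (hB : dOdd ε B + B * B = 0) : Commute ε (B ^ 2) := by
  have h : ε * B = -(B * ε) - B * B := by
    have := hB
    unfold dOdd at this
    rw [← sub_eq_zero, ← this]; abel
  change ε * B ^ 2 = B ^ 2 * ε
  calc ε * B ^ 2 = (ε * B) * B := by noncomm_ring
    _ = (-(B * ε) - B * B) * B := by rw [h]
    _ = -(B * (ε * B)) - B * B * B := by noncomm_ring
    _ = -(B * (-(B * ε) - B * B)) - B * B * B := by rw [h]
    _ = B ^ 2 * ε := by noncomm_ring

theorem bSer_eps_mul_kSer {B : H →L[ℂ] H} (hB : dOdd ε B + B * B = 0) :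
    bSer ε * kSer B = kSer B * bSer ε := by
  ext1 l
  cases l with
  | zero => rw [coeff_bSer_mul_zero, coeff_mul_bSer_zero]
  | succ l =>
    rw [coeff_bSer_mul_succ, coeff_mul_bSer_succ, kSer, coeff_mk]
    split_ifs with h
    · obtain ⟨i, rfl⟩ := h
      rw [← two_mul, pow_mul]
      exact (commute_sq hB).pow_right i
    · simp

/-- The power series whose coefficient at `s ^ l` is a form of degree `l`. -/
noncomputable def formSeries (hp : 1 ≤ p) (hε : ε * ε = 1) :
    Subring (PowerSeries (H →L[ℂ] H)) where
  carrier := {f | ∀ l, coeff l f ∈ form ε p l}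
  mul_mem' {f g} hf hg l := by
    rw [coeff_mul]
    refine (formSubmodule ε hp l).sum_mem fun i hi => ?_
    have h := mul_mem_form hp hε (hf i.1) (hg i.2)
    rwa [Finset.HasAntidiagonal.mem_antidiagonal.1 hi] at h
  one_mem' l := by
    rw [coeff_one]
    split_ifs with h
    · rw [h]; exact one_mem_form hp hε
    · exact (formSubmodule ε hp l).zero_mem
  add_mem' {f g} hf hg l := by
    rw [map_add]
    exact (formSubmodule ε hp l).add_mem (hf l) (hg l)
  zero_mem' l := by
    rw [map_zero]
    exact (formSubmodule ε hp l).zero_mem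
  neg_mem' {f} hf l := by
    rw [map_neg]
    exact (formSubmodule ε hp l).neg_mem (hf l)

variable {hp : 1 ≤ p} {hε : ε * ε = 1}

theorem C_mem_formSeries {A : H →L[ℂ] H} (hA : A ∈ form ε p 0) : C A ∈ formSeries hp hε :=
  fun l => by
    rw [coeff_C]
    split_ifs with h
    · rw [h]; exact hA
    · exact (formSubmodule ε hp l).zero_mem

theorem bSer_mem_formSeries {A : H →L[ℂ] H} (hA : A ∈ form ε p 1) : bSer A ∈ formSeries hp hε :=
  fun l => by
    rcases l with _ | _ | l
    · rw [← mul_one (bSer A), coeff_bSer_mul_zero]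
      exact (formSubmodule ε hp _).zero_mem
    · rw [← mul_one (bSer A), coeff_bSer_mul_succ]
      simpa using hA
    · rw [← mul_one (bSer A), coeff_bSer_mul_succ]
      have : coeff (l + 1) (1 : PowerSeries (H →L[ℂ] H)) = 0 := by simp [coeff_one]
      rw [this, mul_zero]
      exact (formSubmodule ε hp _).zero_mem

theorem kSer_mem_formSeries {B : H →L[ℂ] H} (hB : B ∈ form ε p 1) : kSer B ∈ formSeries hp hε :=
  fun l => by
    rw [kSer, coeff_mk]
    split_ifs with h
    · simpa using pow_mem_form hp hε hB l
    · exact (formSubmodule ε hp l).zero_mem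

variable [CompleteSpace H] {n : ℕ}

/-- The linear functional on power series of operators induced by the coefficient at
`s ^ (2n + 1)`. -/
noncomputable def coeffFunctional (τ : (H →L[ℂ] H) →ₗ[ℂ] ℂ) (n : ℕ) :
    PowerSeries (H →L[ℂ] H) →+ ℂ :=
  τ.toAddMonoidHom.comp (coeff (R := H →L[ℂ] H) (2 * n + 1)).toAddMonoidHom

theorem coeffFunctional_apply (τ : (H →L[ℂ] H) →ₗ[ℂ] ℂ) (f : PowerSeries (H →L[ℂ] H)) :
    coeffFunctional τ n f = τ (coeff (2 * n + 1) f) := rfl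

variable {τ : (H →L[ℂ] H) →ₗ[ℂ] ℂ}

theorem linear_str_mul_comm (hp : 1 ≤ p) (hε : ε * ε = 1) (hpn : p ≤ n + 1)
    (hτ : ∀ T ∈ form ε p (2 * n + 1), str ε T = τ T)
    {i j : ℕ} {A B : H →L[ℂ] H} (hA : A ∈ form ε p i) (hB : B ∈ form ε p j)
    (hij : 2 * n + 1 ≤ i + j) : τ (A * B) = τ (B * A) := by
  rw [← hτ _ (form_mono hp hij (mul_mem_form hp hε hA hB)),
    ← hτ _ (form_mono hp (hij.trans_eq (add_comm i j)) (mul_mem_form hp hε hB hA)),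
    str_mul_comm hp hpn hε hA hB hij]

/-- The coefficient at `s ^ (2n + 1)` of a product pairs forms of total degree `2n + 1`, where the
supertrace is cyclic. -/
theorem coeffFunctional_mul_comm (hpn : p ≤ n + 1)
    (hτ : ∀ T ∈ form ε p (2 * n + 1), str ε T = τ T) {f g : PowerSeries (H →L[ℂ] H)}
    (hf : f ∈ formSeries hp hε) (hg : g ∈ formSeries hp hε) :
    coeffFunctional τ n (f * g) = coeffFunctional τ n (g * f) := by
  rw [coeffFunctional_apply, coeffFunctional_apply, coeff_mul, coeff_mul,
    ← Finset.Nat.sum_antidiagonal_swap, map_sum, map_sum]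
  refine Finset.sum_congr rfl fun i hi => ?_
  have hi' := Finset.HasAntidiagonal.mem_antidiagonal.1 hi
  exact linear_str_mul_comm hp hε hpn hτ (hf i.2) (hg i.1) (by omega)

/-- This is not an instance of cyclicity, since membership of `bSer ε` in `formSeries` is not
available. The relevant coefficient is instead `dEven` of a form of degree `2n`, whose supertrace is
zero. -/
theorem coeffFunctional_commutator (hτ : ∀ T ∈ form ε p (2 * n + 1), str ε T = τ T)
    {f : PowerSeries (H →L[ℂ] H)} (hf : f ∈ formSeries hp hε) :
    coeffFunctional τ n (bSer ε * f - f * bSer ε) = 0 := by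
  rw [coeffFunctional_apply, map_sub, coeff_bSer_mul_succ, coeff_mul_bSer_succ]
  have h := dEven_mem_form hp hε (by simp) (hf (2 * n))
  have h2 := hτ _ h
  rw [str_dEven hε] at h2
  exact h2.symm

/-- The restriction of the coefficient functional to power series of forms is a trace. -/
noncomputable def formFunctional (hp : 1 ≤ p) (hε : ε * ε = 1) (τ : (H →L[ℂ] H) →ₗ[ℂ] ℂ) (n : ℕ) :
    formSeries hp hε →+ ℂ :=
  (coeffFunctional τ n).comp (formSeries hp hε).subtype.toAddMonoidHom

/-! ### First order expansions of curves of power series -/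

/-- First order expansion of a curve in the power series of forms. -/
def SerJet (ε : H →L[ℂ] H) (p : ℝ) (f : ℝ → PowerSeries (H →L[ℂ] H))
    (f₀ f₁ : PowerSeries (H →L[ℂ] H)) : Prop :=
  ∀ l, Jet ε p l (fun t => coeff l (f t)) (coeff l f₀) (coeff l f₁)

section SerJet

variable {f g : ℝ → PowerSeries (H →L[ℂ] H)} {f₀ f₁ g₀ g₁ : PowerSeries (H →L[ℂ] H)}

theorem SerJet.congr {f' : ℝ → PowerSeries (H →L[ℂ] H)} {f₀' f₁' : PowerSeries (H →L[ℂ] H)}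
    (h : SerJet ε p f f₀ f₁) (hf : f = f') (h0 : f₀ = f₀') (h1 : f₁ = f₁') :
    SerJet ε p f' f₀' f₁' := by
  rwa [← hf, ← h0, ← h1]

theorem SerJet.add (hp : 1 ≤ p) (hf : SerJet ε p f f₀ f₁) (hg : SerJet ε p g g₀ g₁) :
    SerJet ε p (fun t => f t + g t) (f₀ + g₀) (f₁ + g₁) := fun l => by
  simpa using (hf l).add hp (hg l)

theorem SerJet.sub (hp : 1 ≤ p) (hf : SerJet ε p f f₀ f₁) (hg : SerJet ε p g g₀ g₁) :
    SerJet ε p (fun t => f t - g t) (f₀ - g₀) (f₁ - g₁) := fun l => by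
  simpa [sub_eq_add_neg] using (hf l).add hp ((hg l).const_smul hp (-1))

theorem SerJet.mul (hp : 1 ≤ p) (hε : ε * ε = 1) (hf : SerJet ε p f f₀ f₁)
    (hg : SerJet ε p g g₀ g₁) :
    SerJet ε p (fun t => f t * g t) (f₀ * g₀) (f₁ * g₀ + f₀ * g₁) := fun l => by
  simp only [coeff_mul, map_add, ← Finset.sum_add_distrib]
  refine Jet.sum hp fun i hi => ?_
  exact ((hf i.1).mul hp hε (hg i.2)).cast (Finset.HasAntidiagonal.mem_antidiagonal.1 hi)

theorem serJet_C (hp : 1 ≤ p) {A : H →L[ℂ] H} (hA : A ∈ form ε p 0) :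
    SerJet ε p (fun _ => C A) (C A) 0 := fun l => by
  simp only [map_zero, coeff_C]
  split_ifs with h
  · rw [h]; exact jet_const hp hA
  · exact jet_const hp (formSubmodule ε hp l).zero_mem

theorem serJet_bSer (hp : 1 ≤ p) {T : ℝ → H →L[ℂ] H} {B D : H →L[ℂ] H} (hT : Jet ε p 1 T B D) :
    SerJet ε p (fun t => bSer (T t)) (bSer B) (bSer D) := fun l => by
  have h0 : ∀ A : H →L[ℂ] H, coeff 0 (bSer A) = 0 := fun A => by
    rw [← mul_one (bSer A), coeff_bSer_mul_zero]
  have h1 : ∀ A : H →L[ℂ] H, coeff 1 (bSer A) = A := fun A => by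
    rw [← mul_one (bSer A), coeff_bSer_mul_succ]; simp
  have h2 : ∀ (A : H →L[ℂ] H) (l : ℕ), coeff (l + 2) (bSer A) = 0 := fun A l => by
    rw [← mul_one (bSer A), coeff_bSer_mul_succ]; simp [coeff_one]
  rcases l with _ | _ | l
  · simp only [h0]
    exact jet_const hp (formSubmodule ε hp _).zero_mem
  · simp only [zero_add, h1]
    exact hT
  · simp only [h2]
    exact jet_const hp (formSubmodule ε hp _).zero_mem

/-- The relation `k = 1 + b²k` gives a two-step recursion for the coefficients, and `dK` satisfies
the linearised recursion; hence induction by two. -/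
theorem serJet_kSer (hp : 1 ≤ p) (hε : ε * ε = 1) {T : ℝ → H →L[ℂ] H} {B D : H →L[ℂ] H}
    (hT : Jet ε p 1 T B D) :
    SerJet ε p (fun t => kSer (T t)) (kSer B) (dK (kSer B) (bSer B) (bSer D)) := by
  have hk1 : kSer B = 1 + bSer B * (bSer B * kSer B) := by
    rw [bSer_mul_kSer, ← mul_assoc, bSer_mul_kSer, mul_assoc, kSer_mul_bSer_sq]; abel
  have hdK : dK (kSer B) (bSer B) (bSer D) = bSer D * (bSer B * kSer B) +
      bSer B * (bSer D * kSer B) + bSer B * (bSer B * dK (kSer B) (bSer B) (bSer D)) := by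
    unfold dK
    calc kSer B * (bSer D * bSer B + bSer B * bSer D) * kSer B
        = (1 + bSer B * (bSer B * kSer B)) * (bSer D * bSer B + bSer B * bSer D) * kSer B := by
          rw [← hk1]
      _ = _ := by noncomm_ring
  have h00 : ∀ A : H →L[ℂ] H, coeff 0 (kSer A) = 1 := fun A => by rw [kSer, coeff_mk]; simp
  have h01 : ∀ A : H →L[ℂ] H, coeff 1 (kSer A) = 0 := fun A => by rw [kSer, coeff_mk]; simp
  intro l
  induction l using Nat.twoStepInduction with
  | zero =>
    rw [hdK]
    simp only [h00, map_add, coeff_bSer_mul_zero, add_zero]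
    exact jet_const hp (one_mem_form hp hε)
  | one =>
    rw [hdK]
    simp only [h01, map_add]
    rw [← zero_add 1]
    simp only [coeff_bSer_mul_succ, coeff_bSer_mul_zero, mul_zero, add_zero]
    exact jet_const hp (formSubmodule ε hp _).zero_mem
  | more l ih _ =>
    rw [hdK]
    simp only [map_add, coeff_kSer_add_two, coeff_bSer_mul_succ]
    have h := (hT.mul hp hε (hT.mul hp hε ih)).cast (m₁ := l + 2) (by ring)
    convert h using 1
    noncomm_ring

theorem SerJet.hasDerivAt (hp : 1 ≤ p) (hpn : p ≤ n + 1) (hf : SerJet ε p f f₀ f₁) :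
    HasDerivAt (fun t => str ε (coeff (2 * n + 1) (f t))) (str ε (coeff (2 * n + 1) f₁)) 0 :=
  (hf (2 * n + 1)).hasDerivAt_str hp hpn

theorem serJet_cocycleElt (hp : 1 ≤ p) (hε : ε * ε = 1) {T : ℝ → H →L[ℂ] H} {B D X Y : H →L[ℂ] H}
    (hT : Jet ε p 1 T B D) (hX : X ∈ form ε p 0) (hY : Y ∈ form ε p 0) :
    SerJet ε p (fun t => cocycleElt (kSer (T t)) (bSer (T t)) (C X) (C Y))
      (cocycleElt (kSer B) (bSer B) (C X) (C Y))
      (dCocycleElt (kSer B) (bSer B) (bSer D) (C X) (C Y)) := by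
  have hk := serJet_kSer hp hε hT
  have hb := serJet_bSer hp hT
  have hx := serJet_C hp hX
  have hy := serJet_C hp hY
  have h := ((hk.mul hp hε ((hb.mul hp hε hx).sub hp (hx.mul hp hε hb))).mul hp hε hk).mul hp hε hy
  refine h.congr rfl rfl ?_
  unfold dCocycleElt
  noncomm_ring

/-- The direction of the gauge action of `X` at `B`. -/
noncomputable def gaugeSer (ε X B : H →L[ℂ] H) : PowerSeries (H →L[ℂ] H) :=
  bSer B * C X - C X * bSer B + bSer (dEven ε X)

theorem bSer_gauge (ε X B : H →L[ℂ] H) :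
    bSer (B * X - X * B + dEven ε X) = gaugeSer ε X B := by
  rw [gaugeSer, bSer_add, bSer_sub, bSer_mul_C, C_mul_bSer]

/-- Written as a commutator with `ε + B`, the gauge direction has the shape required by
`dCoboundaryElt_cyclic`. -/
theorem gaugeSer_eq (ε X B : H →L[ℂ] H) :
    gaugeSer ε X B = (bSer ε + bSer B) * C X - C X * (bSer ε + bSer B) := by
  rw [gaugeSer, dEven, bSer_sub, ← bSer_mul_C, ← C_mul_bSer]
  noncomm_ring

/-- The gauge directions themselves depend on `B`, so their variations `[D, X]` and `[D, Y]` appear.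
The zeroth order part of this expansion later serves as a proof that the coefficients are forms. -/
theorem serJet_coboundaryElt (hp : 1 ≤ p) (hε : ε * ε = 1) {T : ℝ → H →L[ℂ] H}
    {B D X Y : H →L[ℂ] H} (hT : Jet ε p 1 T B D) (hX : X ∈ form ε p 0) (hY : Y ∈ form ε p 0) :
    SerJet ε p (fun t => coboundaryElt (kSer (T t)) (bSer (T t)) (C X) (C Y) (gaugeSer ε X (T t))
        (gaugeSer ε Y (T t)))
      (coboundaryElt (kSer B) (bSer B) (C X) (C Y) (gaugeSer ε X B) (gaugeSer ε Y B))
      (dCoboundaryElt (kSer B) (bSer B) (bSer D) (C X) (C Y) (gaugeSer ε X B) (gaugeSer ε Y B)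
        (bSer D * C X - C X * bSer D) (bSer D * C Y - C Y * bSer D)) := by
  have hk := serJet_kSer hp hε hT
  have hb := serJet_bSer hp hT
  have hx := serJet_C hp hX
  have hy := serJet_C hp hY
  have hg : ∀ {X : H →L[ℂ] H}, X ∈ form ε p 0 → SerJet ε p (fun t => gaugeSer ε X (T t))
      (gaugeSer ε X B) (bSer D * C X - C X * bSer D) := fun {X} hX => by
    have hx := serJet_C hp hX
    have h := ((hb.mul hp hε hx).sub hp (hx.mul hp hε hb)).add hp
      (serJet_bSer hp (jet_const hp (dEven_mem_form hp hε (by simp) hX)))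
    refine h.congr rfl rfl ?_
    have : bSer (0 : H →L[ℂ] H) = 0 := by simp [bSer]
    rw [this]
    noncomm_ring
  have hP : ∀ {X : H →L[ℂ] H}, X ∈ form ε p 0 →
      SerJet ε p (fun t => dKB (kSer (T t)) (bSer (T t)) (gaugeSer ε X (T t)))
        (dKB (kSer B) (bSer B) (gaugeSer ε X B))
        (ddKB (kSer B) (bSer B) (bSer D) (gaugeSer ε X B) +
          dKB (kSer B) (bSer B) (bSer D * C X - C X * bSer D)) := fun {X} hX => by
    have hv := hg hX
    have h := ((((hk.mul hp hε ((hv.mul hp hε hb).add hp (hb.mul hp hε hv))).mul hp hε hk).mul hp hε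
      hb).add hp (hk.mul hp hε hv))
    refine h.congr rfl rfl ?_
    unfold ddKB dKB dK
    noncomm_ring
  have h := (((hP hX).mul hp hε hy).sub hp ((hP hY).mul hp hε hx)).sub hp
    ((hk.mul hp hε hb).mul hp hε ((hx.mul hp hε hy).sub hp (hy.mul hp hε hx)))
  refine h.congr rfl rfl ?_
  unfold dCoboundaryElt dKB
  noncomm_ring

theorem serJet_kSer_mul_bSer (hp : 1 ≤ p) (hε : ε * ε = 1) {T : ℝ → H →L[ℂ] H} {B D X : H →L[ℂ] H}
    (hT : Jet ε p 1 T B D) (hX : X ∈ form ε p 0) :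
    SerJet ε p (fun t => kSer (T t) * bSer (T t) * C X) (kSer B * bSer B * C X)
      (dKB (kSer B) (bSer B) (bSer D) * C X) := by
  have hk := serJet_kSer hp hε hT
  have hb := serJet_bSer hp hT
  have hx := serJet_C hp hX
  have h := (hk.mul hp hε hb).mul hp hε hx
  refine h.congr rfl rfl ?_
  unfold dKB
  noncomm_ring

end SerJet

end Series

/-! ### The cochains -/

section Cochains

set_option linter.unusedSectionVars false

open PowerSeries

variable {H : Type*} [NormedAddCommGroup H] [InnerProductSpace ℂ H] [CompleteSpace H]
  {ε : H →L[ℂ] H} {p : ℝ} {n : ℕ} {X Y Z B : H →L[ℂ] H}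

/-- The supertrace of `cocycleElt`. -/
noncomputable def cocycleFun (ε : H →L[ℂ] H) (n : ℕ) (X Y B : H →L[ℂ] H) : ℂ :=
  str ε (coeff (2 * n + 1) (cocycleElt (kSer B) (bSer B) (C X) (C Y)))

/-- The supertrace of `coboundaryElt`. -/
noncomputable def coboundaryFun (ε : H →L[ℂ] H) (n : ℕ) (X Y B : H →L[ℂ] H) : ℂ :=
  str ε (coeff (2 * n + 1)
    (coboundaryElt (kSer B) (bSer B) (C X) (C Y) (gaugeSer ε X B) (gaugeSer ε Y B)))

theorem coeff_kSer_mul_C (X B : H →L[ℂ] H) (l : ℕ) :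
    coeff l (kSer B * C X) = if Even l then B ^ l * X else 0 := by
  rw [coeff_mul_C, kSer, coeff_mk]
  split_ifs <;> simp

theorem coeff_kSer_mul_bSer_mul_C (X B : H →L[ℂ] H) (l : ℕ) :
    coeff l (kSer B * bSer B * C X) = if Even l then 0 else B ^ l * X := by
  rw [coeff_mul_C]
  cases l with
  | zero => rw [coeff_mul_bSer_zero]; simp
  | succ l =>
    rw [coeff_mul_bSer_succ, kSer, coeff_mk]
    by_cases h : Even l
    · rw [if_pos h, if_neg (by simp [Nat.even_add_one, h]), pow_succ]
    · rw [if_neg h, if_pos (by simp [Nat.even_add_one, h])]; simp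

/-- The series `k` carries even powers of `B` and `k b` odd ones. As the total degree is odd,
exactly one of the two products contributes to each pair `(i, j)`, with sign `(-1) ^ j`. -/
theorem coeff_cocycleElt (X Y B : H →L[ℂ] H) (n : ℕ) :
    coeff (2 * n + 1) (cocycleElt (kSer B) (bSer B) (C X) (C Y)) =
      ∑ ij ∈ Finset.HasAntidiagonal.antidiagonal (2 * n + 1),
        (-1 : ℂ) ^ ij.2 • (B ^ ij.1 * X * B ^ ij.2 * Y) := by
  have h : cocycleElt (kSer B) (bSer B) (C X) (C Y) =
      (kSer B * bSer B * C X) * (kSer B * C Y) - (kSer B * C X) * (kSer B * bSer B * C Y) := by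
    rw [cocycleElt_eq (bSer_mul_kSer B)]; noncomm_ring
  rw [h, map_sub, coeff_mul, coeff_mul, ← Finset.sum_sub_distrib]
  refine Finset.sum_congr rfl fun ij hij => ?_
  have h1 := Finset.HasAntidiagonal.mem_antidiagonal.1 hij
  simp only [coeff_kSer_mul_C, coeff_kSer_mul_bSer_mul_C]
  by_cases h2 : Even ij.2
  · have h3 : ¬ Even ij.1 := fun h4 => by
      have := h4.add h2
      rw [h1] at this
      exact absurd this (by simp)
    simp [h2, h3, mul_assoc]
  · have h3 : Even ij.1 := by
      by_contra h4
      have := (Nat.not_even_iff_odd.1 h4).add_odd (Nat.not_even_iff_odd.1 h2)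
      rw [h1] at this
      exact absurd this (by simp)
    simp [h2, h3, (Nat.not_even_iff_odd.1 h2).neg_one_pow, mul_assoc]

theorem etaTilde_eq (ε X B : H →L[ℂ] H) (n : ℕ) :
    etaTilde ε n X B = str ε (coeff (2 * n + 1) (kSer B * bSer B * C X)) := by
  rw [coeff_kSer_mul_bSer_mul_C, if_neg (by simp), etaTilde]

theorem word_mem_form (hp : 1 ≤ p) (hε : ε * ε = 1) (hX : X ∈ form ε p 0) (hY : Y ∈ form ε p 0)
    (hB : B ∈ form ε p 1) {m i j k : ℕ} (h : i + j + k = m) :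
    B ^ i * X * B ^ j * Y * B ^ k ∈ form ε p m := by
  have hpow := fun i => pow_mem_form hp hε hB i
  have h1 := mul_mem_form hp hε (mul_mem_form hp hε (mul_mem_form hp hε
    (mul_mem_form hp hε (hpow i) hX) (hpow j)) hY) (hpow k)
  simpa [h] using h1

theorem word_mem_form' (hp : 1 ≤ p) (hε : ε * ε = 1) (hX : X ∈ form ε p 0) (hY : Y ∈ form ε p 0)
    (hB : B ∈ form ε p 1) {m i j : ℕ} (h : i + j = m) :
    B ^ i * X * B ^ j * Y ∈ form ε p m := by
  simpa using word_mem_form hp hε hX hY hB (k := 0) (by simpa using h)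

theorem cTildeForm_mem (hp : 1 ≤ p) (hε : ε * ε = 1) (hX : X ∈ form ε p 0) (hY : Y ∈ form ε p 0)
    (hB : B ∈ form ε p 1) : cTildeForm n X Y B ∈ form ε p (2 * n + 1) := by
  refine (formSubmodule ε hp _).sum_mem fun k hk => (formSubmodule ε hp _).smul_mem _
    ((formSubmodule ε hp _).sub_mem ?_ ?_)
  all_goals
    have := Finset.mem_range.1 hk
  · exact word_mem_form' hp hε hX hY hB (by omega)
  · exact word_mem_form' hp hε hY hX hB (by omega)

theorem brstComponent_mem (hp : 1 ≤ p) (hε : ε * ε = 1) (hX : X ∈ form ε p 0)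
    (hY : Y ∈ form ε p 0) (hB : B ∈ form ε p 1) : brstComponent n X Y B ∈ form ε p (2 * n + 1) := by
  refine (formSubmodule ε hp _).sum_mem fun a ha => (formSubmodule ε hp _).sum_mem fun b hb =>
    (formSubmodule ε hp _).smul_mem _ ((formSubmodule ε hp _).sub_mem ?_ ?_)
  all_goals
    have := Finset.HasAntidiagonal.mem_antidiagonal.1 ha
    have := Finset.HasAntidiagonal.mem_antidiagonal.1 hb
  · exact word_mem_form hp hε hX hY hB (by omega)
  · exact word_mem_form hp hε hY hX hB (by omega)

theorem pow_mul_mem (hp : 1 ≤ p) (hε : ε * ε = 1) (hX : X ∈ form ε p 0) (hB : B ∈ form ε p 1) :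
    B ^ (2 * n + 1) * X ∈ form ε p (2 * n + 1) := by
  simpa using mul_mem_form hp hε (pow_mem_form hp hε hB (2 * n + 1)) hX

/-! ### Counting and rotating words under the supertrace. -/

theorem neg_one_pow_reflect {m k : ℕ} (hm : Odd m) (hk : k ≤ m) :
    (-1 : ℂ) ^ (m - k) = -(-1) ^ k := by
  have h : (-1 : ℂ) ^ (m - k) * (-1) ^ k = -1 := by
    rw [← pow_add, Nat.sub_add_cancel hk, hm.neg_one_pow]
  rcases neg_one_pow_eq_or ℂ k with h1 | h1 <;> rw [h1] at h ⊢
  · linear_combination h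
  · linear_combination -h

/-- For a fixed middle exponent `j` there are `m + 1 - j` ways to distribute the remaining degree
between the two outer exponents. -/
theorem sum_antidiagonal_double_eq (g : ℕ → ℂ) (m : ℕ) :
    ∑ a ∈ Finset.HasAntidiagonal.antidiagonal m, ∑ b ∈ Finset.HasAntidiagonal.antidiagonal a.2, g b.1 =
      ∑ j ∈ Finset.range (m + 1), ((m : ℂ) + 1 - j) * g j := by
  have h1 : ∀ r, ∑ b ∈ Finset.HasAntidiagonal.antidiagonal r, g b.1 =
      ∑ j ∈ Finset.range (r + 1), g j := fun r =>
    Finset.Nat.sum_antidiagonal_eq_sum_range_succ (fun i _ => g i) r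
  simp only [h1]
  rw [← Finset.Nat.sum_antidiagonal_swap]
  simp only [Prod.snd_swap]
  rw [Finset.Nat.sum_antidiagonal_eq_sum_range_succ
    (fun i _ => ∑ j ∈ Finset.range (i + 1), g j) m]
  induction m with
  | zero => simp
  | succ m ih =>
    rw [Finset.sum_range_succ, ih,
      Finset.sum_range_succ _ (m + 1), Finset.sum_range_succ _ (m + 1), ← add_assoc,
      ← Finset.sum_add_distrib]
    congr 1
    · refine Finset.sum_congr rfl fun j _ => ?_
      push_cast; ring
    · push_cast; ring

variable {τ : (H →L[ℂ] H) →ₗ[ℂ] ℂ}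

theorem linear_word_rotate (hp : 1 ≤ p) (hε : ε * ε = 1) (hpn : p ≤ n + 1)
    (hτ : ∀ T ∈ form ε p (2 * n + 1), str ε T = τ T) (hX : X ∈ form ε p 0) (hY : Y ∈ form ε p 0)
    (hB : B ∈ form ε p 1) {i j : ℕ} (hij : i + j = 2 * n + 1) :
    τ (B ^ i * X * B ^ j * Y) = τ (B ^ j * Y * B ^ i * X) := by
  have h1 := mul_mem_form hp hε (pow_mem_form hp hε hB i) hX
  have h2 := mul_mem_form hp hε (pow_mem_form hp hε hB j) hY
  have h := linear_str_mul_comm hp hε hpn hτ h1 h2 (by omega)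
  simpa only [mul_assoc] using h

theorem linear_cTildeForm (hp : 1 ≤ p) (hε : ε * ε = 1) (hpn : p ≤ n + 1)
    (hτ : ∀ T ∈ form ε p (2 * n + 1), str ε T = τ T) (hX : X ∈ form ε p 0) (hY : Y ∈ form ε p 0)
    (hB : B ∈ form ε p 1) :
    τ (cTildeForm n X Y B) = ∑ k ∈ Finset.range (n + 1), (-1 : ℂ) ^ k *
      (τ (B ^ (2 * n + 1 - k) * X * B ^ k * Y) - τ (B ^ k * X * B ^ (2 * n + 1 - k) * Y)) := by
  rw [cTildeForm, map_sum]
  refine Finset.sum_congr rfl fun k hk => ?_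
  have := Finset.mem_range.1 hk
  rw [map_smul, map_sub, smul_eq_mul,
    linear_word_rotate hp hε hpn hτ hY hX hB (i := 2 * n + 1 - k) (j := k) (by omega)]

theorem sum_range_two_mul_add_two (g : ℕ → ℂ) (n : ℕ) :
    ∑ k ∈ Finset.range (2 * n + 1 + 1), g k =
      ∑ k ∈ Finset.range (n + 1), (g k + g (2 * n + 1 - k)) := by
  rw [show 2 * n + 1 + 1 = (n + 1) + (n + 1) by ring, Finset.sum_range_add, Finset.sum_add_distrib,
    ← Finset.sum_range_reflect (fun x => g (n + 1 + x))]
  congr 1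
  refine Finset.sum_congr rfl fun k hk => ?_
  have := Finset.mem_range.1 hk
  congr 1
  omega

/-- After rotation the subtracted words become those with exponents `k` and `2n + 1 - k` exchanged.
Reflection changes the sign, so the two families together fill the alternating sum over all
exponents `0` to `2n + 1`. -/
theorem str_cTildeForm (hp : 1 ≤ p) (hε : ε * ε = 1) (hpn : p ≤ n + 1) (hX : X ∈ form ε p 0)
    (hY : Y ∈ form ε p 0) (hB : B ∈ form ε p 1) :
    str ε (cTildeForm n X Y B) = cocycleFun ε n X Y B := by
  obtain ⟨τ, hτ⟩ := exists_linear_str (ε := ε) (H := H) hp hpn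
  have hmem : ∑ ij ∈ Finset.HasAntidiagonal.antidiagonal (2 * n + 1),
      (-1 : ℂ) ^ ij.2 • (B ^ ij.1 * X * B ^ ij.2 * Y) ∈ form ε p (2 * n + 1) :=
    (formSubmodule ε hp _).sum_mem fun ij hij => (formSubmodule ε hp _).smul_mem _
      (word_mem_form' hp hε hX hY hB (Finset.HasAntidiagonal.mem_antidiagonal.1 hij))
  rw [cocycleFun, coeff_cocycleElt, hτ _ hmem, hτ _ (cTildeForm_mem hp hε hX hY hB),
    linear_cTildeForm hp hε hpn hτ hX hY hB, map_sum, ← Finset.Nat.sum_antidiagonal_swap]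
  simp only [Prod.fst_swap, Prod.snd_swap, map_smul, smul_eq_mul]
  rw [Finset.Nat.sum_antidiagonal_eq_sum_range_succ
    (fun j i => (-1 : ℂ) ^ j * τ (B ^ i * X * B ^ j * Y)), Nat.succ_eq_add_one,
    sum_range_two_mul_add_two]
  refine Finset.sum_congr rfl fun k hk => ?_
  have h1 := Finset.mem_range.1 hk
  rw [neg_one_pow_reflect (by simp) (show k ≤ 2 * n + 1 by omega),
    show 2 * n + 1 - (2 * n + 1 - k) = k by omega]
  ring

/-- Rotation makes a word depend only on its middle exponent `j`, which occurs `2n + 2 - j` times.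
The reflected exponent `2n + 1 - j` occurs `j + 1` times with the same value, and the multiplicities
add up to `2n + 3`. -/
theorem str_brstComponent (hp : 1 ≤ p) (hε : ε * ε = 1) (hpn : p ≤ n + 1) (hX : X ∈ form ε p 0)
    (hY : Y ∈ form ε p 0) (hB : B ∈ form ε p 1) :
    str ε (brstComponent n X Y B) = (2 * n + 3) * str ε (cTildeForm n X Y B) := by
  obtain ⟨τ, hτ⟩ := exists_linear_str (ε := ε) (H := H) hp hpn
  rw [hτ _ (brstComponent_mem hp hε hX hY hB), hτ _ (cTildeForm_mem hp hε hX hY hB),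
    linear_cTildeForm hp hε hpn hτ hX hY hB]
  set g : ℕ → ℂ := fun k => (-1 : ℂ) ^ k *
    (τ (B ^ (2 * n + 1 - k) * X * B ^ k * Y) - τ (B ^ k * X * B ^ (2 * n + 1 - k) * Y)) with hg
  have hword : ∀ {X Y : H →L[ℂ] H}, X ∈ form ε p 0 → Y ∈ form ε p 0 → ∀ {i j k : ℕ},
      i + j + k = 2 * n + 1 → τ (B ^ i * X * B ^ j * Y * B ^ k) =
        τ (B ^ (2 * n + 1 - j) * X * B ^ j * Y) := by
    intro X Y hX hY i j k h
    have h1 := word_mem_form' hp hε hX hY hB (i := i) (j := j) rfl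
    have h2 := linear_str_mul_comm hp hε hpn hτ h1 (pow_mem_form hp hε hB k) (by omega)
    rw [h2, show 2 * n + 1 - j = k + i by omega, pow_add]
    simp only [mul_assoc]
  have h1 : τ (brstComponent n X Y B) =
      ∑ a ∈ Finset.HasAntidiagonal.antidiagonal (2 * n + 1),
        ∑ b ∈ Finset.HasAntidiagonal.antidiagonal a.2, g b.1 := by
    rw [brstComponent, map_sum]
    refine Finset.sum_congr rfl fun a ha => ?_
    rw [map_sum]
    refine Finset.sum_congr rfl fun b hb => ?_
    have h3 := Finset.HasAntidiagonal.mem_antidiagonal.1 ha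
    have h4 := Finset.HasAntidiagonal.mem_antidiagonal.1 hb
    rw [map_smul, map_sub, smul_eq_mul, hword hX hY (by omega), hword hY hX (by omega),
      linear_word_rotate hp hε hpn hτ hY hX hB (i := 2 * n + 1 - b.1) (j := b.1) (by omega)]
  have hsymm : ∀ k ≤ 2 * n + 1, g (2 * n + 1 - k) = g k := fun k hk => by
    simp only [hg]
    rw [neg_one_pow_reflect (by simp) hk, show 2 * n + 1 - (2 * n + 1 - k) = k by omega]
    ring
  rw [h1, sum_antidiagonal_double_eq, sum_range_two_mul_add_two, Finset.mul_sum]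
  refine Finset.sum_congr rfl fun k hk => ?_
  have h5 := Finset.mem_range.1 hk
  rw [hsymm k (by omega), Nat.cast_sub (by omega)]
  push_cast
  ring

theorem cTilde_eq_brst (hp : 1 ≤ p) (hε : ε * ε = 1) (hpn : p ≤ n + 1) (hX : X ∈ form ε p 0)
    (hY : Y ∈ form ε p 0) (hB : B ∈ form ε p 1) :
    cTilde ε n X Y B = 2 ^ (2 * n) / (2 * n + 3) * str ε (brstComponent n X Y B) := by
  rw [str_brstComponent hp hε hpn hX hY hB, cTilde]
  have : (2 * (n : ℂ) + 3) ≠ 0 := by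
    have : (2 * (n : ℂ) + 3) = ((2 * n + 3 : ℕ) : ℂ) := by push_cast; ring
    rw [this]; exact Nat.cast_ne_zero.2 (by omega)
  field_simp

/-! ### Derivatives along gauge curves and the cochain properties. -/

theorem eventually_mem_Icc : ∀ᶠ t : ℝ in nhds 0, t ∈ Set.Icc (-1 : ℝ) 1 :=
  Icc_mem_nhds (by norm_num) (by norm_num)

theorem hasDerivAt_cTilde (hp : 1 ≤ p) (hε : ε * ε = 1) (hpn : p ≤ n + 1) (hX : X ∈ form ε p 0)
    (hY : Y ∈ form ε p 0) (hZ : Z ∈ form ε p 0) (hB : B ∈ form ε p 1) :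
    HasDerivAt (fun t : ℝ => cTilde ε n X Y (gaugeCurve ε Z B t))
      (2 ^ (2 * n) * str ε (coeff (2 * n + 1)
        (dCocycleElt (kSer B) (bSer B) (gaugeSer ε Z B) (C X) (C Y)))) 0 := by
  have hj := jet_gaugeCurve hp hε hZ hB
  have h := ((serJet_cocycleElt hp hε hj hX hY).hasDerivAt hp hpn).const_mul ((2 : ℂ) ^ (2 * n))
  rw [bSer_gauge] at h
  -- The generating series formula for the supertrace uses cyclicity and hence needs a form of
  -- degree one, which the gauge curve is known to be for `|t| ≤ 1`.
  refine h.congr_of_eventuallyEq ?_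
  filter_upwards [eventually_mem_Icc] with t ht
  rw [cTilde, str_cTildeForm hp hε hpn hX hY (hj.mem_form hp ht), cocycleFun]

theorem hasDerivAt_coboundaryFun (hp : 1 ≤ p) (hε : ε * ε = 1) (hpn : p ≤ n + 1)
    (hX : X ∈ form ε p 0) (hY : Y ∈ form ε p 0) (hZ : Z ∈ form ε p 0) (hB : B ∈ form ε p 1) :
    HasDerivAt (fun t : ℝ => coboundaryFun ε n X Y (gaugeCurve ε Z B t))
      (str ε (coeff (2 * n + 1) (dCoboundaryElt (kSer B) (bSer B) (gaugeSer ε Z B) (C X) (C Y)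
        (gaugeSer ε X B) (gaugeSer ε Y B) (gaugeSer ε Z B * C X - C X * gaugeSer ε Z B)
        (gaugeSer ε Z B * C Y - C Y * gaugeSer ε Z B)))) 0 := by
  have h := (serJet_coboundaryElt hp hε (jet_gaugeCurve hp hε hZ hB) hX hY).hasDerivAt hp hpn
  rw [bSer_gauge] at h
  exact h

theorem hasDerivAt_etaTilde (hp : 1 ≤ p) (hε : ε * ε = 1) (hpn : p ≤ n + 1) (hX : X ∈ form ε p 0)
    (hZ : Z ∈ form ε p 0) (hB : B ∈ form ε p 1) :
    HasDerivAt (fun t : ℝ => etaTilde ε n X (gaugeCurve ε Z B t))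
      (str ε (coeff (2 * n + 1) (dKB (kSer B) (bSer B) (gaugeSer ε Z B) * C X))) 0 := by
  have h := (serJet_kSer_mul_bSer hp hε (jet_gaugeCurve hp hε hZ hB) hX).hasDerivAt hp hpn
  rw [bSer_gauge] at h
  simpa only [etaTilde_eq] using h

theorem isCochain₁_etaTilde (hp : 1 ≤ p) (hε : ε * ε = 1) (hpn : p ≤ n + 1) :
    IsCochain₁ ε p (etaTilde ε n) := by
  obtain ⟨τ, hτ⟩ := exists_linear_str (ε := ε) (H := H) hp hpn
  intro B hB
  simp only [mem_gl_iff hp hε]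
  refine ⟨fun X hX X' hX' a => ?_, fun X hX Z hZ =>
    (hasDerivAt_etaTilde hp hε hpn hX hZ hB).differentiableAt⟩
  have h := (formSubmodule ε hp 0).add_mem ((formSubmodule ε hp 0).smul_mem a hX) hX'
  rw [etaTilde, etaTilde, etaTilde, hτ _ (pow_mul_mem hp hε h hB), hτ _ (pow_mul_mem hp hε hX hB),
    hτ _ (pow_mul_mem hp hε hX' hB), mul_add, mul_smul_comm, map_add, map_smul, smul_eq_mul]

theorem cTildeForm_add_left (a : ℂ) (X X' Y B : H →L[ℂ] H) (n : ℕ) :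
    cTildeForm n (a • X + X') Y B = a • cTildeForm n X Y B + cTildeForm n X' Y B := by
  simp only [cTildeForm, Finset.smul_sum, ← Finset.sum_add_distrib]
  refine Finset.sum_congr rfl fun k _ => ?_
  simp only [mul_add, add_mul, mul_smul_comm, smul_mul_assoc]
  module

theorem cTildeForm_swap (X Y B : H →L[ℂ] H) (n : ℕ) :
    cTildeForm n X Y B = -cTildeForm n Y X B := by
  simp only [cTildeForm, ← Finset.sum_neg_distrib, ← smul_neg, neg_sub]

theorem cTildeForm_add_right (a : ℂ) (X Y Y' B : H →L[ℂ] H) (n : ℕ) :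
    cTildeForm n X (a • Y + Y') B = a • cTildeForm n X Y B + cTildeForm n X Y' B := by
  rw [cTildeForm_swap, cTildeForm_add_left, cTildeForm_swap Y, cTildeForm_swap Y']
  module

theorem isCochain₂_cTilde (hp : 1 ≤ p) (hε : ε * ε = 1) (hpn : p ≤ n + 1) :
    IsCochain₂ ε p (cTilde ε n) := by
  obtain ⟨τ, hτ⟩ := exists_linear_str (ε := ε) (H := H) hp hpn
  intro B hB
  simp only [mem_gl_iff hp hε]
  refine ⟨fun X hX X' hX' Y hY a => ?_, fun X hX Y hY Y' hY' a => ?_, fun X hX => ?_,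
    fun X hX Y hY Z hZ => (hasDerivAt_cTilde hp hε hpn hX hY hZ hB).differentiableAt⟩
  · have h := (formSubmodule ε hp 0).add_mem ((formSubmodule ε hp 0).smul_mem a hX) hX'
    rw [cTilde, cTilde, cTilde, hτ _ (cTildeForm_mem hp hε h hY hB),
      hτ _ (cTildeForm_mem hp hε hX hY hB), hτ _ (cTildeForm_mem hp hε hX' hY hB),
      cTildeForm_add_left, map_add, map_smul, smul_eq_mul]
    ring
  · have h := (formSubmodule ε hp 0).add_mem ((formSubmodule ε hp 0).smul_mem a hY) hY'
    rw [cTilde, cTilde, cTilde, hτ _ (cTildeForm_mem hp hε hX h hB),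
      hτ _ (cTildeForm_mem hp hε hX hY hB), hτ _ (cTildeForm_mem hp hε hX hY' hB),
      cTildeForm_add_right, map_add, map_smul, smul_eq_mul]
    ring
  · rw [cTilde, hτ _ (cTildeForm_mem hp hε hX hX hB)]
    simp [cTildeForm]

/-! ### The coboundary of the 1-cochain -/

/-- Replacing the derivatives in the coboundary by an explicit expression in `B` allows it to be
differentiated once more. -/
theorem coboundary₁_etaTilde (hp : 1 ≤ p) (hε : ε * ε = 1) (hpn : p ≤ n + 1)
    (hX : X ∈ form ε p 0) (hY : Y ∈ form ε p 0) (hB : B ∈ form ε p 1) :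
    coboundary₁ ε (etaTilde ε n) X Y B = coboundaryFun ε n X Y B := by
  obtain ⟨τ, hτ⟩ := exists_linear_str (ε := ε) (H := H) hp hpn
  have hXY := (formSubmodule ε hp 0).sub_mem (mul_mem_form hp hε hX hY) (mul_mem_form hp hε hY hX)
  have s1 := (serJet_kSer_mul_bSer hp hε (jet_gaugeCurve hp hε hX hB) hY (2 * n + 1)).deriv_mem
  have s2 := (serJet_kSer_mul_bSer hp hε (jet_gaugeCurve hp hε hY hB) hX (2 * n + 1)).deriv_mem
  have s3 := (serJet_kSer_mul_bSer hp hε (jet_gaugeCurve hp hε hY hB) hXY (2 * n + 1)).zero_mem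
  have s4 := (serJet_coboundaryElt hp hε (jet_gaugeCurve hp hε hX hB) hX hY (2 * n + 1)).zero_mem
  rw [bSer_gauge] at s1 s2
  rw [coboundary₁, lieDeriv, lieDeriv, (hasDerivAt_etaTilde hp hε hpn hY hX hB).deriv,
    (hasDerivAt_etaTilde hp hε hpn hX hY hB).deriv, etaTilde_eq, coboundaryFun, hτ _ s1, hτ _ s2,
    hτ _ s3, hτ _ s4, ← map_sub, ← map_sub, ← map_sub, ← map_sub, coboundaryElt]
  simp only [map_sub, map_mul]

/-- The cocycle `c̃ - 2^{2n} δη̃`. -/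
noncomputable def cReduced (ε : H →L[ℂ] H) (n : ℕ) (X Y B : H →L[ℂ] H) : ℂ :=
  cTilde ε n X Y B - 2 ^ (2 * n) * coboundaryFun ε n X Y B

theorem hasDerivAt_cReduced (hp : 1 ≤ p) (hε : ε * ε = 1) (hpn : p ≤ n + 1) (hX : X ∈ form ε p 0)
    (hY : Y ∈ form ε p 0) (hZ : Z ∈ form ε p 0) (hB : B ∈ form ε p 1) :
    HasDerivAt (fun t : ℝ => cReduced ε n X Y (gaugeCurve ε Z B t))
      (lieDeriv ε Z (cTilde ε n X Y) B - 2 ^ (2 * n) * lieDeriv ε Z (coboundaryFun ε n X Y) B) 0 := by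
  have h1 := hasDerivAt_cTilde hp hε hpn hX hY hZ hB
  have h2 := hasDerivAt_coboundaryFun hp hε hpn hX hY hZ hB
  rw [lieDeriv, lieDeriv, h1.deriv, h2.deriv]
  exact h1.sub (h2.const_mul _)

theorem coboundaryElt_smul_add {A : Type*} [Ring A] [Algebra ℂ A] (k b x x' y D D' Dy : A) (a : ℂ) :
    coboundaryElt k b (a • x + x') y (a • D + D') Dy =
      a • coboundaryElt k b x y D Dy + coboundaryElt k b x' y D' Dy := by
  unfold coboundaryElt dKB dK
  simp only [mul_add, add_mul, mul_smul_comm, smul_mul_assoc, mul_sub]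
  module

theorem coboundaryElt_swap {A : Type*} [Ring A] (k b x y Dx Dy : A) :
    coboundaryElt k b x y Dx Dy = -coboundaryElt k b y x Dy Dx := by
  unfold coboundaryElt
  noncomm_ring

theorem C_smul (a : ℂ) (X : H →L[ℂ] H) :
    (C (a • X) : PowerSeries (H →L[ℂ] H)) = a • C X := by
  ext1 l
  rw [coeff_C, coeff_smul, coeff_C]
  split_ifs <;> simp

theorem gaugeSer_smul_add (X X' B : H →L[ℂ] H) (a : ℂ) :
    gaugeSer ε (a • X + X') B = a • gaugeSer ε X B + gaugeSer ε X' B := by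
  rw [gaugeSer_eq, gaugeSer_eq, gaugeSer_eq, map_add, C_smul]
  simp only [mul_add, add_mul, mul_smul_comm, smul_mul_assoc]
  module

theorem coboundaryFun_smul_add (hp : 1 ≤ p) (hε : ε * ε = 1) (hpn : p ≤ n + 1)
    (hB : B ∈ form ε p 1) {X' : H →L[ℂ] H} (hX : X ∈ form ε p 0) (hX' : X' ∈ form ε p 0)
    (hY : Y ∈ form ε p 0) (a : ℂ) :
    coboundaryFun ε n (a • X + X') Y B =
      a * coboundaryFun ε n X Y B + coboundaryFun ε n X' Y B := by
  obtain ⟨τ, hτ⟩ := exists_linear_str (ε := ε) (H := H) hp hpn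
  have h := (formSubmodule ε hp 0).add_mem ((formSubmodule ε hp 0).smul_mem a hX) hX'
  have hj := jet_gaugeCurve hp hε hY hB
  rw [coboundaryFun, coboundaryFun, coboundaryFun,
    hτ _ (serJet_coboundaryElt hp hε hj h hY (2 * n + 1)).zero_mem,
    hτ _ (serJet_coboundaryElt hp hε hj hX hY (2 * n + 1)).zero_mem,
    hτ _ (serJet_coboundaryElt hp hε hj hX' hY (2 * n + 1)).zero_mem, gaugeSer_smul_add, map_add C,
    C_smul, coboundaryElt_smul_add, map_add, coeff_smul, map_add, map_smul, smul_eq_mul]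

theorem coboundaryFun_swap (hp : 1 ≤ p) (hε : ε * ε = 1) (hpn : p ≤ n + 1)
    (hB : B ∈ form ε p 1) (hX : X ∈ form ε p 0) (hY : Y ∈ form ε p 0) :
    coboundaryFun ε n X Y B = -coboundaryFun ε n Y X B := by
  obtain ⟨τ, hτ⟩ := exists_linear_str (ε := ε) (H := H) hp hpn
  have hj := jet_gaugeCurve hp hε hY hB
  rw [coboundaryFun, coboundaryFun,
    hτ _ (serJet_coboundaryElt hp hε hj hX hY (2 * n + 1)).zero_mem,
    hτ _ (serJet_coboundaryElt hp hε hj hY hX (2 * n + 1)).zero_mem, coboundaryElt_swap, map_neg,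
    map_neg]

theorem isCochain₂_cReduced (hp : 1 ≤ p) (hε : ε * ε = 1) (hpn : p ≤ n + 1) :
    IsCochain₂ ε p (cReduced ε n) := by
  intro B hB
  have hc := isCochain₂_cTilde hp hε hpn B hB
  simp only [mem_gl_iff hp hε] at hc ⊢
  refine ⟨fun X hX X' hX' Y hY a => ?_, fun X hX Y hY Y' hY' a => ?_, fun X hX => ?_,
    fun X hX Y hY Z hZ => (hasDerivAt_cReduced hp hε hpn hX hY hZ hB).differentiableAt⟩
  · rw [cReduced, cReduced, cReduced, hc.1 X hX X' hX' Y hY a,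
      coboundaryFun_smul_add hp hε hpn hB hX hX' hY]
    ring
  · have h := (formSubmodule ε hp 0).add_mem ((formSubmodule ε hp 0).smul_mem a hY) hY'
    rw [cReduced, cReduced, cReduced, hc.2.1 X hX Y hY Y' hY' a,
      coboundaryFun_swap hp hε hpn hB hX h, coboundaryFun_smul_add hp hε hpn hB hY hY' hX,
      coboundaryFun_swap hp hε hpn hB hX hY, coboundaryFun_swap hp hε hpn hB hX hY']
    ring
  · have h := coboundaryFun_swap hp hε hpn hB hX hX
    have h' : coboundaryFun ε n X X B = 0 := by linear_combination h / 2
    rw [cReduced, hc.2.2.1 X hX, h']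
    ring

/-! ### The cocycle conditions -/

/-- With gauge directions written as commutators with `ε + B`, this is the formal identity δδ = 0.
It holds at every form of degree one, flat or not. -/
theorem coboundary₂_coboundaryFun (hp : 1 ≤ p) (hε : ε * ε = 1) (hpn : p ≤ n + 1)
    (hX : X ∈ form ε p 0) (hY : Y ∈ form ε p 0) (hZ : Z ∈ form ε p 0) (hB : B ∈ form ε p 1) :
    coboundary₂ ε (coboundaryFun ε n) X Y Z B = 0 := by
  obtain ⟨τ, hτ⟩ := exists_linear_str (ε := ε) (H := H) hp hpn
  have hcomm : ∀ {X Y : H →L[ℂ] H}, X ∈ form ε p 0 → Y ∈ form ε p 0 →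
      X * Y - Y * X ∈ form ε p 0 := fun hX hY =>
    (formSubmodule ε hp 0).sub_mem (mul_mem_form hp hε hX hY) (mul_mem_form hp hε hY hX)
  have hL : ∀ {X Y Z : H →L[ℂ] H}, X ∈ form ε p 0 → Y ∈ form ε p 0 → Z ∈ form ε p 0 →
      lieDeriv ε Z (coboundaryFun ε n X Y) B = coeffFunctional τ n (dCoboundaryElt (kSer B) (bSer B)
        (gaugeSer ε Z B) (C X) (C Y) (gaugeSer ε X B) (gaugeSer ε Y B)
        (gaugeSer ε Z B * C X - C X * gaugeSer ε Z B)
        (gaugeSer ε Z B * C Y - C Y * gaugeSer ε Z B)) := fun {X Y Z} hX hY hZ => by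
    have h := (serJet_coboundaryElt hp hε (jet_gaugeCurve hp hε hZ hB) hX hY (2 * n + 1)).deriv_mem
    rw [bSer_gauge] at h
    rw [lieDeriv, (hasDerivAt_coboundaryFun hp hε hpn hX hY hZ hB).deriv, hτ _ h]
    rfl
  have hE : ∀ {X Y : H →L[ℂ] H}, X ∈ form ε p 0 → Y ∈ form ε p 0 →
      coboundaryFun ε n X Y B = coeffFunctional τ n (coboundaryElt (kSer B) (bSer B) (C X) (C Y)
        (gaugeSer ε X B) (gaugeSer ε Y B)) := fun {X Y} hX hY => by
    rw [coboundaryFun,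
      hτ _ (serJet_coboundaryElt hp hε (jet_gaugeCurve hp hε hX hB) hX hY (2 * n + 1)).zero_mem]
    rfl
  rw [coboundary₂, hL hY hZ hX, hL hX hZ hY, hL hX hY hZ, hE (hcomm hX hY) hZ, hE (hcomm hX hZ) hY,
    hE (hcomm hY hZ) hX, ← map_sub, ← map_add, ← map_sub, ← map_add, ← map_sub]
  have key := dCoboundaryElt_cyclic (kSer B) (bSer B) (bSer ε + bSer B) (C X) (C Y) (C Z)
  simp only [gaugeSer_eq, map_sub C, map_mul C]
  rw [key, map_zero]

/-- The abstract cyclic identities are applied in the subring `formSeries`, where the functional is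
a trace on all pairs. The commutators with `e` are computed in the ambient ring of power series. -/
theorem coboundary₂_cTilde (hp : 1 ≤ p) (hε : ε * ε = 1) (hpn : p ≤ n + 1)
    (hX : X ∈ form ε p 0) (hY : Y ∈ form ε p 0) (hZ : Z ∈ form ε p 0) (hB : B ∈ flat ε p) :
    coboundary₂ ε (cTilde ε n) X Y Z B = 0 := by
  obtain ⟨hB1, hflat⟩ := hB
  obtain ⟨τ, hτ⟩ := exists_linear_str (ε := ε) (H := H) hp hpn
  have hcomm : ∀ {X Y : H →L[ℂ] H}, X ∈ form ε p 0 → Y ∈ form ε p 0 →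
      X * Y - Y * X ∈ form ε p 0 := fun hX hY =>
    (formSubmodule ε hp 0).sub_mem (mul_mem_form hp hε hX hY) (mul_mem_form hp hε hY hX)
  let S := formSeries hp hε
  let T := formFunctional hp hε τ n
  let k : S := ⟨kSer B, kSer_mem_formSeries hB1⟩
  let b : S := ⟨bSer B, bSer_mem_formSeries hB1⟩
  let c : ∀ {X : H →L[ℂ] H}, X ∈ form ε p 0 → S := fun {X} hX => ⟨C X, C_mem_formSeries hX⟩
  let d : ∀ {X : H →L[ℂ] H}, X ∈ form ε p 0 → S := fun {X} hX =>
    ⟨bSer (dEven ε X), bSer_mem_formSeries (dEven_mem_form hp hε (by simp) hX)⟩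
  have hT : ∀ f g, T (f * g) = T (g * f) := fun f g =>
    coeffFunctional_mul_comm hpn hτ f.2 g.2
  have hL : ∀ {X Y Z : H →L[ℂ] H} (hX : X ∈ form ε p 0) (hY : Y ∈ form ε p 0)
      (hZ : Z ∈ form ε p 0), lieDeriv ε Z (cTilde ε n X Y) B =
        2 ^ (2 * n) * T (dCocycleElt k b (b * c hZ - c hZ * b + d hZ) (c hX) (c hY)) :=
    fun {X Y Z} hX hY hZ => by
      have h := (serJet_cocycleElt hp hε (jet_gaugeCurve hp hε hZ hB1) hX hY (2 * n + 1)).deriv_mem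
      rw [bSer_gauge] at h
      rw [lieDeriv, (hasDerivAt_cTilde hp hε hpn hX hY hZ hB1).deriv, hτ _ h]
      rfl
  have hE : ∀ {X Y : H →L[ℂ] H} (hX : X ∈ form ε p 0) (hY : Y ∈ form ε p 0),
      cTilde ε n X Y B = 2 ^ (2 * n) * T (cocycleElt k b (c hX) (c hY)) := fun {X Y} hX hY => by
    rw [cTilde, str_cTildeForm hp hε hpn hX hY hB1, cocycleFun,
      hτ _ (serJet_cocycleElt hp hε (jet_gaugeCurve hp hε hX hB1) hX hY (2 * n + 1)).zero_mem]
    rfl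
  have hc : ∀ {X Y : H →L[ℂ] H} (hX : X ∈ form ε p 0) (hY : Y ∈ form ε p 0),
      c (hcomm hX hY) = c hX * c hY - c hY * c hX := fun {X Y} hX hY => by
    refine Subtype.ext ?_
    change C (X * Y - Y * X) = C X * C Y - C Y * C X
    rw [map_sub, map_mul, map_mul]
  -- The Ward identity is proved outside the subring and transported back; its vanishing comes from
  -- the supertrace of an exact form, not from cyclicity.
  have hW : ∀ {X Y Z : H →L[ℂ] H} (hX : X ∈ form ε p 0) (hY : Y ∈ form ε p 0)
      (hZ : Z ∈ form ε p 0), T (dWardElt k b (c hX) (c hY) (c hZ) (d hX) (d hY) (d hZ)) = 0 :=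
    fun {X Y Z} hX hY hZ => by
      have h1 := coeffFunctional_commutator hτ (wardElt k b (c hX) (c hY) (c hZ)).2
      have h2 := commutator_wardElt (bSer_mul_kSer B) (kSer_mul_bSer_sq B)
        (bSer_eps_mul_kSer hflat) (bSer_eps_mul_bSer hflat) (bSer_eps_mul_C (ε := ε) X)
        (bSer_eps_mul_C Y) (bSer_eps_mul_C Z)
      rw [← h1]
      exact congrArg (coeffFunctional τ n) h2.symm
  have key := trace_coboundary_cocycleElt T hT (k := k) (b := b)
    (Subtype.ext (bSer_mul_kSer B)) (Subtype.ext (kSer_mul_bSer_sq B)) (hW hX hY hZ) (hW hY hX hZ)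
  rw [coboundary₂, hL hY hZ hX, hL hX hZ hY, hL hX hY hZ, hE (hcomm hX hY) hZ, hE (hcomm hX hZ) hY,
    hE (hcomm hY hZ) hX, hc hX hY, hc hX hZ, hc hY hZ]
  linear_combination 2 ^ (2 * n) * key

theorem coboundary₂_cReduced (hp : 1 ≤ p) (hε : ε * ε = 1) (hpn : p ≤ n + 1)
    (hX : X ∈ form ε p 0) (hY : Y ∈ form ε p 0) (hZ : Z ∈ form ε p 0) (hB : B ∈ flat ε p) :
    coboundary₂ ε (cReduced ε n) X Y Z B = 0 := by
  have h1 := coboundary₂_cTilde hp hε hpn hX hY hZ hB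
  have h2 := coboundary₂_coboundaryFun (n := n) hp hε hpn hX hY hZ hB.1
  have hL : ∀ {X Y Z : H →L[ℂ] H}, X ∈ form ε p 0 → Y ∈ form ε p 0 → Z ∈ form ε p 0 →
      lieDeriv ε Z (cReduced ε n X Y) B = lieDeriv ε Z (cTilde ε n X Y) B -
        2 ^ (2 * n) * lieDeriv ε Z (coboundaryFun ε n X Y) B := fun hX hY hZ =>
    (hasDerivAt_cReduced hp hε hpn hX hY hZ hB.1).deriv
  rw [coboundary₂] at h1 h2 ⊢
  rw [hL hY hZ hX, hL hX hZ hY, hL hX hY hZ]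
  unfold cReduced
  linear_combination h1 - 2 ^ (2 * n) * h2

/-! ### Flat connections and the vanishing of the reduced cocycle -/

/-- `B + ε = g⁻¹εg` squares to one, and expanding this square is the flatness equation. -/
theorem gauge_mem_flat (hp : 1 ≤ p) (hε : ε * ε = 1) (g : (H →L[ℂ] H)ˣ)
    (hg : (g : H →L[ℂ] H) ∈ gl ε p) :
    (↑g⁻¹ : H →L[ℂ] H) * dEven ε (g : H →L[ℂ] H) ∈ flat ε p := by
  set B : H →L[ℂ] H := (↑g⁻¹ : H →L[ℂ] H) * dEven ε (g : H →L[ℂ] H) with hBdef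
  have hBA : B = (↑g⁻¹ : H →L[ℂ] H) * ε * g - ε := by
    rw [hBdef, dEven, mul_sub, ← mul_assoc, ← mul_assoc, Units.inv_mul, one_mul]
  have hA : (B + ε) * (B + ε) = 1 := by
    rw [hBA, sub_add_cancel]
    calc (↑g⁻¹ : H →L[ℂ] H) * ε * g * ((↑g⁻¹ : H →L[ℂ] H) * ε * g)
        = (↑g⁻¹ : H →L[ℂ] H) * ε * (g * (↑g⁻¹ : H →L[ℂ] H)) * ε * g := by noncomm_ring
      _ = (↑g⁻¹ : H →L[ℂ] H) * (ε * ε) * g := by rw [Units.mul_inv]; noncomm_ring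
      _ = 1 := by rw [hε, mul_one, Units.inv_mul]
  have hflat : dOdd ε B + B * B = 0 := by
    have h : (B + ε) * (B + ε) = dOdd ε B + B * B + ε * ε := by unfold dOdd; noncomm_ring
    rw [hA, hε] at h
    exact (left_eq_add.1 (h.trans (add_comm _ _)))
  refine ⟨?_, hflat⟩
  rw [mem_gl] at hg
  have hB := schatten_mul_left hp hg (↑g⁻¹ : H →L[ℂ] H)
  rw [← hBdef, ← unifLevel_one_iff hp] at hB
  refine UnifForm.mem_form (T := fun _ : Unit => B) hp ⟨?_, ?_⟩ ()
  -- Flatness expresses the even part through `B²`, so it gains the required second Schatten level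
  -- from `B` having level one.
  · have h : B + ε * B * ε = (-1 : ℂ) • (ε * (B * B)) := by
      have h2 : B * B = -dOdd ε B := by rw [eq_neg_iff_add_eq_zero, add_comm]; exact hflat
      calc B + ε * B * ε = (ε * ε) * B + ε * B * ε := by rw [hε, one_mul]
        _ = (-1 : ℂ) • (ε * -dOdd ε B) := by unfold dOdd; rw [neg_one_smul]; noncomm_ring
        _ = _ := by rw [h2]
    simp only [h]
    exact UnifLevel.const_smul ((unifLevel_const_zero ε).mul hp (hB.mul hp hB)) _
  · have h : UnifLevel p 1 (fun _ : Unit => ε * B * ε) := by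
      simpa using ((unifLevel_const_zero ε).mul hp hB).mul hp (unifLevel_const_zero ε)
    have h' := UnifLevel.sub hp hB h
    simpa [oddLevel] using h'

/-- Subtracting the coboundary leaves a single term in which `X` enters only through `dX`; this
makes one-sided loops tractable. -/
theorem cReduced_eq (hp : 1 ≤ p) (hε : ε * ε = 1) (hpn : p ≤ n + 1)
    (hX : X ∈ form ε p 0) (hY : Y ∈ form ε p 0) (hB : B ∈ flat ε p) :
    cReduced ε n X Y B =
      -2 * 2 ^ (2 * n) * str ε (coeff (2 * n + 1) (kSer B * bSer (dEven ε X) * kSer B * C Y)) := by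
  obtain ⟨hB1, hflat⟩ := hB
  obtain ⟨τ, hτ⟩ := exists_linear_str (ε := ε) (H := H) hp hpn
  let S := formSeries hp hε
  let T := formFunctional hp hε τ n
  let k : S := ⟨kSer B, kSer_mem_formSeries hB1⟩
  let b : S := ⟨bSer B, bSer_mem_formSeries hB1⟩
  let x : S := ⟨C X, C_mem_formSeries hX⟩
  let y : S := ⟨C Y, C_mem_formSeries hY⟩
  let dx : S := ⟨bSer (dEven ε X), bSer_mem_formSeries (dEven_mem_form hp hε (by simp) hX)⟩
  let dy : S := ⟨bSer (dEven ε Y), bSer_mem_formSeries (dEven_mem_form hp hε (by simp) hY)⟩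
  have hT : ∀ f g, T (f * g) = T (g * f) := fun f g =>
    coeffFunctional_mul_comm hpn hτ f.2 g.2
  have h2 := commutator_wardElt₂ (bSer_mul_kSer B) (kSer_mul_bSer_sq B)
    (bSer_eps_mul_kSer hflat) (bSer_eps_mul_bSer hflat) (bSer_eps_mul_C (ε := ε) X)
    (bSer_eps_mul_C Y)
  have key := trace_cocycleElt_sub_coboundaryElt T hT (k := k) (b := b) (x := x) (y := y) (dx := dx)
    (dy := dy) (Subtype.ext (bSer_mul_kSer B)) (Subtype.ext (kSer_mul_bSer_sq B))
    ((congrArg (coeffFunctional τ n) h2.1.symm).trans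
      (coeffFunctional_commutator hτ (k * x * k * y).2))
    ((congrArg (coeffFunctional τ n) h2.2.symm).trans
      (coeffFunctional_commutator hτ (k * b * x * k * b * y).2))
  have e1 : cTilde ε n X Y B = 2 ^ (2 * n) * T (cocycleElt k b x y) := by
    rw [cTilde, str_cTildeForm hp hε hpn hX hY hB1, cocycleFun,
      hτ _ (show coeff (2 * n + 1) (cocycleElt (kSer B) (bSer B) (C X) (C Y)) ∈ form ε p (2 * n + 1)
        from (cocycleElt k b x y).2 (2 * n + 1))]
    rfl
  have e2 : coboundaryFun ε n X Y B =
      T (coboundaryElt k b x y (b * x - x * b + dx) (b * y - y * b + dy)) := by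
    rw [coboundaryFun, hτ _ (show coeff (2 * n + 1) (coboundaryElt (kSer B) (bSer B) (C X) (C Y)
        (gaugeSer ε X B) (gaugeSer ε Y B)) ∈ form ε p (2 * n + 1) from
      (coboundaryElt k b x y (b * x - x * b + dx) (b * y - y * b + dy)).2 (2 * n + 1))]
    rfl
  have e3 : str ε (coeff (2 * n + 1) (kSer B * bSer (dEven ε X) * kSer B * C Y)) =
      T (k * dx * k * y) := by
    rw [hτ _ (show coeff (2 * n + 1) (kSer B * bSer (dEven ε X) * kSer B * C Y) ∈
      form ε p (2 * n + 1) from (k * dx * k * y).2 (2 * n + 1))]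
    rfl
  rw [cReduced, e1, e2, e3]
  linear_combination 2 ^ (2 * n) * key

/-- Since `dX` anticommutes with `ε`, `ε dX = s dX` also gives `dX ε = -s dX`. Thus `dX` maps
between opposite eigenspaces of `ε`, and conjugation reverses the sign of the whole product. -/
theorem even_part_eq_zero {P Q X Y : H →L[ℂ] H} (hP : Commute ε P) (hQ : Commute ε Q)
    (hε : ε * ε = 1) {s : ℂ} (hs : s * s = 1) (hX : ε * dEven ε X = s • dEven ε X)
    (hY : ε * dEven ε Y = s • dEven ε Y) :
    P * dEven ε X * Q * Y + ε * (P * dEven ε X * Q * Y) * ε = 0 := by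
  have hanti : dEven ε X * ε = -(ε * dEven ε X) := by
    unfold dEven
    have : (ε * X - X * ε) * ε = ε * X * ε - X * (ε * ε) := by noncomm_ring
    rw [this, hε]
    have : ε * (ε * X - X * ε) = (ε * ε) * X - ε * X * ε := by noncomm_ring
    rw [this, hε]
    noncomm_ring
  have hXs : dEven ε X * ε = -(s • dEven ε X) := by rw [hanti, hX]
  have e1 : ε * (P * dEven ε X * Q * Y) * ε = s • (P * dEven ε X * Q * (Y * ε)) := by
    calc ε * (P * dEven ε X * Q * Y) * ε = (ε * P) * dEven ε X * Q * (Y * ε) := by noncomm_ring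
      _ = P * (ε * dEven ε X) * Q * (Y * ε) := by rw [hP.eq]; noncomm_ring
      _ = _ := by rw [hX, mul_smul_comm, smul_mul_assoc, smul_mul_assoc]
  have e2 : s • (P * dEven ε X * Q * (ε * Y)) = -(P * dEven ε X * Q * Y) := by
    calc s • (P * dEven ε X * Q * (ε * Y)) = s • (P * dEven ε X * (Q * ε) * Y) := by noncomm_ring
      _ = s • (P * (dEven ε X * ε) * Q * Y) := by rw [← hQ.eq]; noncomm_ring
      _ = -((s * s) • (P * dEven ε X * Q * Y)) := by
        rw [hXs, mul_neg, mul_smul_comm, neg_mul, neg_mul, smul_mul_assoc, smul_mul_assoc, smul_neg,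
          smul_smul]
      _ = _ := by rw [hs, one_smul]
  -- Insert `ε` before `dY`. Evaluated on the right it gives `s`, and moved left through `Q` into
  -- `dX` it gives `-s`. Consequently `Y` and `ε` commute behind `P * dEven ε X * Q`.
  have e3 : P * dEven ε X * Q * dEven ε Y = 0 := by
    have h : P * dEven ε X * Q * (ε * dEven ε Y) = -(P * dEven ε X * Q * (ε * dEven ε Y)) := by
      calc P * dEven ε X * Q * (ε * dEven ε Y) = P * dEven ε X * (Q * ε) * dEven ε Y := by
            noncomm_ring
        _ = P * (dEven ε X * ε) * Q * dEven ε Y := by rw [← hQ.eq]; noncomm_ring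
        _ = -(P * dEven ε X * Q * (s • dEven ε Y)) := by
          rw [hXs, mul_neg, mul_smul_comm, neg_mul, neg_mul, smul_mul_assoc, smul_mul_assoc,
            mul_smul_comm]
        _ = _ := by rw [hY]
    have h0 : P * dEven ε X * Q * (ε * dEven ε Y) = 0 := by
      rw [eq_neg_iff_add_eq_zero, ← two_smul ℂ] at h
      exact (smul_eq_zero.1 h).resolve_left two_ne_zero
    rw [hY, mul_smul_comm] at h0
    have hs0 : s ≠ 0 := fun h => by simp [h] at hs
    exact (smul_eq_zero.1 h0).resolve_left hs0
  have e5 : P * dEven ε X * Q * (Y * ε) = P * dEven ε X * Q * (ε * Y) := by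
    rw [show dEven ε Y = ε * Y - Y * ε from rfl, mul_sub, sub_eq_zero] at e3
    exact e3.symm
  rw [e1, e5, e2]
  abel

/-- The coefficients of `kSer B` are even powers of `B` or zero, so they commute with `ε` and every
summand has vanishing even part. -/
theorem cReduced_eq_zero (hp : 1 ≤ p) (hε : ε * ε = 1) (hpn : p ≤ n + 1)
    (hX : X ∈ form ε p 0) (hY : Y ∈ form ε p 0) (hB : B ∈ flat ε p) {s : ℂ} (hs : s * s = 1)
    (hXs : ε * dEven ε X = s • dEven ε X) (hYs : ε * dEven ε Y = s • dEven ε Y) :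
    cReduced ε n X Y B = 0 := by
  have hcomm : ∀ l, Commute ε (coeff l (kSer B)) := fun l => by
    rw [kSer, coeff_mk]
    split_ifs with h
    · obtain ⟨i, rfl⟩ := h
      rw [← two_mul, pow_mul]
      exact (commute_sq hB.2).pow_right i
    · exact Commute.zero_right ε
  have h : coeff (2 * n + 1) (kSer B * bSer (dEven ε X) * kSer B * C Y) =
      ∑ ij ∈ Finset.HasAntidiagonal.antidiagonal (2 * n),
        coeff ij.1 (kSer B) * dEven ε X * coeff ij.2 (kSer B) * Y := by
    have e : kSer B * bSer (dEven ε X) * kSer B * C Y =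
        (kSer B * C (dEven ε X)) * (kSer B * C Y) * PowerSeries.X := by
      unfold bSer
      calc kSer B * (C (dEven ε X) * PowerSeries.X) * kSer B * C Y
          = kSer B * C (dEven ε X) * (PowerSeries.X * (kSer B * C Y)) := by noncomm_ring
        _ = _ := by rw [X_mul]; noncomm_ring
    rw [e, coeff_succ_mul_X, coeff_mul]
    refine Finset.sum_congr rfl fun ij _ => ?_
    rw [coeff_mul_C, coeff_mul_C, mul_assoc, mul_assoc, mul_assoc]
  rw [cReduced_eq hp hε hpn hX hY hB, h, str]
  have h0 : ∑ ij ∈ Finset.HasAntidiagonal.antidiagonal (2 * n),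
        coeff ij.1 (kSer B) * dEven ε X * coeff ij.2 (kSer B) * Y +
      ε * (∑ ij ∈ Finset.HasAntidiagonal.antidiagonal (2 * n),
        coeff ij.1 (kSer B) * dEven ε X * coeff ij.2 (kSer B) * Y) * ε = 0 := by
    rw [Finset.mul_sum, Finset.sum_mul, ← Finset.sum_add_distrib]
    exact Finset.sum_eq_zero fun ij _ => even_part_eq_zero (hcomm _) (hcomm _) hε hs hXs hYs
  rw [h0]
  simp [trace]

end Cochains

/-! ### Hilbert–Schmidt operators -/

section HilbertSchmidt

variable {H : Type*} [NormedAddCommGroup H] [InnerProductSpace ℂ H] {ι : Type*}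

/-- A vector orthogonal to `K` on which `A` is nearly as large as its singular number of index
`dim K`. -/
theorem exists_orthogonal_singularNumber_le (A : H →L[ℂ] H) {N : ℕ} (K : Submodule ℂ H)
    [FiniteDimensional ℂ K] (hK : Module.finrank ℂ K ≤ N) (hs : 0 < singularNumber A N) :
    ∃ e ∈ Kᗮ, ‖e‖ = 1 ∧ singularNumber A N ≤ 2 * ‖A e‖ := by
  set P := K.starProjection
  -- Precomposing `A` with the projection onto `K` gives a competitor in the definition of the
  -- singular number, so `A` is at least that large off `K`.
  have hP : ((A * P : H →L[ℂ] H) : H →ₗ[ℂ] H).rank ≤ (N : Cardinal) := by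
    refine rank_mul_le_right A ?_
    have h : LinearMap.range (P : H →ₗ[ℂ] H) ≤ K := by
      rintro _ ⟨x, rfl⟩
      exact K.starProjection_apply_mem x
    refine (Submodule.rank_mono h).trans ?_
    rw [← Module.finrank_eq_rank]
    exact_mod_cast hK
  -- The operator norm need not be attained; giving up a factor of two yields an actual vector.
  have h1 : ∃ x, singularNumber A N / 2 * ‖x‖ < ‖(A - A * P) x‖ := by
    by_contra! h
    have := (singularNumber_le hP).trans
      (ContinuousLinearMap.opNorm_le_bound _ (half_pos hs).le h)
    linarith
  obtain ⟨x, hx⟩ := h1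
  have h2 : (A - A * P) x = A (x - P x) := by simp
  rw [h2] at hx
  set y := x - P x with hy
  have hyK : y ∈ Kᗮ := K.sub_starProjection_mem_orthogonal x
  have hyx : ‖y‖ ≤ ‖x‖ := by
    have : y = Kᗮ.starProjection x := by
      rw [Submodule.starProjection_orthogonal_val]
    rw [this]
    exact Kᗮ.norm_starProjection_apply_le x
  have hy0 : 0 < ‖y‖ := by
    rw [norm_pos_iff]
    rintro h0
    rw [h0, map_zero, norm_zero] at hx
    exact absurd hx (not_lt.2 (by positivity))
  refine ⟨((‖y‖⁻¹ : ℝ) : ℂ) • y, Kᗮ.smul_mem _ hyK, ?_, ?_⟩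
  · rw [norm_smul, Complex.norm_real, norm_inv, norm_norm, inv_mul_cancel₀ hy0.ne']
  · rw [map_smul, norm_smul, Complex.norm_real, norm_inv, norm_norm]
    have : singularNumber A N / 2 * ‖y‖ ≤ ‖A y‖ :=
      (mul_le_mul_of_nonneg_left hyx (half_pos hs).le).trans hx.le
    rw [← div_eq_inv_mul]
    have := (le_div_iff₀ hy0).2 this
    linarith

/-- Greedy choice: each new vector is taken orthogonal to the span of the earlier ones, whose
dimension is at most the index of the singular number in question. -/
theorem exists_orthonormal_singularNumber_le (A : H →L[ℂ] H) (N : ℕ)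
    (hs : ∀ k < N, 0 < singularNumber A k) :
    ∃ e : Fin N → H, Orthonormal ℂ e ∧ ∀ k : Fin N, singularNumber A k ≤ 2 * ‖A (e k)‖ := by
  induction N with
  | zero => exact ⟨Fin.elim0, ⟨fun i => i.elim0, fun i => i.elim0⟩, fun i => i.elim0⟩
  | succ N ih =>
    obtain ⟨e, he, hAe⟩ := ih fun k hk => hs k (by omega)
    have hK : Module.finrank ℂ (Submodule.span ℂ (Set.range e)) ≤ N := by
      exact (finrank_range_le_card (R := ℂ) e).trans_eq (Fintype.card_fin N)
    have := FiniteDimensional.span_of_finite ℂ (Set.finite_range e)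
    obtain ⟨f, hf, hf1, hAf⟩ := exists_orthogonal_singularNumber_le A _ hK (hs N (by omega))
    have hef : ∀ i, inner ℂ (e i) f = 0 := fun i =>
      (Submodule.mem_orthogonal _ _).1 hf _ (Submodule.subset_span ⟨i, rfl⟩)
    refine ⟨Fin.snoc e f, ?_, fun k => ?_⟩
    · rw [orthonormal_iff_ite] at he ⊢
      intro i j
      refine Fin.lastCases ?_ (fun i => ?_) i <;> refine Fin.lastCases ?_ (fun j => ?_) j
      · simp [inner_self_eq_norm_sq_to_K, hf1]
      · have : Fin.last N ≠ j.castSucc := (Fin.castSucc_lt_last j).ne'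
        simp [inner_eq_zero_symm.1 (hef j), this]
      · have : i.castSucc ≠ Fin.last N := (Fin.castSucc_lt_last i).ne
        simp [hef i, this]
      · simp [he i j]
    · refine Fin.lastCases ?_ (fun k => ?_) k
      · simpa using hAf
      · simpa using hAe k

theorem hasSum_norm_inner_sq (b : HilbertBasis ι ℂ H) (x : H) :
    HasSum (fun i => ‖inner ℂ (b i) x‖ ^ 2) (‖x‖ ^ 2) := by
  have h := b.hasSum_inner_mul_inner x x
  rw [inner_self_eq_norm_sq_to_K] at h
  have h1 : ∀ i, inner ℂ x (b i) * inner ℂ (b i) x = ((‖inner ℂ (b i) x‖ ^ 2 : ℝ) : ℂ) := fun i => by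
    rw [← inner_conj_symm x (b i), RCLike.conj_mul]
    norm_cast
  simp only [h1] at h
  refine (RCLike.hasSum_ofReal (𝕜 := ℂ)).1 ?_
  convert h using 1
  · push_cast
    rfl
  · exact RCLike.ofReal_pow (K := ℂ) ‖x‖ 2

theorem hilbertBasis_ext_inner (b : HilbertBasis ι ℂ H) {x y : H}
    (h : ∀ i, inner ℂ (b i) x = inner ℂ (b i) y) : x = y := by
  have h1 := hasSum_norm_inner_sq b (x - y)
  simp only [inner_sub_right, h, sub_self, norm_zero, ne_eq, OfNat.ofNat_ne_zero, not_false_eq_true,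
    zero_pow] at h1
  have h2 := h1.unique hasSum_zero
  exact sub_eq_zero.1 (norm_eq_zero.1 (pow_eq_zero_iff two_ne_zero |>.1 h2))

theorem ext_matrix (b : HilbertBasis ι ℂ H) {A B : H →L[ℂ] H}
    (h : ∀ i j, inner ℂ (b i) (A (b j)) = inner ℂ (b i) (B (b j))) : A = B := by
  refine ContinuousLinearMap.ext_on (s := Set.range b) ?_ ?_
  · rw [dense_iff_closure_eq, ← Submodule.topologicalClosure_coe, b.dense_span, Submodule.top_coe]
  · rintro _ ⟨j, rfl⟩
    exact hilbertBasis_ext_inner b fun i => h i j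

variable [CompleteSpace H]

/-- Operators with square summable matrix coefficients are in `L_2`. -/
theorem mem_schatten_two (b : HilbertBasis ι ℂ H) {A : H →L[ℂ] H}
    (h : Summable fun ij : ι × ι => ‖inner ℂ (b ij.1) (A (b ij.2))‖ ^ 2) : A ∈ schatten H 2 := by
  have hadj : ∀ i, HasSum (fun j => ‖inner ℂ (b i) (A (b j))‖ ^ 2) (‖A.adjoint (b i)‖ ^ 2) :=
    fun i => by
      have h1 := hasSum_norm_inner_sq b (A.adjoint (b i))
      refine h1.congr_fun fun j => ?_
      rw [ContinuousLinearMap.adjoint_inner_right, norm_inner_symm]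
  have hsum : Summable fun i => ‖A.adjoint (b i)‖ ^ 2 := by
    have := h.prod
    simpa only [(hadj _).tsum_eq] using this
  -- Expand each `A (e k)` in the basis `b` by Parseval, exchange the sums, and apply Bessel's
  -- inequality for `e` to `A.adjoint (b i)`.
  have hortho : ∀ {N : ℕ} (e : Fin N → H), Orthonormal ℂ e →
      ∑ k, ‖A (e k)‖ ^ 2 ≤ ∑' i, ‖A.adjoint (b i)‖ ^ 2 := fun {N} e he => by
    have h1 : HasSum (fun i => ∑ k, ‖inner ℂ (b i) (A (e k))‖ ^ 2) (∑ k, ‖A (e k)‖ ^ 2) :=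
      hasSum_sum fun k _ => hasSum_norm_inner_sq b (A (e k))
    refine hasSum_le (fun i => ?_) h1 hsum.hasSum
    have h2 := he.sum_inner_products_le (s := Finset.univ) (A.adjoint (b i))
    refine le_trans (le_of_eq (Finset.sum_congr rfl fun k _ => ?_)) h2
    rw [ContinuousLinearMap.adjoint_inner_right, norm_inner_symm]
  have hbound : ∀ N : ℕ, ∑ k ∈ Finset.range N, singularNumber A k ^ 2 ≤
      4 * ∑' i, ‖A.adjoint (b i)‖ ^ 2 := fun N => by
    induction N with
    | zero => simpa using tsum_nonneg fun i => sq_nonneg ‖A.adjoint (b i)‖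
    | succ N ih =>
      -- A zero singular number adds nothing to the sum; otherwise all earlier ones are positive by
      -- monotonicity and the greedy vectors exist. The factor `4` is the square of the lost factor
      -- `2`.
      rcases (singularNumber_nonneg A N).eq_or_lt with h0 | h0
      · rw [Finset.sum_range_succ, ← h0]
        simpa using ih
      · obtain ⟨e, he, hAe⟩ := exists_orthonormal_singularNumber_le A (N + 1) fun k hk =>
          h0.trans_le (singularNumber_antitone A (by omega))
        rw [← Fin.sum_univ_eq_sum_range (fun k => singularNumber A k ^ 2)]
        refine le_trans ?_ (mul_le_mul_of_nonneg_left (hortho e he) (by norm_num))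
        rw [Finset.mul_sum]
        refine Finset.sum_le_sum fun k _ => ?_
        have := pow_le_pow_left₀ (singularNumber_nonneg A k) (hAe k) 2
        linarith [mul_pow 2 ‖A (e k)‖ 2]
  have := summable_of_sum_range_le (fun k => sq_nonneg (singularNumber A k)) hbound
  simpa [schatten] using this

end HilbertSchmidt

/-! ### Fourier modes -/

section Fourier

variable {V : Type*} [NormedAddCommGroup V] [InnerProductSpace ℂ V]

theorem coeFn_mode (k : ℤ) (v : V) :
    (mode k v : Circ → V) =ᵐ[haar] fun x => fourier k x • v :=
  ContinuousMap.coeFn_toLp (E := V) haar (p := 2) (𝕜 := ℂ) _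

theorem inner_fourier_smul (k : ℤ) (x : Circ) (v w : V) :
    inner ℂ (fourier k x • v) w = fourier (-k) x * inner ℂ v w := by
  rw [inner_smul_left, fourier_neg]

theorem integral_fourier (k : ℤ) : ∫ x : Circ, fourier k x ∂haar = if k = 0 then 1 else 0 := by
  have h := (orthonormal_iff_ite.1 (orthonormal_fourier (T := 2 * Real.pi))) 0 k
  rw [ContinuousMap.inner_toLp (@haarAddCircle (2 * Real.pi) _) (fourier 0) (fourier k)] at h
  simpa [eq_comm] using h

theorem inner_mode_mode (l k : ℤ) (v w : V) :
    inner ℂ (mode l v) (mode k w) = if k = l then inner ℂ v w else 0 := by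
  have h : ∀ᵐ x ∂haar, inner ℂ ((mode l v : Circ → V) x) ((mode k w : Circ → V) x) =
      fourier (k - l) x * inner ℂ v w := by
    filter_upwards [coeFn_mode l v, coeFn_mode k w] with x h1 h2
    rw [h1, h2, inner_fourier_smul, inner_smul_right, sub_eq_neg_add, fourier_add, mul_assoc]
  rw [L2.inner_def, integral_congr_ae h, integral_mul_const, integral_fourier]
  simp [sub_eq_zero]

theorem inner_mode_left (k : ℤ) (v : V) (ψ : Hilb V) :
    inner ℂ (mode k v) ψ = fourierCoeff (fun x => inner ℂ v (ψ x)) k := by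
  rw [L2.inner_def, fourierCoeff]
  refine integral_congr_ae ?_
  filter_upwards [coeFn_mode k v] with x h
  rw [h, inner_fourier_smul, smul_eq_mul]

/-- Each coordinate of `ψ` in an orthonormal basis of `V` is a scalar function with vanishing
Fourier coefficients, so completeness of the scalar Fourier basis applies. -/
theorem eq_zero_of_inner_mode [FiniteDimensional ℂ V] {ψ : Hilb V}
    (h : ∀ k j, inner ℂ (mode k (stdOrthonormalBasis ℂ V j)) ψ = 0) : ψ = 0 := by
  have hj : ∀ j, ∀ᵐ x ∂haar, inner ℂ (stdOrthonormalBasis ℂ V j) (ψ x) = 0 := fun j => by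
    set f : Lp ℂ 2 haar := (innerSL ℂ (stdOrthonormalBasis ℂ V j)).compLp ψ with hf
    have hfae := (innerSL ℂ (stdOrthonormalBasis ℂ V j)).coeFn_compLp ψ
    have hf0 : f = 0 := by
      refine fourierBasis.repr.injective ?_
      rw [map_zero]
      ext k
      rw [fourierBasis_repr, lp.coeFn_zero, Pi.zero_apply, ← h k j, inner_mode_left, fourierCoeff,
        fourierCoeff]
      refine integral_congr_ae ?_
      filter_upwards [hfae] with x hx
      rw [hx, innerSL_apply_apply]
    rw [← hf, hf0] at hfae
    filter_upwards [hfae, Lp.coeFn_zero ℂ 2 haar] with x h1 h2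
    rw [← innerSL_apply_apply ℂ, ← h1, h2, Pi.zero_apply]
  refine Lp.ext ?_
  filter_upwards [ae_all_iff.2 hj, Lp.coeFn_zero V 2 haar] with x h1 h2
  rw [h2, Pi.zero_apply]
  refine (stdOrthonormalBasis ℂ V).repr.injective ?_
  ext j
  rw [OrthonormalBasis.repr_apply_apply, h1 j, map_zero, PiLp.zero_apply]

variable [CompleteSpace V]

/-- The Fourier modes with coefficients in an orthonormal basis of `V` form a Hilbert basis. -/
noncomputable def modeBasis (V : Type*) [NormedAddCommGroup V] [InnerProductSpace ℂ V]
    [CompleteSpace V] [FiniteDimensional ℂ V] :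
    HilbertBasis (ℤ × Fin (Module.finrank ℂ V)) ℂ (Hilb V) :=
  HilbertBasis.mkOfOrthogonalEqBot (v := fun i => mode i.1 (stdOrthonormalBasis ℂ V i.2))
    (by
      rw [orthonormal_iff_ite]
      rintro ⟨k, i⟩ ⟨l, j⟩
      rw [inner_mode_mode, orthonormal_iff_ite.1 (stdOrthonormalBasis ℂ V).orthonormal i j,
        ← ite_and]
      simp [Prod.ext_iff, eq_comm])
    (by
      rw [Submodule.eq_bot_iff]
      intro ψ hψ
      exact eq_zero_of_inner_mode fun k j =>
        (Submodule.mem_orthogonal _ _).1 hψ _ (Submodule.subset_span ⟨(k, j), rfl⟩))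

theorem modeBasis_apply [FiniteDimensional ℂ V] (i : ℤ × Fin (Module.finrank ℂ V)) :
    modeBasis V i = mode i.1 (stdOrthonormalBasis ℂ V i.2) := by
  rw [modeBasis, HilbertBasis.coe_mkOfOrthogonalEqBot]

/-! ### The sign operator and multiplication operators -/

theorem signOp_mul_signOp : signOp V * signOp V = 1 := by
  have h : (hPlus V).starProjection * (hPlus V).starProjection = (hPlus V).starProjection :=
    (hPlus V).isIdempotentElem_starProjection
  unfold signOp
  generalize (hPlus V).starProjection = P at h
  rw [sub_mul, mul_sub, smul_mul_smul_comm, h]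
  simp only [mul_one, one_mul]
  module

/-- The eigenvalue of the sign operator on the Fourier modes of index `k`. -/
noncomputable def modeSign (k : ℤ) : ℂ := if 0 ≤ k then 1 else -1

theorem modeSign_of_nonneg {k : ℤ} (h : 0 ≤ k) : modeSign k = 1 := if_pos h

theorem modeSign_of_neg {k : ℤ} (h : k < 0) : modeSign k = -1 := if_neg (not_le.2 h)

theorem signOp_mode (k : ℤ) (v : V) : signOp V (mode k v) = modeSign k • mode k v := by
  rcases le_or_gt 0 k with h | h
  · have hm : mode k v ∈ hPlus V :=
      Submodule.le_topologicalClosure _ (Submodule.subset_span ⟨k, h, v, rfl⟩)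
    rw [modeSign_of_nonneg h, signOp, sub_apply, smul_apply,
      Submodule.starProjection_eq_self_iff.2 hm, one_apply_eq_self]
    module
  · have hm : mode k v ∈ (hPlus V)ᗮ := by
      rw [hPlus, Submodule.orthogonal_closure, Submodule.mem_orthogonal]
      intro u hu
      induction hu using Submodule.span_induction with
      | mem u hu =>
        obtain ⟨l, hl, w, rfl⟩ := hu
        rw [inner_mode_mode, if_neg (by omega)]
      | zero => exact inner_zero_left _
      | add x y _ _ hx hy => rw [inner_add_left, hx, hy, add_zero]
      | smul a x _ hx => rw [inner_smul_left, hx, mul_zero]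
    rw [modeSign_of_neg h, signOp, sub_apply, smul_apply,
      (hPlus V).starProjection_apply_eq_zero_iff.2 hm, one_apply_eq_self]
    module

theorem inner_signOp_left (φ ψ : Hilb V) : inner ℂ (signOp V φ) ψ = inner ℂ φ (signOp V ψ) := by
  unfold signOp
  simp only [sub_apply, smul_apply,
    one_apply_eq_self, inner_sub_left, inner_sub_right, inner_smul_left,
    inner_smul_right, (hPlus V).inner_starProjection_left_eq_right, map_ofNat]

theorem inner_mode_signOp (k : ℤ) (v : V) (ψ : Hilb V) :
    inner ℂ (mode k v) (signOp V ψ) = modeSign k * inner ℂ (mode k v) ψ := by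
  rw [← inner_signOp_left, signOp_mode, inner_smul_left]
  congr 1
  unfold modeSign
  split_ifs <;> simp

theorem coeFn_mulOp (X : LInfty V) (ψ : Hilb V) :
    (mulOp X ψ : Circ → V) =ᵐ[haar] fun x => X x (ψ x) :=
  (ContinuousLinearMap.id ℂ (V →L[ℂ] V)).coeFn_holder X ψ

theorem inner_mode_mulOp (X : LInfty V) (l k : ℤ) (v w : V) :
    inner ℂ (mode l v) (mulOp X (mode k w)) =
      inner ℂ v (fourierCoeff (X : Circ → V →L[ℂ] V) (l - k) w) := by
  have hX : Integrable (X : Circ → V →L[ℂ] V) haar := (Lp.memLp X).integrable le_top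
  have h : ∀ᵐ x ∂haar, inner ℂ ((mode l v : Circ → V) x) ((mulOp X (mode k w) : Circ → V) x) =
      inner ℂ v ((fourier (-(l - k)) x • X x) w) := by
    filter_upwards [coeFn_mode l v, coeFn_mode k w, coeFn_mulOp X (mode k w)] with x h1 h2 h3
    rw [h1, h3, h2, inner_fourier_smul, map_smul, inner_smul_right,
      smul_apply, inner_smul_right, neg_sub, sub_eq_neg_add, fourier_add,
      mul_assoc]
  have hX' := hX.fourier_smul (-(l - k))
  rw [L2.inner_def, integral_congr_ae h, integral_inner (hX'.apply_continuousLinearMap w),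
    ← ContinuousLinearMap.integral_apply hX', fourierCoeff]

theorem inner_mode_dEven_mulOp (X : LInfty V) (l k : ℤ) (v w : V) :
    inner ℂ (mode l v) (dEven (signOp V) (mulOp X) (mode k w)) =
      (modeSign l - modeSign k) * inner ℂ v (fourierCoeff (X : Circ → V →L[ℂ] V) (l - k) w) := by
  rw [dEven, sub_apply, mul_apply_eq_comp,
    mul_apply_eq_comp, inner_sub_right, inner_mode_signOp, signOp_mode, map_smul,
    inner_smul_right, inner_mode_mulOp, sub_mul]

/-- The entries of the commutator vanish between modes of equal sign, and the hypothesis removes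
those whose target mode does not have sign `s`. The range therefore lies in one eigenspace of `ε`.
-/
theorem signOp_mul_dEven [FiniteDimensional ℂ V] {X : LInfty V} {s : ℂ}
    (h : ∀ l k : ℤ, modeSign l ≠ modeSign k → modeSign l ≠ s →
      fourierCoeff (X : Circ → V →L[ℂ] V) (l - k) = 0) :
    signOp V * dEven (signOp V) (mulOp X) = s • dEven (signOp V) (mulOp X) := by
  refine ext_matrix (modeBasis V) fun i j => ?_
  rw [modeBasis_apply, modeBasis_apply, mul_apply_eq_comp, inner_mode_signOp,
    smul_apply, inner_smul_right, inner_mode_dEven_mulOp]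
  by_cases h1 : modeSign i.1 = modeSign j.1
  · simp [h1]
  by_cases h2 : modeSign i.1 = s
  · rw [h2]
  · simp [h _ _ h1 h2]

theorem signOp_mul_dEven_of_positive [FiniteDimensional ℂ V] {X : LInfty V}
    (h : X ∈ positiveLoops V) :
    signOp V * dEven (signOp V) (mulOp X) = (1 : ℂ) • dEven (signOp V) (mulOp X) := by
  refine signOp_mul_dEven fun l k h1 h2 => h _ ?_
  have hl : l < 0 := not_le.1 fun hl => h2 (modeSign_of_nonneg hl)
  have hk : 0 ≤ k := not_lt.1 fun hk => h1 (by rw [modeSign_of_neg hl, modeSign_of_neg hk])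
  omega

theorem signOp_mul_dEven_of_negative [FiniteDimensional ℂ V] {X : LInfty V}
    (h : X ∈ negativeLoops V) :
    signOp V * dEven (signOp V) (mulOp X) = (-1 : ℂ) • dEven (signOp V) (mulOp X) := by
  refine signOp_mul_dEven fun l k h1 h2 => h _ ?_
  have hl : 0 ≤ l := not_lt.1 fun hl => h2 (modeSign_of_neg hl)
  have hk : k < 0 := not_le.1 fun hk => h1 (by rw [modeSign_of_nonneg hl, modeSign_of_nonneg hk])
  omega

/-! ### Fractional loops -/

/-- Translation by `m` changes the sign of at most `|m|` integers, and each change contributes `2² =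
4`. -/
theorem tsum_modeSign_sub_le (m : ℤ) :
    Summable (fun k : ℤ => ‖modeSign (m + k) - modeSign k‖ ^ 2) ∧
      ∑' k : ℤ, ‖modeSign (m + k) - modeSign k‖ ^ 2 ≤ 4 * |(m : ℝ)| := by
  -- One of the two intervals is empty, according to the sign of `m`.
  set s : Finset ℤ := Finset.Ico (-m) 0 ∪ Finset.Ico 0 (-m) with hs
  have h0 : ∀ k ∉ s, ‖modeSign (m + k) - modeSign k‖ ^ 2 = 0 := fun k hk => by
    simp only [hs, Finset.mem_union, Finset.mem_Ico, not_or, not_and, not_lt] at hk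
    rcases le_or_gt 0 k with h | h
    · rw [modeSign_of_nonneg h, modeSign_of_nonneg (by have := hk.2 h; omega)]; simp
    · rw [modeSign_of_neg h, modeSign_of_neg (by by_contra h'; have := hk.1 (by omega); omega)]
      simp
  have h4 : ∀ k, ‖modeSign (m + k) - modeSign k‖ ^ 2 ≤ 4 := fun k => by
    have h1 : ∀ k, ‖modeSign k‖ = 1 := fun k => by unfold modeSign; split_ifs <;> simp
    have h2 := norm_sub_le (modeSign (m + k)) (modeSign k)
    rw [h1, h1] at h2
    nlinarith [norm_nonneg (modeSign (m + k) - modeSign k)]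
  refine ⟨summable_of_ne_finset_zero h0, ?_⟩
  rw [tsum_eq_sum h0]
  refine (Finset.sum_le_card_nsmul s _ 4 fun k _ => h4 k).trans ?_
  have hcard : (s.card : ℝ) ≤ |(m : ℝ)| := by
    have h1 : s.card ≤ m.natAbs := by
      refine (Finset.card_union_le _ _).trans ?_
      rw [Int.card_Ico, Int.card_Ico]
      omega
    calc (s.card : ℝ) ≤ (m.natAbs : ℝ) := by exact_mod_cast h1
      _ = |(m : ℝ)| := by rw [Nat.cast_natAbs, Int.cast_abs]
  rw [nsmul_eq_mul]
  linarith

theorem abs_le_one_add_sq_rpow {q : ℝ} (hq : 1 / 2 ≤ q) (x : ℝ) : |x| ≤ (1 + x ^ 2) ^ q := by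
  calc |x| = √(x ^ 2) := (Real.sqrt_sq_eq_abs x).symm
    _ ≤ √(1 + x ^ 2) := Real.sqrt_le_sqrt (by linarith)
    _ = (1 + x ^ 2) ^ (1 / 2 : ℝ) := Real.sqrt_eq_rpow _
    _ ≤ _ := Real.rpow_le_rpow_of_exponent_le (by nlinarith) hq

/-- In the variables `m = l - k` and `k`, the inner sum is at most `4|m|`, which the Sobolev weight
controls because `q ≥ 1/2`. -/
theorem summable_modeSign_sub {a : ℤ → ℝ} (ha : ∀ m, 0 ≤ a m) {q : ℝ} (hq : 1 / 2 ≤ q)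
    (h : Summable fun m : ℤ => (1 + (m : ℝ) ^ 2) ^ q * a m) :
    Summable fun lk : ℤ × ℤ => ‖modeSign lk.1 - modeSign lk.2‖ ^ 2 * a (lk.1 - lk.2) := by
  have h0 : 0 ≤ fun mk : ℤ × ℤ => ‖modeSign (mk.1 + mk.2) - modeSign mk.2‖ ^ 2 * a mk.1 :=
    fun mk => mul_nonneg (sq_nonneg _) (ha _)
  have hmk : Summable fun mk : ℤ × ℤ =>
      ‖modeSign (mk.1 + mk.2) - modeSign mk.2‖ ^ 2 * a mk.1 := by
    refine (summable_prod_of_nonneg h0).2 ⟨fun m => (tsum_modeSign_sub_le m).1.mul_right (a m), ?_⟩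
    simp only [tsum_mul_right]
    refine Summable.of_nonneg_of_le
      (fun m => mul_nonneg (tsum_nonneg fun k => sq_nonneg _) (ha m)) (fun m => ?_) (h.mul_left 4)
    rw [← mul_assoc]
    refine mul_le_mul_of_nonneg_right ((tsum_modeSign_sub_le m).2.trans ?_) (ha m)
    exact mul_le_mul_of_nonneg_left (abs_le_one_add_sq_rpow hq _) (by norm_num)
  have e : Function.Injective fun lk : ℤ × ℤ => (lk.1 - lk.2, lk.2) := by
    rintro ⟨l, k⟩ ⟨l', k'⟩ h
    simp only [Prod.mk.injEq] at h ⊢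
    omega
  simpa [Function.comp_def] using hmk.comp_injective e

theorem dEven_mulOp_mem_schatten_two [FiniteDimensional ℂ V] {X : LInfty V} {q : ℝ}
    (hq : 1 / 2 ≤ q) (hX : Summable fun k : ℤ =>
      (1 + (k : ℝ) ^ 2) ^ q * ‖fourierCoeff (X : Circ → V →L[ℂ] V) k‖ ^ 2) :
    dEven (signOp V) (mulOp X) ∈ schatten (Hilb V) 2 := by
  have hlk := summable_modeSign_sub (fun m => sq_nonneg _) hq hX
  have hall := hlk.mul_of_nonneg (hasSum_fintype fun _ : Fin (Module.finrank ℂ V) ×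
    Fin (Module.finrank ℂ V) => (1 : ℝ)).summable (fun lk => by positivity) fun _ => zero_le_one
  refine mem_schatten_two (modeBasis V) ?_
  refine Summable.of_nonneg_of_le (fun _ => by positivity) (fun ij => ?_)
    ((Equiv.prodProdProdComm _ _ _ _).summable_iff.2 hall)
  rw [modeBasis_apply, modeBasis_apply, inner_mode_dEven_mulOp, norm_mul, mul_pow]
  simp only [Function.comp_apply, Equiv.prodProdProdComm_apply, mul_one]
  refine mul_le_mul_of_nonneg_left ?_ (by positivity)
  refine pow_le_pow_left₀ (norm_nonneg _) ((norm_inner_le_norm _ _).trans ?_) 2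
  rw [OrthonormalBasis.norm_eq_one, one_mul]
  refine (ContinuousLinearMap.le_opNorm _ _).trans ?_
  rw [OrthonormalBasis.norm_eq_one, mul_one]

/-- Sobolev loops have Hilbert–Schmidt commutator, so already `p ≥ 1` suffices for them; for
continuous loops `1 / (2 * q) ≤ p` gives the inclusion of Schatten classes. -/
theorem mulOp_mem_gl [FiniteDimensional ℂ V] {𝔤 : LieSubalgebra ℂ (V →L[ℂ] V)} {p q : ℝ}
    {L : Set (LInfty V)} (hp : 1 ≤ p) (hL : IsFractionalLoopAlgebra 𝔤 q L) (hpq : 1 / (2 * q) ≤ p)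
    {X : LInfty V} (hX : X ∈ L) : mulOp X ∈ gl (signOp V) p := by
  rcases hL with ⟨hq, rfl⟩ | ⟨hq, -, rfl⟩
  · rw [mem_gl]
    have h : (2 : ℝ) ≤ 2 * p := by linarith
    exact schatten_mono two_pos h (dEven_mulOp_mem_schatten_two hq hX.2)
  · have h := hX.2
    rw [mem_gl] at h ⊢
    exact schatten_mono (by positivity) (by linarith) h

end Fourier

theorem even_part_mem_schatten_one {H : Type*} [NormedAddCommGroup H] [InnerProductSpace ℂ H]
    {ε T : H →L[ℂ] H} {p : ℝ} {n : ℕ} (hp : 1 ≤ p) (hpn : p ≤ n + 1)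
    (hT : T ∈ form ε p (2 * n + 1)) : T + ε * T * ε ∈ schatten H 1 := by
  have h := ((unifForm_of_mem_form (ι := Unit) hp hT).even).mem_schatten hp
    (by unfold evenLevel; omega) ()
  have hl : (evenLevel (2 * n + 1) : ℝ) = 2 * (n + 1) := by
    have : evenLevel (2 * n + 1) = 2 * (n + 1) := by unfold evenLevel; omega
    rw [this]; push_cast; ring
  refine schatten_mono ?_ ?_ h
  · rw [hl]; positivity
  · rw [hl, div_le_one (by positivity)]
    linarith

end FractionalLoop

theorem theorem4p1 {V : Type*} [NormedAddCommGroup V] [InnerProductSpace ℂ V]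
    [FiniteDimensional ℂ V] [CompleteSpace V] (p : ℝ) (n : ℕ) (hp : 1 ≤ p) (hpn : p ≤ n + 1) :
    -- the forms under the supertrace, and the two expressions for the given cochain
    (∀ X ∈ gl (signOp V) p, ∀ Y ∈ gl (signOp V) p, ∀ B ∈ form (signOp V) p 1,
      B ^ (2 * n + 1) * X ∈ form (signOp V) p (2 * n + 1) ∧
      cTildeForm n X Y B ∈ form (signOp V) p (2 * n + 1) ∧
      brstComponent n X Y B ∈ form (signOp V) p (2 * n + 1) ∧
      cTilde (signOp V) n X Y B =
        2 ^ (2 * n) / (2 * n + 3) * str (signOp V) (brstComponent n X Y B)) ∧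
    -- the supertrace of a form of degree `2n + 1` is the trace of a trace class operator
    (∀ T ∈ form (signOp V) p (2 * n + 1),
      T + signOp V * T * signOp V ∈ schatten (Hilb V) 1) ∧
    -- `B = g⁻¹dg` is a flat connection for every `g ∈ GL_p`
    (∀ g : (Hilb V →L[ℂ] Hilb V)ˣ, (g : Hilb V →L[ℂ] Hilb V) ∈ gl (signOp V) p →
      (↑g⁻¹ : Hilb V →L[ℂ] Hilb V) * dEven (signOp V) (g : Hilb V →L[ℂ] Hilb V) ∈
        flat (signOp V) p) ∧
    IsCochain₁ (signOp V) p (etaTilde (signOp V) n) ∧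
    IsCochain₂ (signOp V) p (cTilde (signOp V) n) ∧
    IsCocycle₂ (signOp V) p (cTilde (signOp V) n) ∧
    ∃ c : (Hilb V →L[ℂ] Hilb V) → (Hilb V →L[ℂ] Hilb V) → (Hilb V →L[ℂ] Hilb V) → ℂ,
      IsCochain₂ (signOp V) p c ∧
      IsCocycle₂ (signOp V) p c ∧
      (∀ X ∈ gl (signOp V) p, ∀ Y ∈ gl (signOp V) p, ∀ B ∈ form (signOp V) p 1,
        c X Y B = cTilde (signOp V) n X Y B -
          2 ^ (2 * n) * coboundary₁ (signOp V) (etaTilde (signOp V) n) X Y B) ∧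
      ∀ (𝔤 : LieSubalgebra ℂ (V →L[ℂ] V)) (q : ℝ) (L : Set (LInfty V)),
        IsFractionalLoopAlgebra 𝔤 q L → 1 / (2 * q) ≤ p →
          (∀ X ∈ L, mulOp X ∈ gl (signOp V) p) ∧
          ∀ X ∈ L, ∀ Y ∈ L, ∀ B ∈ flat (signOp V) p,
            (X ∈ negativeLoops V ∧ Y ∈ negativeLoops V) ∨
              (X ∈ positiveLoops V ∧ Y ∈ positiveLoops V) →
            c (mulOp X) (mulOp Y) B = 0 := by
  have hε := signOp_mul_signOp (V := V)
  have hgl : ∀ {X}, X ∈ gl (signOp V) p ↔ X ∈ form (signOp V) p 0 := mem_gl_iff hp hε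
  -- The reduced cocycle is supplied as `cReduced`, which uses the explicit expression for the
  -- coboundary of η̃_n; the two agree on all forms of degree one.
  refine ⟨fun X hX Y hY B hB => ?_, fun T hT => even_part_mem_schatten_one hp hpn hT,
    gauge_mem_flat hp hε, isCochain₁_etaTilde hp hε hpn, isCochain₂_cTilde hp hε hpn,
    fun X hX Y hY Z hZ B hB => ?_, cReduced (signOp V) n, isCochain₂_cReduced hp hε hpn,
    fun X hX Y hY Z hZ B hB => ?_, fun X hX Y hY B hB => ?_, fun 𝔤 q L hL hpq => ⟨fun X hX => ?_,
    fun X hX Y hY B hB h => ?_⟩⟩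
  · rw [hgl] at hX hY
    exact ⟨pow_mul_mem hp hε hX hB, cTildeForm_mem hp hε hX hY hB, brstComponent_mem hp hε hX hY hB,
      cTilde_eq_brst hp hε hpn hX hY hB⟩
  · rw [hgl] at hX hY hZ
    exact coboundary₂_cTilde hp hε hpn hX hY hZ hB
  · rw [hgl] at hX hY hZ
    exact coboundary₂_cReduced hp hε hpn hX hY hZ hB
  · rw [hgl] at hX hY
    rw [coboundary₁_etaTilde hp hε hpn hX hY hB, cReduced]
  · exact mulOp_mem_gl hp hL hpq hX
  · have hX' := hgl.1 (mulOp_mem_gl hp hL hpq hX)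
    have hY' := hgl.1 (mulOp_mem_gl hp hL hpq hY)
    rcases h with ⟨hXn, hYn⟩ | ⟨hXp, hYp⟩
    · exact cReduced_eq_zero hp hε hpn hX' hY' hB (by norm_num) (signOp_mul_dEven_of_negative hXn)
        (signOp_mul_dEven_of_negative hYn)
    · exact cReduced_eq_zero hp hε hpn hX' hY' hB (by norm_num) (signOp_mul_dEven_of_positive hXp)
        (signOp_mul_dEven_of_positive hYp)
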